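/- Let $(M,\omega)$ be a symplectic manifold with $H^1(M,\mathbb R)=0$, and let $L\to M$ be a pre-quantum line bundle, i.e. a Hermitian line bundle with a compatible connection $\nabla$ of curvature $-i\omega$; for an integer $k>0$ let $L^k$ carry the induced connection. Let $J_\sigma$ be a family of integrable almost complex structures on $M$, depending smoothly on a parameter $\sigma$ in a complex manifold $\mathcal T$, such that $(\omega,J_\sigma)$ is Kähler with metric $g_\sigma=\omega(\cdot,J_\sigma\cdot)$ and $(M,J_\sigma)$ has no non-constant holomorphic functions and no non-zero holomorphic vector fields. Write $\tilde g$ for the inverse of $g$ and, for $V$ tangent to $\mathcal T$, write $-V[\tilde g]=\tilde G(V)=G(V)+\overline G(V)$ for the decomposition into parts of type $(2,0)$ and $(0,2)$. Assume that the family is holomorphic ($G$ is of type $(1,0)$ as a form on $\mathcal T$) and rigid (each $G(V)$ is a holomorphic tensor field on $M$). Let $\lambda\in\mathbb R$ and let $F$ be a smooth real function on $M\times\mathcal T$ with $2i\partial\overline\partial F_\sigma=\rho_\sigma-\lambda\omega$, where $\rho_\sigma$ is the Ricci form. For a symmetric contravariant tensor $T=(T^{\mu\nu})$ put $\Delta_T=\nabla^2_T+\nabla_{\delta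 T}$, where $\nabla^2_T=T^{\mu\nu}\nabla_\mu\nabla_\nu$ and $(\delta T)^\nu=\nabla_\mu T^{\mu\nu}$ (Levi-Civita connection of $g_\sigma$), and let $$b(V)=\Delta_{G(V)}+2\nabla_{G(V)\cdot dF}-2\lambda V'[F],\qquad \overline b(V)=\Delta_{\overline G(V)}+2\nabla_{\overline G(V)\cdot dF}-2\lambda V''[F],$$ where $V'$, $V''$ are the $(1,0)$ and $(0,1)$ parts of $V$. For $t=k+is$, $s\in\mathbb R$, the Hitchin–Witten connection is $d_{\mathcal T}+\frac1{2t}b-\frac1{2\overline t}\overline b+d_{\mathcal T}F$ on $C^\infty(M,L^k)\times\mathcal T\to\mathcal T$; let $\nabla^{\mathrm{End}}$ be the induced connection on operators, and put $d^F_{\mathcal T}D=d_{\mathcal T}D+[d_{\mathcal T}F,D]$. Let $\Gamma$ be a group acting on $\mathcal T$ by diffeomorphisms and on $L\to M$ by bundle automorphisms preserving the Hermitian metric, the connection and $\omega$, such that $\sigma\mapsto J_\sigma$ is $\Gamma$-equivariant. For every smooth function $f\colon M\to\mathbb C$ independent of $\sigma$, let $C_f$ be the operator of multiplication by $f$ and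 let $$S^{(1)}(f)_\sigma=-\tfrac i2\bigl(2\nabla_{\tilde g\cdot df}+2\,df\cdot\tilde g\cdot dF+\Delta f\bigr),$$ with $\Delta$ the Laplace–Beltrami operator of $g_\sigma$. Then $S^{(1)}(f)$ is a smooth family, parametrised by $\mathcal T$, of differential operators of order at most $1$ on $L^k$, and: (1) it solves the first step of the recursion for a formal trivialisation in powers of $s^{-1}$: $d^F_{\mathcal T}S^{(1)}(f)=\frac i2[\,b+\overline b,C_f]$; (2) the map $f\mapsto S^{(1)}(f)$ is $\Gamma$-invariant: $\gamma\circ S^{(1)}(f)_\sigma\circ\gamma^{-1}=S^{(1)}(f\circ\gamma^{-1})_{\gamma\sigma}$ for all $\gamma\in\Gamma$; (3) for every $\sigma$ and every $V$ tangent to $\mathcal T$ at $\sigma$, $$\nabla^{\mathrm{End}}_V\bigl(C_f+S^{(1)}(f)\,s^{-1}\bigr)=o(|t|^{-1})\qquad\text{for } |t|\to\infty \text{ with } k \text{ fixed},$$ with respect to every seminorm on operators on $C^\infty(M,L^k)$ with values in $[0,\infty]$ that is finite on the left-hand side for all large $|s|$ (such as Sobolev operator norms, the sup-norm of the total symbol,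 or $D\mapsto\|D\psi\|_{L^2}$ for a fixed smooth section $\psi$, whenever they make sense). -/

import Mathlib

open Bundle Filter
open scoped Manifold ContDiff ENNReal TensorProduct

noncomputable section

namespace HitchinWitten

/-! ## Tensor calculus on a manifold -/

section Tensors

variable (E : Type*) [NormedAddCommGroup E] [NormedSpace ℝ E]
  (M : Type*) [TopologicalSpace M] [ChartedSpace E M] [IsManifold 𝓘(ℝ, E) ∞ M]

/-- (Not necessarily smooth) vector fields on `M`. -/
abbrev VecField := Π x : M, TangentSpace 𝓘(ℝ, E) x

/-- (Not necessarily smooth) real `1`-forms on `M`. -/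
abbrev OneForm := Π x : M, TangentSpace 𝓘(ℝ, E) x →L[ℝ] ℝ

/-- (Not necessarily smooth) fields of real bilinear forms on the tangent spaces of `M`. -/
abbrev BilinField :=
  Π x : M, TangentSpace 𝓘(ℝ, E) x →L[ℝ] TangentSpace 𝓘(ℝ, E) x →L[ℝ] ℝ

/-- (Not necessarily smooth) fields of endomorphisms of the tangent spaces of `M`. -/
abbrev EndField := Π x : M, TangentSpace 𝓘(ℝ, E) x →L[ℝ] TangentSpace 𝓘(ℝ, E) x

/-- Contravariant `2`-tensors `T`, seen as the maps `α ↦ T · α` from covectors to vectors. -/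
abbrev Bivector :=
  Π x : M, (TangentSpace 𝓘(ℝ, E) x →L[ℝ] ℝ) →L[ℝ] TangentSpace 𝓘(ℝ, E) x

/-- Operators taking a vector field `Y` to `u ↦ ∇_u Y`. -/
abbrev ConnOp := VecField E M → EndField E M

variable {E M}

/-- Smooth vector fields. -/
def SmoothVec (X : VecField E M) : Prop :=
  ContMDiff 𝓘(ℝ, E) (𝓘(ℝ, E).prod 𝓘(ℝ, E)) ∞
    (fun x => TotalSpace.mk' E (E := fun x : M => TangentSpace 𝓘(ℝ, E) x) x (X x))

/-- Vector fields that are differentiable at a point. -/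
def DiffVecAt (X : VecField E M) (x : M) : Prop :=
  MDifferentiableAt 𝓘(ℝ, E) (𝓘(ℝ, E).prod 𝓘(ℝ, E))
    (fun x => TotalSpace.mk' E (E := fun x : M => TangentSpace 𝓘(ℝ, E) x) x (X x)) x

/-- Smooth `1`-forms. -/
def SmoothOneForm (α : OneForm E M) : Prop :=
  ContMDiff 𝓘(ℝ, E) (𝓘(ℝ, E).prod 𝓘(ℝ, E →L[ℝ] ℝ)) ∞
    (fun x => TotalSpace.mk' (E →L[ℝ] ℝ)
      (E := fun x : M => TangentSpace 𝓘(ℝ, E) x →L[ℝ] ℝ) x (α x))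

/-- The differential of a real function. -/
def diff (f : M → ℝ) : OneForm E M := fun x => mvfderiv 𝓘(ℝ, E) f x

/-- The function `X[f]`. -/
def dirDeriv (X : VecField E M) (f : M → ℝ) : M → ℝ := fun x => diff f x (X x)

/-- The exterior derivative of a `1`-form, evaluated on two vector fields:
`dα(X, Y) = X[α(Y)] - Y[α(X)] - α([X, Y])`. -/
def extDeriv₁ (α : OneForm E M) (X Y : VecField E M) : M → ℝ := fun x =>
  dirDeriv X (fun y => α y (Y y)) x - dirDeriv Y (fun y => α y (X y)) x
    - α x (VectorField.mlieBracket 𝓘(ℝ, E) X Y x)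

/-- The exterior derivative of a `2`-form, evaluated on three vector fields. -/
def extDeriv₂ (Ω : BilinField E M) (X Y Z : VecField E M) : M → ℝ := fun x =>
  dirDeriv X (fun y => Ω y (Y y) (Z y)) x - dirDeriv Y (fun y => Ω y (X y) (Z y)) x
    + dirDeriv Z (fun y => Ω y (X y) (Y y)) x
    - Ω x (VectorField.mlieBracket 𝓘(ℝ, E) X Y x) (Z x)
    + Ω x (VectorField.mlieBracket 𝓘(ℝ, E) X Z x) (Y x)
    - Ω x (VectorField.mlieBracket 𝓘(ℝ, E) Y Z x) (X x)

variable (E M) in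
/-- `H¹(M, ℝ) = 0`, in de Rham form: every closed `1`-form is exact. -/
def TrivialH1 : Prop :=
  ∀ α : OneForm E M, SmoothOneForm α →
    (∀ X Y, SmoothVec X → SmoothVec Y → ∀ x, extDeriv₁ α X Y x = 0) →
    ∃ v : M → ℝ, ContMDiff 𝓘(ℝ, E) 𝓘(ℝ, ℝ) ∞ v ∧ α = diff v

/-- `Ω` is a symplectic form. -/
structure IsSymplectic (Ω : BilinField E M) : Prop where
  smooth : ContMDiff 𝓘(ℝ, E) (𝓘(ℝ, E).prod 𝓘(ℝ, E →L[ℝ] E →L[ℝ] ℝ)) ∞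
    (fun x => TotalSpace.mk' (E →L[ℝ] E →L[ℝ] ℝ)
      (E := fun x : M => TangentSpace 𝓘(ℝ, E) x →L[ℝ] TangentSpace 𝓘(ℝ, E) x →L[ℝ] ℝ) x (Ω x))
  alt : ∀ x u, Ω x u u = 0
  nondegenerate : ∀ x u, (∀ v, Ω x u v = 0) → u = 0
  closed : ∀ X Y Z, SmoothVec X → SmoothVec Y → SmoothVec Z → ∀ x, extDeriv₂ Ω X Y Z x = 0

/-- `D` is the Levi-Civita connection of the metric `g`: a covariant derivative on the tangent
bundle that has no torsion and preserves `g`. -/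
structure IsLeviCivita (g : BilinField E M) (D : ConnOp E M) : Prop where
  isCovariantDerivative : IsCovariantDerivativeOn E D Set.univ
  torsion_free : ∀ X Y x, DiffVecAt X x → DiffVecAt Y x →
    D Y x (X x) - D X x (Y x) = VectorField.mlieBracket 𝓘(ℝ, E) X Y x
  metric : ∀ Y Z x, DiffVecAt Y x → DiffVecAt Z x → ∀ u,
    diff (fun y => g y (Y y) (Z y)) x u = g x (D Y x u) (Z x) + g x (Y x) (D Z x u)

/-- The Levi-Civita connection of `g`; its value on differentiable vector fields is uniquely
determined by `IsLeviCivita`. -/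
def leviCivita (g : BilinField E M) : ConnOp E M :=
  letI : Nonempty (ConnOp E M) := ⟨fun _ _ => 0⟩
  Classical.epsilon (IsLeviCivita g)

/-- The inverse `g̃` of a metric `g`. -/
def invMetric (g : BilinField E M) : Bivector E M := fun x => ContinuousLinearMap.inverse (g x)

/-- The extension of a tangent vector at `x` to a vector field that is constant in the preferred
trivialisation of the tangent bundle at `x` (hence smooth near `x`). -/
def extendVec {x : M} (u : TangentSpace 𝓘(ℝ, E) x) : VecField E M :=
  FiberBundle.extend E u

/-- `(∇_u T)(α)` for a contravariant `2`-tensor `T` and the Levi-Civita connection of `g`. Here the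
covector `α` is extended to the `1`-form `g(A, ·)`, so that `∇_u (g(A, ·)) = g(∇_u A, ·)`. -/
def nablaBivector (g : BilinField E M) (T : Bivector E M) (x : M) (u : TangentSpace 𝓘(ℝ, E) x)
    (α : TangentSpace 𝓘(ℝ, E) x →L[ℝ] ℝ) : TangentSpace 𝓘(ℝ, E) x :=
  let A : VecField E M := extendVec (invMetric g x α)
  leviCivita g (fun y => T y (g y (A y))) x u - T x (g x (leviCivita g A x u))

/-- The curvature `R(u, v)w = ∇_u ∇_v w - ∇_v ∇_u w - ∇_{[u, v]} w` of `g`. -/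
def curvature (g : BilinField E M) (x : M) (u v w : TangentSpace 𝓘(ℝ, E) x) :
    TangentSpace 𝓘(ℝ, E) x :=
  leviCivita g (fun y => leviCivita g (extendVec w) y (extendVec v y)) x u
    - leviCivita g (fun y => leviCivita g (extendVec w) y (extendVec u y)) x v
    - leviCivita g (extendVec w) x (VectorField.mlieBracket 𝓘(ℝ, E) (extendVec u) (extendVec v) x)

variable [FiniteDimensional ℝ E]

/-- A basis of the tangent space at `x`. -/
def tbasis (x : M) : Module.Basis (Fin (Module.finrank ℝ E)) ℝ (TangentSpace 𝓘(ℝ, E) x) :=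
  (Module.finBasis ℝ E : Module.Basis (Fin (Module.finrank ℝ E)) ℝ E)

/-- The dual basis of `tbasis`. -/
def tcobasis (x : M) (i : Fin (Module.finrank ℝ E)) : TangentSpace 𝓘(ℝ, E) x →L[ℝ] ℝ :=
  (LinearMap.toContinuousLinearMap ((Module.finBasis ℝ E).coord i) : E →L[ℝ] ℝ)

/-- The Ricci tensor `Ric(v, w) = tr (u ↦ R(u, v)w)`. -/
def ricci (g : BilinField E M) (x : M) (v w : TangentSpace 𝓘(ℝ, E) x) : ℝ :=
  ∑ i, tcobasis x i (curvature g x (tbasis x i) v w)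

/-- The divergence `δT`, in coordinates `(δT)^ν = ∇_μ T^{μν}`, of a symmetric contravariant
`2`-tensor. -/
def divBivector (g : BilinField E M) (T : Bivector E M) : VecField E M := fun x =>
  ∑ i, nablaBivector g T x (tbasis x i) (tcobasis x i)

/-- The gradient `g̃ · df` of a real function. -/
def grad (g : BilinField E M) (f : M → ℝ) : VecField E M := fun x => invMetric g x (diff f x)

/-- The Laplace-Beltrami operator on real functions: `Δf = tr (u ↦ ∇_u (g̃ · df))`. -/
def laplacian (g : BilinField E M) (f : M → ℝ) : M → ℝ := fun x =>
  ∑ i, tcobasis x i (leviCivita g (grad g f) x (tbasis x i))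

end Tensors

/-! ## Families of Kähler structures -/

section Families

variable {E : Type*} [NormedAddCommGroup E] [NormedSpace ℝ E] [FiniteDimensional ℝ E]
  {M : Type*} [TopologicalSpace M] [ChartedSpace E M] [IsManifold 𝓘(ℝ, E) ∞ M]
  {P : Type*} [NormedAddCommGroup P] [NormedSpace ℂ P]
  {S : Type*} [TopologicalSpace S] [ChartedSpace P S]

/-- The metric `g(u, v) = Ω(u, J v)`. -/
def kahlerMetric (Ω : BilinField E M) (J : EndField E M) : BilinField E M := fun x =>
  (ContinuousLinearMap.precomp ℝ (J x)).comp (Ω x)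

/-- A smooth family `J_σ`, `σ ∈ S`, of integrable almost complex structures on `M` that form a
Kähler structure together with `Ω` and `g_σ = Ω · J_σ`. -/
structure IsKahlerFamily (Ω : BilinField E M) (J : S → EndField E M) : Prop where
  /-- `J` is smooth as a section of the pull-back of `End(TM)` to `S × M`. -/
  smooth : ContMDiff (𝓘(ℝ, P).prod 𝓘(ℝ, E)) (𝓘(ℝ, E).prod 𝓘(ℝ, E →L[ℝ] E)) ∞
    (fun p : S × M => TotalSpace.mk' (E →L[ℝ] E)
      (E := fun x : M => TangentSpace 𝓘(ℝ, E) x →L[ℝ] TangentSpace 𝓘(ℝ, E) x) p.2 (J p.1 p.2))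
  sq : ∀ σ x u, J σ x (J σ x u) = -u
  /-- The Nijenhuis tensor vanishes. -/
  integrable : ∀ σ X Y, SmoothVec X → SmoothVec Y → ∀ x,
    VectorField.mlieBracket 𝓘(ℝ, E) (fun y => J σ y (X y)) (fun y => J σ y (Y y)) x
      - J σ x (VectorField.mlieBracket 𝓘(ℝ, E) (fun y => J σ y (X y)) Y x)
      - J σ x (VectorField.mlieBracket 𝓘(ℝ, E) X (fun y => J σ y (Y y)) x)
      - VectorField.mlieBracket 𝓘(ℝ, E) X Y x = 0
  symm : ∀ σ x u v, kahlerMetric Ω (J σ) x u v = kahlerMetric Ω (J σ) x v u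
  pos : ∀ σ x u, u ≠ 0 → 0 < kahlerMetric Ω (J σ) x u u

/-- `J` admits only constant holomorphic functions. -/
def OnlyConstHolFun (J : EndField E M) : Prop :=
  ∀ h : M → ℂ, ContMDiff 𝓘(ℝ, E) 𝓘(ℝ, ℂ) ∞ h →
    (∀ x u, mvfderiv 𝓘(ℝ, E) h x (J x u) = Complex.I * mvfderiv 𝓘(ℝ, E) h x u) →
    ∃ c, ∀ x, h x = c

/-- `J` admits no holomorphic vector field but `0`. Holomorphic sections of `T^(1,0)M` are
identified with their real parts, that is with the real vector fields `X` with `L_X J = 0`. -/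
def OnlyZeroHolVec (J : EndField E M) : Prop :=
  ∀ X, SmoothVec X →
    (∀ Y, SmoothVec Y → ∀ x, VectorField.mlieBracket 𝓘(ℝ, E) X (fun y => J y (Y y)) x
      = J x (VectorField.mlieBracket 𝓘(ℝ, E) X Y x)) →
    ∀ x, X x = 0

/-- `V[F_σ](x)`, the derivative of a family of functions along a vector tangent to `S`. -/
def paramDeriv (F : S → M → ℝ) (σ : S) (V : TangentSpace 𝓘(ℝ, P) σ) : M → ℝ := fun x =>
  mvfderiv 𝓘(ℝ, P) (fun τ => F τ x) σ V

/-- `G̃(V) = -V[g̃]`. -/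
def Gtilde (Ω : BilinField E M) (J : S → EndField E M) (σ : S) (V : TangentSpace 𝓘(ℝ, P) σ) :
    Bivector E M := fun x =>
  -(mvfderiv (F := (E →L[ℝ] ℝ) →L[ℝ] E) 𝓘(ℝ, P)
      (fun τ => invMetric (kahlerMetric Ω (J τ)) x) σ V)

/-- The real part of `G(V)`, the `(2,0)`-part of `G̃(V)`. As `G̃(V)` has no `(1,1)`-part,
`G(V) = ½ (1 - i J) G̃(V)`; its conjugate `Ḡ(V) = ½ (1 + i J) G̃(V)` is the `(0,2)`-part. -/
def Gre (Ω : BilinField E M) (J : S → EndField E M) (σ : S) (V : TangentSpace 𝓘(ℝ, P) σ) :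
    Bivector E M := fun x =>
  (1 / 2 : ℝ) • Gtilde Ω J σ V x

/-- The imaginary part of `G(V)`, see `Gre`. -/
def Gim (Ω : BilinField E M) (J : S → EndField E M) (σ : S) (V : TangentSpace 𝓘(ℝ, P) σ) :
    Bivector E M := fun x =>
  -((1 / 2 : ℝ) • (J σ x).comp (Gtilde Ω J σ V x))

/-- The vector `iV`, for `V` tangent to the complex manifold `S`. -/
def mulI {σ : S} (V : TangentSpace 𝓘(ℝ, P) σ) : TangentSpace 𝓘(ℝ, P) σ :=
  Complex.I • (show P from V)

/-- The family `J` is holomorphic: `G` is of type `(1,0)` as a form on `S`, i.e.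
`G(iV) = i G(V)` (the condition that `Ḡ` is of type `(0,1)` is the complex conjugate). -/
def IsHolomorphicFamily (Ω : BilinField E M) (J : S → EndField E M) : Prop :=
  ∀ (σ : S) (V : TangentSpace 𝓘(ℝ, P) σ) (x : M),
    Gre Ω J σ (mulI V) x = -Gim Ω J σ V x ∧ Gim Ω J σ (mulI V) x = Gre Ω J σ V x

/-- The family `J` is rigid: each `G(V)` is a holomorphic tensor field on `M`, i.e.
`∇_{u + iJu} G(V) = 0` for all `u`. -/
def IsRigidFamily (Ω : BilinField E M) (J : S → EndField E M) : Prop :=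
  ∀ (σ : S) (V : TangentSpace 𝓘(ℝ, P) σ) (x : M) (u : TangentSpace 𝓘(ℝ, E) x)
    (α : TangentSpace 𝓘(ℝ, E) x →L[ℝ] ℝ),
    nablaBivector (kahlerMetric Ω (J σ)) (Gre Ω J σ V) x u α
      = nablaBivector (kahlerMetric Ω (J σ)) (Gim Ω J σ V) x (J σ x u) α ∧
    nablaBivector (kahlerMetric Ω (J σ)) (Gim Ω J σ V) x u α
      = -nablaBivector (kahlerMetric Ω (J σ)) (Gre Ω J σ V) x (J σ x u) α

/-- The real `2`-form `2i ∂∂̄F = 2i d∂̄F`, evaluated on two vector fields. Since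
`∂̄F = ½ (dF + i dF ∘ J)`, it is `-d(dF ∘ J)`. -/
def ddbar (J : EndField E M) (F : M → ℝ) (X Y : VecField E M) : M → ℝ := fun x =>
  -extDeriv₁ (fun y => (diff F y).comp (J y)) X Y x

/-- `F` is a smooth family of Ricci potentials: `2i ∂∂̄F_σ = ρ_σ - lam Ω`, where
`ρ(u, v) = Ric(Ju, v)` is the Ricci form. -/
structure IsRicciPotential (Ω : BilinField E M) (J : S → EndField E M) (lam : ℝ)
    (F : S → M → ℝ) : Prop where
  smooth : ContMDiff (𝓘(ℝ, P).prod 𝓘(ℝ, E)) 𝓘(ℝ, ℝ) ∞ (fun p : S × M => F p.1 p.2)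
  eq : ∀ σ X Y, SmoothVec X → SmoothVec Y → ∀ x,
    ddbar (J σ) (F σ) X Y x
      = ricci (kahlerMetric Ω (J σ)) x (J σ x (X x)) (Y x) - lam * Ω x (X x) (Y x)

end Families

/-! ## The pre-quantum line bundle and its tensor powers -/

section LineBundle

variable {E : Type*} [NormedAddCommGroup E] [NormedSpace ℝ E] [FiniteDimensional ℝ E]
  {M : Type*} [TopologicalSpace M] [ChartedSpace E M] [IsManifold 𝓘(ℝ, E) ∞ M]
  (L : M → Type*) [∀ x, AddCommGroup (L x)] [∀ x, Module ℂ (L x)]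
  [∀ x, TopologicalSpace (L x)] [∀ x, IsTopologicalAddGroup (L x)] [∀ x, ContinuousSMul ℝ (L x)]
  [TopologicalSpace (TotalSpace ℂ L)] [FiberBundle ℂ L] [VectorBundle ℝ ℂ L] [VectorBundle ℂ ℂ L]

variable {L} in
/-- Smooth sections of `L`. -/
def SmoothSec (s : Π x, L x) : Prop :=
  ContMDiff 𝓘(ℝ, E) (𝓘(ℝ, E).prod 𝓘(ℝ, ℂ)) ∞ (fun x => TotalSpace.mk' ℂ x (s x))

/-- The structure of a pre-quantum line bundle for `Ω` on the smooth complex line bundle `L`: a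
Hermitian metric and a compatible connection with curvature `-i Ω`. -/
structure Prequantum (Ω : BilinField E M) where
  /-- The Hermitian metric. -/
  herm : Π x, L x → L x → ℂ
  /-- The connection. -/
  conn : CovariantDerivative 𝓘(ℝ, E) ℂ L
  herm_add : ∀ x a b c, herm x a (b + c) = herm x a b + herm x a c
  herm_smul : ∀ x (z : ℂ) a b, herm x a (z • b) = z * herm x a b
  herm_symm : ∀ x a b, herm x b a = (starRingEnd ℂ) (herm x a b)
  herm_pos : ∀ x a, a ≠ 0 → 0 < (herm x a a).re
  herm_smooth : ∀ s s' : Π x, L x, SmoothSec (E := E) s → SmoothSec (E := E) s' →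
    ContMDiff 𝓘(ℝ, E) 𝓘(ℝ, ℂ) ∞ (fun x => herm x (s x) (s' x))
  conn_smooth : conn.ContMDiffCovariantDerivative ∞
  conn_complex : ∀ s : Π x, L x, SmoothSec (E := E) s → ∀ x u,
    conn (fun y => Complex.I • s y) x u = Complex.I • conn s x u
  conn_herm : ∀ s s' : Π x, L x, SmoothSec (E := E) s → SmoothSec (E := E) s' → ∀ x u,
    mvfderiv 𝓘(ℝ, E) (fun y => herm y (s y) (s' y)) x u
      = herm x (conn s x u) (s' x) + herm x (s x) (conn s' x u)
  curvature : ∀ (X Y : VecField E M) (s : Π x, L x), SmoothVec X → SmoothVec Y →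
    SmoothSec (E := E) s → ∀ x,
    conn (fun y => conn s y (Y y)) x (X x) - conn (fun y => conn s y (X y)) x (Y x)
      - conn s x (VectorField.mlieBracket 𝓘(ℝ, E) X Y x)
      = (-(Complex.I * (Ω x (X x) (Y x) : ℂ))) • s x

/-- The fibre of `L^k` at `x`. -/
abbrev LPow (k : ℕ) (x : M) := ⨂[ℂ] _ : Fin k, L x

/-- (Not necessarily smooth) sections of `L^k`. -/
abbrev Sec (k : ℕ) := Π x : M, LPow L k x

/-- Operators on sections of `L^k`. -/
abbrev Op (k : ℕ) := Sec L k → Sec L k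

variable {L}

/-- The coordinate on the fibre of `L^k` at `y` induced by the preferred local trivialisation of
`L` at `x₀`: it maps `a₁ ⊗ ⋯ ⊗ a_k` to the product of the coordinates of the `a_j`. -/
def coord (k : ℕ) (x₀ y : M) : LPow L k y →ₗ[ℂ] ℂ :=
  PiTensorProduct.lift ((MultilinearMap.mkPiAlgebra ℂ (Fin k) ℂ).compLinearMap
    fun _ => (trivializationAt ℂ L x₀).linearMapAt ℂ y)

/-- The local frame `e` of `L` given by the preferred local trivialisation at `x₀`. -/
def frame (x₀ : M) : Π y, L y := fun y => (trivializationAt ℂ L x₀).symm y (1 : ℂ)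

/-- The element `e(x) ⊗ ⋯ ⊗ e(x)` of the fibre of `L^k` at `x`, with `e = frame x`. -/
def framePow (k : ℕ) (x : M) : LPow L k x := PiTensorProduct.tprod ℂ fun _ => frame x x

/-- Smooth sections of `L^k`. -/
def SmoothPow {k : ℕ} (ψ : Sec L k) : Prop :=
  ∀ x₀ : M, ContMDiffAt 𝓘(ℝ, E) 𝓘(ℝ, ℂ) ∞ (fun y => coord k x₀ y (ψ y)) x₀

/-- The connection on `L^k` induced by a connection on `L`:
`∇_u (h e^k) = (dh(u) + k θ(u) h) e^k`, where `∇_u e = θ(u) e`. -/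
def nabla {k : ℕ} (conn : CovariantDerivative 𝓘(ℝ, E) ℂ L) (ψ : Sec L k) (x : M)
    (u : TangentSpace 𝓘(ℝ, E) x) : LPow L k x :=
  (mvfderiv 𝓘(ℝ, E) (fun y => coord k x y (ψ y)) x u
    + k * (trivializationAt ℂ L x).linearMapAt ℂ x (conn (frame x) x u) * coord k x x (ψ x))
    • framePow k x

/-- `∇_{A + iB}`, for the complex vector field `A + iB`. -/
def nablaC {k : ℕ} (conn : CovariantDerivative 𝓘(ℝ, E) ℂ L) (A B : VecField E M) : Op L k :=
  fun ψ x => nabla conn ψ x (A x) + Complex.I • nabla conn ψ x (B x)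

/-- The second covariant derivative `∇²_{u,v} ψ = ∇_u ∇_v ψ - ∇_{∇_u v} ψ`. -/
def hess {k : ℕ} (conn : CovariantDerivative 𝓘(ℝ, E) ℂ L) (g : BilinField E M) (ψ : Sec L k)
    (x : M) (u v : TangentSpace 𝓘(ℝ, E) x) : LPow L k x :=
  nabla conn (fun y => nabla conn ψ y (extendVec v y)) x u
    - nabla conn ψ x (leviCivita g (extendVec v) x u)

/-- The operator `Δ_T = ∇²_T + ∇_{δT}`, where `∇²_T = T^{μν} ∇_μ ∇_ν`. -/
def lap {k : ℕ} (conn : CovariantDerivative 𝓘(ℝ, E) ℂ L) (g : BilinField E M) (T : Bivector E M) :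
    Op L k := fun ψ x =>
  ∑ i, hess conn g ψ x (tbasis x i) (T x (tcobasis x i)) + nabla conn ψ x (divBivector g T x)

/-- `Δ_{A + iB}` for the complex tensor `A + iB`. -/
def lapC {k : ℕ} (conn : CovariantDerivative 𝓘(ℝ, E) ℂ L) (g : BilinField E M)
    (A B : Bivector E M) : Op L k := fun ψ x =>
  lap conn g A ψ x + Complex.I • lap conn g B ψ x

/-- The curve operator: multiplication by the function `f`. -/
def mulOp {k : ℕ} (f : M → ℂ) : Op L k := fun ψ x => f x • ψ x

/-- The commutator of two operators. -/
def comm {k : ℕ} (A B : Op L k) : Op L k := fun ψ => A (B ψ) - B (A ψ)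

variable (E) in
/-- `D` is a (linear) differential operator of order at most `n` on the smooth sections of `L^k`. -/
def IsDiffOp {k : ℕ} : ℕ → Op L k → Prop
  | 0, D => (∀ ψ, SmoothPow (E := E) ψ → SmoothPow (E := E) (D ψ)) ∧
      (∀ ψ φ, SmoothPow (E := E) ψ → SmoothPow (E := E) φ → D (ψ + φ) = D ψ + D φ) ∧
      (∀ f : M → ℂ, ContMDiff 𝓘(ℝ, E) 𝓘(ℝ, ℂ) ∞ f → ∀ ψ, SmoothPow (E := E) ψ →
        D (mulOp f ψ) = mulOp f (D ψ))
  | n + 1, D => (∀ ψ, SmoothPow (E := E) ψ → SmoothPow (E := E) (D ψ)) ∧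
      (∀ ψ φ, SmoothPow (E := E) ψ → SmoothPow (E := E) φ → D (ψ + φ) = D ψ + D φ) ∧
      (∀ (c : ℂ) ψ, SmoothPow (E := E) ψ → D (c • ψ) = c • D ψ) ∧
      (∀ f : M → ℂ, ContMDiff 𝓘(ℝ, E) 𝓘(ℝ, ℂ) ∞ f → IsDiffOp n (comm D (mulOp f)))

end LineBundle

/-! ## The Hitchin-Witten connection -/

section Connection

variable {E : Type*} [NormedAddCommGroup E] [NormedSpace ℝ E] [FiniteDimensional ℝ E]
  {M : Type*} [TopologicalSpace M] [ChartedSpace E M] [IsManifold 𝓘(ℝ, E) ∞ M]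
  {P : Type*} [NormedAddCommGroup P] [NormedSpace ℂ P]
  {S : Type*} [TopologicalSpace S] [ChartedSpace P S]
  {L : M → Type*} [∀ x, AddCommGroup (L x)] [∀ x, Module ℂ (L x)]
  [∀ x, TopologicalSpace (L x)] [∀ x, IsTopologicalAddGroup (L x)] [∀ x, ContinuousSMul ℝ (L x)]
  [TopologicalSpace (TotalSpace ℂ L)] [FiberBundle ℂ L] [VectorBundle ℝ ℂ L] [VectorBundle ℂ ℂ L]

/-- `V'[F] = ½ (V[F] - i (iV)[F])`, where `V'` is the `(1,0)`-part of `V`. -/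
def derivHol (F : S → M → ℝ) (σ : S) (V : TangentSpace 𝓘(ℝ, P) σ) : M → ℂ := fun x =>
  (1 / 2 : ℂ) * (paramDeriv F σ V x - Complex.I * paramDeriv F σ (mulI V) x)

/-- `V''[F] = ½ (V[F] + i (iV)[F])`, where `V''` is the `(0,1)`-part of `V`. -/
def derivAntihol (F : S → M → ℝ) (σ : S) (V : TangentSpace 𝓘(ℝ, P) σ) : M → ℂ := fun x =>
  (1 / 2 : ℂ) * (paramDeriv F σ V x + Complex.I * paramDeriv F σ (mulI V) x)

/-- `b(V) = Δ_{G(V)} + 2 ∇_{G(V) · dF} - 2 lam V'[F]`. -/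
def bOp {k : ℕ} (conn : CovariantDerivative 𝓘(ℝ, E) ℂ L) (Ω : BilinField E M)
    (J : S → EndField E M) (lam : ℝ) (F : S → M → ℝ) (σ : S) (V : TangentSpace 𝓘(ℝ, P) σ) :
    Op L k := fun ψ =>
  lapC conn (kahlerMetric Ω (J σ)) (Gre Ω J σ V) (Gim Ω J σ V) ψ
    + (2 : ℂ) • nablaC conn (fun x => Gre Ω J σ V x (diff (F σ) x))
        (fun x => Gim Ω J σ V x (diff (F σ) x)) ψ
    - (2 * lam : ℂ) • mulOp (derivHol F σ V) ψ

/-- `b̄(V) = Δ_{Ḡ(V)} + 2 ∇_{Ḡ(V) · dF} - 2 lam V''[F]`. -/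
def bBarOp {k : ℕ} (conn : CovariantDerivative 𝓘(ℝ, E) ℂ L) (Ω : BilinField E M)
    (J : S → EndField E M) (lam : ℝ) (F : S → M → ℝ) (σ : S) (V : TangentSpace 𝓘(ℝ, P) σ) :
    Op L k := fun ψ =>
  lapC conn (kahlerMetric Ω (J σ)) (Gre Ω J σ V) (-Gim Ω J σ V) ψ
    + (2 : ℂ) • nablaC conn (fun x => Gre Ω J σ V x (diff (F σ) x))
        (fun x => -Gim Ω J σ V x (diff (F σ) x)) ψ
    - (2 * lam : ℂ) • mulOp (derivAntihol F σ V) ψ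

/-- Multiplication by `V[F]`. -/
def dFOp {k : ℕ} (F : S → M → ℝ) (σ : S) (V : TangentSpace 𝓘(ℝ, P) σ) : Op L k :=
  mulOp fun x => (paramDeriv F σ V x : ℂ)

/-- The derivative `V[D]` of a family of operators:
`(V[D] ψ)(x)` is the derivative of `σ ↦ (D_σ ψ)(x)`, a map into the fibre at `x`. -/
def derivOp {k : ℕ} (D : S → Op L k) (σ : S) (V : TangentSpace 𝓘(ℝ, P) σ) : Op L k := fun ψ x =>
  mvfderiv 𝓘(ℝ, P) (fun τ => coord k x x (D τ ψ x)) σ V • framePow k x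

/-- The twisted derivative `V[D] + [V[F], D]` of a family of operators. -/
def twistedDeriv {k : ℕ} (F : S → M → ℝ) (D : S → Op L k) (σ : S) (V : TangentSpace 𝓘(ℝ, P) σ) :
    Op L k :=
  derivOp D σ V + comm (dFOp F σ V) (D σ)

/-- The quantum parameter `t = k + is`. -/
def level (k : ℕ) (s : ℝ) : ℂ := k + Complex.I * s

/-- The connection form `(1/2t) b - (1/2t̄) b̄ + d_S F` of the Hitchin-Witten connection at level
`t = k + is`. -/
def hwForm {k : ℕ} (conn : CovariantDerivative 𝓘(ℝ, E) ℂ L) (Ω : BilinField E M)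
    (J : S → EndField E M) (lam : ℝ) (F : S → M → ℝ) (s : ℝ) (σ : S)
    (V : TangentSpace 𝓘(ℝ, P) σ) : Op L k := fun ψ =>
  (1 / (2 * level k s)) • bOp conn Ω J lam F σ V ψ
    - (1 / (2 * (starRingEnd ℂ) (level k s))) • bBarOp conn Ω J lam F σ V ψ + dFOp F σ V ψ

/-- The covariant derivative along `V` of a family `D` of operators, with respect to the connection
induced by the Hitchin-Witten connection on endomorphisms. -/
def hwDeriv {k : ℕ} (conn : CovariantDerivative 𝓘(ℝ, E) ℂ L) (Ω : BilinField E M)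
    (J : S → EndField E M) (lam : ℝ) (F : S → M → ℝ) (s : ℝ) (D : S → Op L k) (σ : S)
    (V : TangentSpace 𝓘(ℝ, P) σ) : Op L k :=
  derivOp D σ V + comm (hwForm conn Ω J lam F s σ V) (D σ)

/-- The operator
`S⁽¹⁾(f)_σ = -(i/2) (2 ∇_{g̃·df} + 2 df·g̃·dF + Δf)`; objects attached to the complex function `f`
are the complex linear extensions of those attached to real functions. -/
def firstSolution {k : ℕ} (conn : CovariantDerivative 𝓘(ℝ, E) ℂ L) (Ω : BilinField E M)
    (J : S → EndField E M) (F : S → M → ℝ) (f : M → ℂ) (σ : S) : Op L k :=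
  let g := kahlerMetric Ω (J σ)
  let f₁ : M → ℝ := fun x => (f x).re
  let f₂ : M → ℝ := fun x => (f x).im
  fun ψ => (-(Complex.I / 2)) •
    ((2 : ℂ) • nablaC conn (grad g f₁) (grad g f₂) ψ
      + (2 : ℂ) • mulOp (fun x => diff (F σ) x (grad g f₁ x)
          + Complex.I * diff (F σ) x (grad g f₂ x)) ψ
      + mulOp (fun x => laplacian g f₁ x + Complex.I * laplacian g f₂ x) ψ)

variable (E P) in
/-- The family `D` of operators depends smoothly on the parameter: for every smooth section `ψ`,
`D ψ` is a smooth section of the pull-back of `L^k` to `S × M`. -/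
def SmoothFamily {k : ℕ} (D : S → Op L k) : Prop :=
  ∀ ψ, SmoothPow (E := E) ψ → ∀ (σ₀ : S) (x₀ : M),
    ContMDiffAt (𝓘(ℝ, P).prod 𝓘(ℝ, E)) 𝓘(ℝ, ℂ) ∞
      (fun p : S × M => coord k x₀ p.2 (D p.1 ψ p.2)) (σ₀, x₀)

/-- Seminorms with values in `[0, ∞]` on a complex vector space. -/
structure ExtSeminorm (W : Type*) [AddCommGroup W] [Module ℂ W] where
  /-- The underlying function. -/
  toFun : W → ℝ≥0∞
  add_le : ∀ a b, toFun (a + b) ≤ toFun a + toFun b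
  smul : ∀ (c : ℂ) a, toFun (c • a) = ‖c‖ₑ * toFun a

variable (E L) in
/-- Maps from smooth sections of `L^k` to sections of `L^k`. -/
abbrev SmoothOp (k : ℕ) := {ψ : Sec L k // SmoothPow (E := E) ψ} → Sec L k

/-- The restriction of an operator to smooth sections. -/
def onSmooth {k : ℕ} (D : Op L k) : SmoothOp E L k := fun ψ => D ψ.1

variable (E) in
/-- `D_s = o(1/|t|)` for `t = k + is → ∞` with `k` fixed, with respect to every seminorm on
operators in which it makes sense, i.e. that is finite on `D_s` for all large `|s|`. Examples
of such seminorms are operator norms between Sobolev spaces, the sup-norm of the total symbol of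
differential operators (both with value `⊤` on those maps where they are not defined), and, for the
notion of strong convergence, the `L²`-norm of the value at a smooth section. -/
def IsLittleOInvLevel {k : ℕ} (D : ℝ → Op L k) : Prop :=
  ∀ N : ExtSeminorm (SmoothOp E L k),
    (∀ᶠ s in Bornology.cobounded ℝ, N.toFun (onSmooth (D s)) ≠ ⊤) →
    (fun s => (N.toFun (onSmooth (D s))).toReal) =o[Bornology.cobounded ℝ]
      (fun s => 1 / ‖level k s‖)

/-! ## Symmetries -/

variable (L) in
/-- An action of the group `Γ` on the line bundle `L` and on the parameter space `S`: `Γ` acts on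
`M` and `S` by diffeomorphisms and on `L`, over its action on `M`, by linear maps that preserve the
pre-quantum structure, and the family `J` is equivariant. -/
structure Symmetry (Γ : Type*) [Group Γ] [MulAction Γ M] [MulAction Γ S]
    (Ω : BilinField E M) (B : Prequantum L Ω) (J : S → EndField E M) where
  /-- The action on the fibres of `L`. -/
  act : Π (γ : Γ) (x : M), L x →ₗ[ℂ] L (γ • x)
  act_one : ∀ (x : M) (a : L x),
    (⟨(1 : Γ) • x, act 1 x a⟩ : TotalSpace ℂ L) = ⟨x, a⟩
  act_mul : ∀ (γ γ' : Γ) (x : M) (a : L x),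
    (⟨(γ * γ') • x, act (γ * γ') x a⟩ : TotalSpace ℂ L)
      = ⟨γ • γ' • x, act γ (γ' • x) (act γ' x a)⟩
  smooth_param : ∀ γ : Γ, ContMDiff 𝓘(ℝ, P) 𝓘(ℝ, P) ∞ (fun σ : S => γ • σ)
  smooth_base : ∀ γ : Γ, ContMDiff 𝓘(ℝ, E) 𝓘(ℝ, E) ∞ (fun x : M => γ • x)
  smooth_act : ∀ γ : Γ, ContMDiff (𝓘(ℝ, E).prod 𝓘(ℝ, ℂ)) (𝓘(ℝ, E).prod 𝓘(ℝ, ℂ)) ∞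
    (fun p : TotalSpace ℂ L => (⟨γ • p.1, act γ p.1 p.2⟩ : TotalSpace ℂ L))
  symplectic : ∀ (γ : Γ) (x : M) (u v : TangentSpace 𝓘(ℝ, E) x),
    Ω (γ • x) (mfderiv 𝓘(ℝ, E) 𝓘(ℝ, E) (fun y : M => γ • y) x u)
      (mfderiv 𝓘(ℝ, E) 𝓘(ℝ, E) (fun y : M => γ • y) x v) = Ω x u v
  herm_inv : ∀ (γ : Γ) (x : M) (a b : L x),
    B.herm (γ • x) (act γ x a) (act γ x b) = B.herm x a b
  conn_inv : ∀ (γ : Γ) (s s' : Π x, L x), SmoothSec (E := E) s → SmoothSec (E := E) s' →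
    (∀ x, s' (γ • x) = act γ x (s x)) → ∀ (x : M) (u : TangentSpace 𝓘(ℝ, E) x),
    B.conn s' (γ • x) (mfderiv 𝓘(ℝ, E) 𝓘(ℝ, E) (fun y : M => γ • y) x u)
      = act γ x (B.conn s x u)
  equivariant : ∀ (γ : Γ) (σ : S) (x : M) (u : TangentSpace 𝓘(ℝ, E) x),
    J (γ • σ) (γ • x) (mfderiv 𝓘(ℝ, E) 𝓘(ℝ, E) (fun y : M => γ • y) x u)
      = mfderiv 𝓘(ℝ, E) 𝓘(ℝ, E) (fun y : M => γ • y) x (J σ x u)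

/-- The induced action on the fibres of `L^k`. -/
def Symmetry.actPow {Γ : Type*} [Group Γ] [MulAction Γ M] [MulAction Γ S]
    {Ω : BilinField E M} {B : Prequantum L Ω} {J : S → EndField E M}
    (A : Symmetry (P := P) L Γ Ω B J) (k : ℕ) (γ : Γ) (x : M) : LPow L k x →ₗ[ℂ] LPow L k (γ • x) :=
  PiTensorProduct.map fun _ => A.act γ x

/-- A map `f ↦ D(f)` from functions on `M` to families of operators on `L^k` is `Γ`-invariant:
`γ ∘ D(f)_σ = D(γ·f)_{γσ} ∘ γ` on smooth sections, for all smooth `f`. Here `(γ·f)(x) = f(γ⁻¹x)`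
and the action on sections is `(γψ)(γx) = γ(ψ(x))`. -/
def Symmetry.Invariant {Γ : Type*} [Group Γ] [MulAction Γ M] [MulAction Γ S]
    {Ω : BilinField E M} {B : Prequantum L Ω} {J : S → EndField E M}
    (A : Symmetry (P := P) L Γ Ω B J) {k : ℕ} (D : (M → ℂ) → S → Op L k) : Prop :=
  ∀ (γ : Γ) (f : M → ℂ), ContMDiff 𝓘(ℝ, E) 𝓘(ℝ, ℂ) ∞ f → ∀ (σ : S) (ψ ψ' : Sec L k),
    SmoothPow (E := E) ψ → (∀ x, ψ' (γ • x) = A.actPow k γ x (ψ x)) →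
    ∀ x, D (fun y => f (γ⁻¹ • y)) (γ • σ) ψ' (γ • x) = A.actPow k γ x (D f σ ψ x)

end Connection

end HitchinWitten

end

/-! The recursion says that one derivative in `σ` equals one commutator, and both are governed by
the bivector `Gtilde`. By complex linearity (`firstSolution_eq`) it suffices to treat real `f`.

Derivative side. Since `g = Ω(·, J·)`, the inverse metric is `J` composed with the inverse of `Ω`,
which does not move (`IsCompatible.invMetric_kahler`). Hence the gradient of `f` varies by
`-G̃(V)·df` (`famDeriv_grad`). The delicate term is `Δf`, because the Levi-Civita connection varies
as well. But the divergence of a vector field `X` is half the `Ω`-trace of the Lie derivative of `Ω`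
along `X`, as in Liouville's theorem, and so does not depend on `J` (`divg_eq_sympDiv`,
`divg_eq_divg`). The connection may therefore be frozen at `σ`, which gives `V[Δf] = -div(G̃(V)·df)`
(`paramDeriv_laplacian`).

Commutator side. In a local frame with its dual coframe, `Δ_T` takes a divergence form (`lap_eq`),
from which `[Δ_T, f] = div(T·df) + 2∇_{T·df}` follows for symmetric `T` (`lap_mulOp_ofReal`). In `b
+ b̄` the imaginary parts cancel and the term with `lam` commutes with `f`, so `[b + b̄, f] =
div(G̃·df) + 2∇_{G̃·df} + 2dF·G̃·df` (`comm_bOp_add_bBarOp`). This is what differentiating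
`firstSolution` produces, up to the factor `i/2` and one extra term `d(V[F])·g̃·df`, which the
commutator with `V[F]` removes (`twistedDeriv_realSolution`).

Asymptotics. Once the recursion holds, `it = ik - s` and `it̄ = ik + s` turn the covariant
derivative of `C_f + S⁽¹⁾(f)/s` into `u/(2ts) + v/(2t̄s)` with operators `u`, `v` independent of `s`
(`hwDeriv_firstSolution`). A seminorm that is finite on this combination for two suitable values of
`s` is finite on `u` and `v`, and the combination is then `O(1/(|t||s|))`
(`ExtSeminorm.isLittleO_level`).

Invariance. An element of `Γ` acts as an isometry from `g_σ` to `g_{γσ}`, so gradients, Laplacians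
and the connection on `L^k` are transported. The potential `F` is not assumed to be equivariant, but
only `dF` occurs. The difference of the transported potentials is pluriharmonic because Ricci forms
are natural; since `H¹ = 0` it is the real part of a holomorphic function, hence constant
(`diff_eq_zero_of_ddbar`, `diff_potential_dmap`). -/

open Bundle Filter
open scoped Manifold ContDiff ENNReal TensorProduct

noncomputable section

set_option linter.unusedSectionVars false

namespace HitchinWitten

open VectorField

/-! ### The Koszul expression and its tensoriality. -/

section Koszul

variable {E : Type*} [NormedAddCommGroup E] [NormedSpace ℝ E]
  {M : Type*} [TopologicalSpace M] [ChartedSpace E M] [IsManifold 𝓘(ℝ, E) ∞ M]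

/-- Vector fields that are smooth at a point. -/
def SmoothVecAt (X : VecField E M) (x : M) : Prop :=
  ContMDiffAt 𝓘(ℝ, E) (𝓘(ℝ, E).prod 𝓘(ℝ, E)) ∞
    (fun x => TotalSpace.mk' E (E := fun x : M => TangentSpace 𝓘(ℝ, E) x) x (X x)) x

lemma SmoothVec.smoothVecAt {X : VecField E M} (h : SmoothVec X) (x : M) : SmoothVecAt X x := h x

lemma SmoothVecAt.diffVecAt {X : VecField E M} {x : M} (h : SmoothVecAt X x) : DiffVecAt X x :=
  ContMDiffAt.mdifferentiableAt h (by simp)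

lemma SmoothVecAt.eventually_diffVecAt {X : VecField E M} {x : M} (h : SmoothVecAt X x) :
    ∀ᶠ y in nhds x, DiffVecAt X y := by
  have h1 := (contMDiffAt_iff_contMDiffAt_nhds (n := 1) (by simp)).1
    (ContMDiffAt.of_le (m := 1) (n := (∞ : ℕ∞ω)) h (by norm_cast))
  exact h1.mono fun y hy => hy.mdifferentiableAt (by simp)

/-- A non-degenerate bilinear form that pairs differentiable (smooth) vector fields to
differentiable (smooth) functions. -/
structure IsNondegForm (g : BilinField E M) : Prop where
  nondegenerate : ∀ x u, (∀ v, g x u v = 0) → u = 0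
  mdiff : ∀ {Y Z : VecField E M} {x : M}, DiffVecAt Y x → DiffVecAt Z x →
    MDifferentiableAt 𝓘(ℝ, E) 𝓘(ℝ, ℝ) (fun y => g y (Y y) (Z y)) x
  smooth : ∀ {Y Z : VecField E M} {x : M}, SmoothVecAt Y x → SmoothVecAt Z x →
    ContMDiffAt 𝓘(ℝ, E) 𝓘(ℝ, ℝ) ∞ (fun y => g y (Y y) (Z y)) x

/-- A symmetric `IsNondegForm`. -/
structure IsMetric (g : BilinField E M) : Prop extends IsNondegForm g where
  symm : ∀ x u v, g x u v = g x v u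

/-- The right-hand side of the Koszul formula for `g(∇_X Y, Z)`. -/
def koszul (g : BilinField E M) (X Y Z : VecField E M) (x : M) : ℝ :=
  (1 / 2 : ℝ) * (dirDeriv X (fun y => g y (Y y) (Z y)) x + dirDeriv Y (fun y => g y (X y) (Z y)) x
    - dirDeriv Z (fun y => g y (X y) (Y y)) x
    + g x (mlieBracket 𝓘(ℝ, E) X Y x) (Z x) - g x (mlieBracket 𝓘(ℝ, E) X Z x) (Y x)
    - g x (mlieBracket 𝓘(ℝ, E) Y Z x) (X x))

lemma diff_mul {f h : M → ℝ} {x : M} (hf : MDifferentiableAt 𝓘(ℝ, E) 𝓘(ℝ, ℝ) f x)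
    (hh : MDifferentiableAt 𝓘(ℝ, E) 𝓘(ℝ, ℝ) h x) (u : TangentSpace 𝓘(ℝ, E) x) :
    diff (fun y => f y * h y) x u = f x * diff h x u + h x * diff f x u := by
  have := mvfderiv_mul hf hh
  simp only [diff]
  erw [this]
  rfl

lemma diff_add {f h : M → ℝ} {x : M} (hf : MDifferentiableAt 𝓘(ℝ, E) 𝓘(ℝ, ℝ) f x)
    (hh : MDifferentiableAt 𝓘(ℝ, E) 𝓘(ℝ, ℝ) h x) (u : TangentSpace 𝓘(ℝ, E) x) :
    diff (fun y => f y + h y) x u = diff f x u + diff h x u := by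
  have := mvfderiv_add hf hh
  simp only [diff]
  erw [this]
  rfl

variable [FiniteDimensional ℝ E] {g : BilinField E M}

lemma diffVecAt_smul {f : M → ℝ} {X : VecField E M} {x : M}
    (hf : MDifferentiableAt 𝓘(ℝ, E) 𝓘(ℝ, ℝ) f x) (hX : DiffVecAt X x) : DiffVecAt (f • X) x :=
  MDifferentiableAt.smul_section hf hX

lemma diffVecAt_add {X Y : VecField E M} {x : M}
    (hX : DiffVecAt X x) (hY : DiffVecAt Y x) : DiffVecAt (X + Y) x :=
  mdifferentiableAt_add_section hX hY

lemma diff_bilin_smul_left (hg : IsMetric g) {f : M → ℝ} {Y Z : VecField E M} {x : M}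
    (hf : MDifferentiableAt 𝓘(ℝ, E) 𝓘(ℝ, ℝ) f x) (hY : DiffVecAt Y x) (hZ : DiffVecAt Z x)
    (u : TangentSpace 𝓘(ℝ, E) x) :
    diff (fun y => g y ((f • Y) y) (Z y)) x u
      = f x * diff (fun y => g y (Y y) (Z y)) x u + g x (Y x) (Z x) * diff f x u := by
  rw [← diff_mul hf (hg.mdiff hY hZ)]
  congr 2
  ext y
  simp

lemma diff_bilin_smul_right (hg : IsMetric g) {f : M → ℝ} {Y Z : VecField E M} {x : M}
    (hf : MDifferentiableAt 𝓘(ℝ, E) 𝓘(ℝ, ℝ) f x) (hY : DiffVecAt Y x) (hZ : DiffVecAt Z x)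
    (u : TangentSpace 𝓘(ℝ, E) x) :
    diff (fun y => g y (Y y) ((f • Z) y)) x u
      = f x * diff (fun y => g y (Y y) (Z y)) x u + g x (Y x) (Z x) * diff f x u := by
  rw [← diff_mul hf (hg.mdiff hY hZ)]
  congr 2
  ext y
  simp

lemma diff_bilin_add_left (hg : IsMetric g) {Y Y' Z : VecField E M} {x : M}
    (hY : DiffVecAt Y x) (hY' : DiffVecAt Y' x) (hZ : DiffVecAt Z x)
    (u : TangentSpace 𝓘(ℝ, E) x) :
    diff (fun y => g y ((Y + Y') y) (Z y)) x u
      = diff (fun y => g y (Y y) (Z y)) x u + diff (fun y => g y (Y' y) (Z y)) x u := by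
  rw [← diff_add (hg.mdiff hY hZ) (hg.mdiff hY' hZ)]
  congr 2
  ext y
  simp

lemma diff_bilin_add_right (hg : IsMetric g) {Y Z Z' : VecField E M} {x : M}
    (hY : DiffVecAt Y x) (hZ : DiffVecAt Z x) (hZ' : DiffVecAt Z' x)
    (u : TangentSpace 𝓘(ℝ, E) x) :
    diff (fun y => g y (Y y) ((Z + Z') y)) x u
      = diff (fun y => g y (Y y) (Z y)) x u + diff (fun y => g y (Y y) (Z' y)) x u := by
  rw [← diff_add (hg.mdiff hY hZ) (hg.mdiff hY hZ')]
  congr 2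
  ext y
  simp

instance : IsManifold 𝓘(ℝ, E) (minSmoothness ℝ 2) M := by
  rw [minSmoothness_of_isRCLikeNormedField]
  exact IsManifold.of_le (n := (∞ : ℕ∞ω)) (by norm_cast)

instance : IsManifold 𝓘(ℝ, E) (minSmoothness ℝ 3) M := by
  rw [minSmoothness_of_isRCLikeNormedField]
  exact IsManifold.of_le (n := (∞ : ℕ∞ω)) (by norm_cast)

/-- The terms with `Y[f]` and `Z[f]` that come from differentiating `g(fX, ·)` cancel those that
come from the brackets with `fX`. -/
lemma koszul_tensorial_left (hg : IsMetric g) {Y Z : VecField E M} {x : M}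
    (hY : DiffVecAt Y x) (hZ : DiffVecAt Z x) :
    TensorialAt 𝓘(ℝ, E) E (fun X : VecField E M => koszul g X Y Z x) x where
  smul {f X} hf hX := by
    have b1 := mlieBracket_smul_left (W := Y) hf hX
    have b2 := mlieBracket_smul_left (W := Z) hf hX
    have d1 := diff_bilin_smul_left hg hf hX hZ (Y x)
    have d2 := diff_bilin_smul_left hg hf hX hY (Z x)
    simp only [koszul, dirDeriv, d1, d2, b1, b2]
    simp only [Pi.smul_apply', map_add, map_smul, smul_eq_mul,
      _root_.add_apply, _root_.smul_apply, diff]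
    ring
  add {X X'} hX hX' := by
    have b1 := mlieBracket_add_left (W := Y) hX hX'
    have b2 := mlieBracket_add_left (W := Z) hX hX'
    have d1 := diff_bilin_add_left hg hX hX' hZ (Y x)
    have d2 := diff_bilin_add_left hg hX hX' hY (Z x)
    simp only [koszul, dirDeriv, d1, d2, b1, b2]
    simp only [Pi.add_apply, map_add,
      _root_.add_apply]
    ring

lemma koszul_tensorial_right (hg : IsMetric g) {X Y : VecField E M} {x : M}
    (hX : DiffVecAt X x) (hY : DiffVecAt Y x) :
    TensorialAt 𝓘(ℝ, E) E (fun Z : VecField E M => koszul g X Y Z x) x where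
  smul {f Z} hf hZ := by
    have b1 := mlieBracket_smul_right (V := X) hf hZ
    have b2 := mlieBracket_smul_right (V := Y) hf hZ
    have d1 := diff_bilin_smul_right hg hf hX hZ (Y x)
    have d2 := diff_bilin_smul_right hg hf hY hZ (X x)
    have s1 := hg.symm x (Z x) (Y x)
    have s2 := hg.symm x (Z x) (X x)
    simp only [koszul, dirDeriv, d1, d2, b1, b2]
    simp only [Pi.smul_apply', map_add, map_smul, smul_eq_mul,
      _root_.add_apply, _root_.smul_apply, diff, s1, s2]
    ring
  add {Z Z'} hZ hZ' := by
    have b1 := mlieBracket_add_right (V := X) hZ hZ'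
    have b2 := mlieBracket_add_right (V := Y) hZ hZ'
    have d1 := diff_bilin_add_right hg hX hZ hZ' (Y x)
    have d2 := diff_bilin_add_right hg hY hZ hZ' (X x)
    simp only [koszul, dirDeriv, d1, d2, b1, b2]
    simp only [Pi.add_apply, map_add,
      _root_.add_apply]
    ring

/-- This is where the Leibniz rule of the connection comes from: the terms with `Z[f]` cancel,
whereas `X[f] g(Y, Z)` occurs twice, which the factor `1/2` compensates. -/
lemma koszul_smul_mid (hg : IsMetric g) {f : M → ℝ} {X Y Z : VecField E M} {x : M}
    (hf : MDifferentiableAt 𝓘(ℝ, E) 𝓘(ℝ, ℝ) f x)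
    (hX : DiffVecAt X x) (hY : DiffVecAt Y x) (hZ : DiffVecAt Z x) :
    koszul g X (f • Y) Z x = f x * koszul g X Y Z x + diff f x (X x) * g x (Y x) (Z x) := by
  have b1 := mlieBracket_smul_right (V := X) hf hY
  have b2 := mlieBracket_smul_left (W := Z) hf hY
  have d1 := diff_bilin_smul_right hg hf hX hY (Z x)
  have d2 := diff_bilin_smul_left hg hf hY hZ (X x)
  have s1 := hg.symm x (X x) (Y x)
  simp only [koszul, dirDeriv, d1, d2, b1, b2]
  simp only [Pi.smul_apply', map_add, map_smul, smul_eq_mul,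
      _root_.add_apply, _root_.smul_apply, diff, s1]
  ring

lemma koszul_add_mid (hg : IsMetric g) {X Y Y' Z : VecField E M} {x : M}
    (hX : DiffVecAt X x) (hY : DiffVecAt Y x) (hY' : DiffVecAt Y' x) (hZ : DiffVecAt Z x) :
    koszul g X (Y + Y') Z x = koszul g X Y Z x + koszul g X Y' Z x := by
  have b1 := mlieBracket_add_right (V := X) hY hY'
  have b2 := mlieBracket_add_left (W := Z) hY hY'
  have d1 := diff_bilin_add_right hg hX hY hY' (Z x)
  have d2 := diff_bilin_add_left hg hY hY' hZ (X x)
  simp only [koszul, dirDeriv, d1, d2, b1, b2]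
  simp only [Pi.add_apply, map_add, _root_.add_apply]
  ring

lemma diffVecAt_extendVec {x : M} (u : TangentSpace 𝓘(ℝ, E) x) : DiffVecAt (extendVec u) x :=
  FiberBundle.mdifferentiableAt_extend 𝓘(ℝ, E) E u

lemma smoothVecAt_extendVec {x : M} (u : TangentSpace 𝓘(ℝ, E) x) : SmoothVecAt (extendVec u) x :=
  FiberBundle.contMDiffAt_extend 𝓘(ℝ, E) E u

@[simp] lemma extendVec_self {x : M} (u : TangentSpace 𝓘(ℝ, E) x) : extendVec u x = u :=
  FiberBundle.extend_apply_self E u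

lemma IsNondegForm.injective (hg : IsNondegForm g) (x : M) : Function.Injective (g x) := by
  rw [injective_iff_map_eq_zero]
  intro u hu
  exact hg.nondegenerate x u fun v => by rw [hu]; rfl

/-- The isomorphism of the tangent space with its dual given by a non-degenerate form. -/
def flatEquiv (g : BilinField E M) {x : M} (h : Function.Injective (g x)) :
    TangentSpace 𝓘(ℝ, E) x ≃L[ℝ] (TangentSpace 𝓘(ℝ, E) x →L[ℝ] ℝ) :=
  letI : FiniteDimensional ℝ (TangentSpace 𝓘(ℝ, E) x) := inferInstanceAs (FiniteDimensional ℝ E)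
  letI e : E ≃L[ℝ] (E →L[ℝ] ℝ) := ContinuousLinearEquiv.ofBijective (g x : E →L[ℝ] (E →L[ℝ] ℝ))
    (LinearMap.ker_eq_bot.2 h) (LinearMap.range_eq_top.2 <| by
      refine (LinearMap.injective_iff_surjective_of_finrank_eq_finrank ?_).1 h
      rw [← LinearEquiv.finrank_eq (LinearMap.toContinuousLinearMap : (E →ₗ[ℝ] ℝ) ≃ₗ[ℝ] _)]
      exact (Subspace.dual_finrank_eq).symm)
  e

lemma flatEquiv_apply (g : BilinField E M) {x : M} (h : Function.Injective (g x))
    (u : TangentSpace 𝓘(ℝ, E) x) : flatEquiv g h u = g x u := rfl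

/-- `invMetric` uses `ContinuousLinearMap.inverse`, which is `0` on maps that are not invertible. In
finite dimension injectivity is enough to rule this out. -/
lemma invMetric_eq (g : BilinField E M) {x : M} (h : Function.Injective (g x)) :
    invMetric g x = (flatEquiv g h).symm := by
  rw [invMetric, ← ContinuousLinearMap.inverse_equiv]
  rfl

lemma apply_invMetric (g : BilinField E M) {x : M} (h : Function.Injective (g x))
    (α : TangentSpace 𝓘(ℝ, E) x →L[ℝ] ℝ) : g x (invMetric g x α) = α := by
  rw [invMetric_eq g h, ← flatEquiv_apply g h]
  exact (flatEquiv g h).apply_symm_apply α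

end Koszul

end HitchinWitten

namespace HitchinWitten

open VectorField

/-! ### Existence of the Levi-Civita connection. -/

section LeviCivita

variable {E : Type*} [NormedAddCommGroup E] [NormedSpace ℝ E]
  {M : Type*} [TopologicalSpace M] [ChartedSpace E M] [IsManifold 𝓘(ℝ, E) ∞ M]
  [FiniteDimensional ℝ E] {g : BilinField E M}

/-- Tensoriality in `X` and `Z` turns the Koszul expression at `x` into a bilinear form on the
tangent space, and the inverse metric turns that into an endomorphism. At points where `Y` is not
differentiable the value `0` is used. -/
lemma exists_koszul_conn (hg : IsMetric g) : ∃ D : ConnOp E M,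
    ∀ X Y Z x, DiffVecAt X x → DiffVecAt Y x → DiffVecAt Z x →
      g x (D Y x (X x)) (Z x) = koszul g X Y Z x := by
  have key : ∀ (Y : VecField E M) (x : M),
      ∃ A : TangentSpace 𝓘(ℝ, E) x →L[ℝ] TangentSpace 𝓘(ℝ, E) x,
      DiffVecAt Y x → ∀ X Z, DiffVecAt X x → DiffVecAt Z x →
        g x (A (X x)) (Z x) = koszul g X Y Z x := by
    intro Y x
    by_cases hY : DiffVecAt Y x
    · refine ⟨(invMetric g x).comp (TensorialAt.mkHom₂ (fun X Z => koszul g X Y Z x) x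
        (fun _ h => koszul_tensorial_left hg hY h)
        (fun _ h => koszul_tensorial_right hg h hY)), fun _ X Z hX hZ => ?_⟩
      rw [ContinuousLinearMap.comp_apply, apply_invMetric g (hg.injective x)]
      exact TensorialAt.mkHom₂_apply _ _ hX hZ
    · exact ⟨0, fun h => absurd h hY⟩
  choose D hD using key
  exact ⟨D, fun X Y Z x hX hY hZ => hD Y x hY X Z hX hZ⟩

lemma IsMetric.ext_extend (hg : IsMetric g) {x : M} {u v : TangentSpace 𝓘(ℝ, E) x}
    (h : ∀ Z : VecField E M, DiffVecAt Z x → g x u (Z x) = g x v (Z x)) : u = v := by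
  apply hg.injective x
  ext w
  simpa using h (extendVec w) (diffVecAt_extendVec w)

/-- By nondegeneracy each axiom may be tested against fields `Z`, where it becomes an algebraic
identity between Koszul expressions. The direction `u` enters through `extendVec u`. -/
theorem exists_isLeviCivita (hg : IsMetric g) : ∃ D, IsLeviCivita g D := by
  obtain ⟨D, hD⟩ := exists_koszul_conn hg
  refine ⟨D, ⟨?_, ?_⟩, ?_, ?_⟩
  · intro Y Y' x hY hY' _
    ext u
    apply hg.ext_extend
    intro Z hZ
    have h1 := hD (extendVec u) _ Z x (diffVecAt_extendVec u) (diffVecAt_add hY hY') hZ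
    have h2 := hD (extendVec u) _ Z x (diffVecAt_extendVec u) hY hZ
    have h3 := hD (extendVec u) _ Z x (diffVecAt_extendVec u) hY' hZ
    rw [extendVec_self] at h1 h2 h3
    rw [h1, koszul_add_mid hg (diffVecAt_extendVec u) hY hY' hZ, ← h2, ← h3]
    simp
  · intro Y f x hY hf _
    ext u
    apply hg.ext_extend
    intro Z hZ
    have h1 := hD (extendVec u) _ Z x (diffVecAt_extendVec u) (diffVecAt_smul hf hY) hZ
    have h2 := hD (extendVec u) _ Z x (diffVecAt_extendVec u) hY hZ
    rw [extendVec_self] at h1 h2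
    rw [h1, koszul_smul_mid hg hf (diffVecAt_extendVec u) hY hZ, ← h2]
    simp [diff]
  · intro X Y x hX hY
    apply hg.ext_extend
    intro Z hZ
    have h1 := hD X Y Z x hX hY hZ
    have h2 := hD Y X Z x hY hX hZ
    rw [map_sub, _root_.sub_apply, h1, h2]
    have b := mlieBracket_swap_apply (I := 𝓘(ℝ, E)) (V := Y) (W := X) (x := x)
    have s : (fun y => g y (X y) (Y y)) = fun y => g y (Y y) (X y) := by
      ext y; exact hg.symm y _ _
    simp only [koszul, b, s, map_neg, _root_.neg_apply]
    ring
  · intro Y Z x hY hZ u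
    have h1 := hD (extendVec u) Y Z x (diffVecAt_extendVec u) hY hZ
    have h2 := hD (extendVec u) Z Y x (diffVecAt_extendVec u) hZ hY
    rw [extendVec_self] at h1 h2
    rw [hg.symm x (Y x), h1, h2]
    have b := mlieBracket_swap_apply (I := 𝓘(ℝ, E)) (V := Z) (W := Y) (x := x)
    have s : (fun y => g y (Z y) (Y y)) = fun y => g y (Y y) (Z y) := by
      ext y; exact hg.symm y _ _
    simp only [koszul, b, s, map_neg, _root_.neg_apply, dirDeriv, extendVec_self]
    ring

/-- `leviCivita` is a Hilbert choice, so existence is what gives it any properties. -/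
theorem isLeviCivita_leviCivita (hg : IsMetric g) : IsLeviCivita g (leviCivita g) :=
  letI : Nonempty (ConnOp E M) := ⟨fun _ _ => 0⟩
  Classical.epsilon_spec (exists_isLeviCivita hg)

lemma IsLeviCivita.add {D : ConnOp E M} (h : IsLeviCivita g D) {Y Y' : VecField E M} {x : M}
    (hY : DiffVecAt Y x) (hY' : DiffVecAt Y' x) : D (Y + Y') x = D Y x + D Y' x :=
  h.isCovariantDerivative.add hY hY' trivial

lemma IsLeviCivita.leibniz {D : ConnOp E M} (h : IsLeviCivita g D) {Y : VecField E M} {f : M → ℝ}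
    {x : M} (hY : DiffVecAt Y x) (hf : MDifferentiableAt 𝓘(ℝ, E) 𝓘(ℝ, ℝ) f x)
    (u : TangentSpace 𝓘(ℝ, E) x) : D (f • Y) x u = f x • D Y x u + diff f x u • Y x := by
  rw [h.isCovariantDerivative.leibniz hY hf trivial]
  rfl

lemma IsLeviCivita.const_smul {D : ConnOp E M} (h : IsLeviCivita g D) {Y : VecField E M} (c : ℝ)
    {x : M} (hY : DiffVecAt Y x) : D (c • Y) x = c • D Y x :=
  h.isCovariantDerivative.smul_const c hY trivial

lemma IsLeviCivita.congr {D : ConnOp E M} (h : IsLeviCivita g D) {Y Y' : VecField E M} {x : M}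
    (hY : DiffVecAt Y x) (hY' : DiffVecAt Y' x) (he : ∀ᶠ y in nhds x, Y y = Y' y) :
    D Y x = D Y' x :=
  h.isCovariantDerivative.congr_of_eventuallyEq hY hY' Filter.univ_mem he

/-- The Koszul formula. -/
theorem IsLeviCivita.eq_koszul {D : ConnOp E M} (hg : IsMetric g) (h : IsLeviCivita g D)
    {X Y Z : VecField E M} {x : M} (hX : DiffVecAt X x) (hY : DiffVecAt Y x)
    (hZ : DiffVecAt Z x) : g x (D Y x (X x)) (Z x) = koszul g X Y Z x := by
  have m1 := h.metric Y Z x hY hZ (X x)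
  have m2 := h.metric X Z x hX hZ (Y x)
  have m3 := h.metric X Y x hX hY (Z x)
  simp only [koszul, dirDeriv, m1, m2, m3, ← h.torsion_free _ _ x hX hY,
    ← h.torsion_free _ _ x hX hZ, ← h.torsion_free _ _ x hY hZ, map_sub, _root_.sub_apply]
  rw [hg.symm x (Y x) (D Z x (X x)), hg.symm x (X x) (D Z x (Y x)), hg.symm x (X x) (D Y x (Z x))]
  ring

end LeviCivita

end HitchinWitten

namespace HitchinWitten

open VectorField

/-! ### Derivatives of functions on a product of manifolds. -/

section Derivatives

variable {E : Type*} [NormedAddCommGroup E] [NormedSpace ℝ E]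
  {M : Type*} [TopologicalSpace M] [ChartedSpace E M] [IsManifold 𝓘(ℝ, E) ∞ M]
  {EN : Type*} [NormedAddCommGroup EN] [NormedSpace ℝ EN]
  {N : Type*} [TopologicalSpace N] [ChartedSpace EN N] [IsManifold 𝓘(ℝ, EN) ∞ N]
  {G : Type*} [NormedAddCommGroup G] [NormedSpace ℝ G]

/-- If `h` is a smooth function on `N × M`, its derivatives along a smooth vector field on `M`
are smooth on `N × M`. -/
lemma contMDiffAt_mvfderiv_prod {X : VecField E M} {h : N × M → G} {n₀ : N} {x₀ : M}
    (hX : SmoothVecAt X x₀) (hh : ContMDiffAt (𝓘(ℝ, EN).prod 𝓘(ℝ, E)) 𝓘(ℝ, G) ∞ h (n₀, x₀)) :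
    ContMDiffAt (𝓘(ℝ, EN).prod 𝓘(ℝ, E)) 𝓘(ℝ, G) ∞
      (fun p : N × M => mvfderiv 𝓘(ℝ, E) (fun y => h (p.1, y)) p.2 (X p.2)) (n₀, x₀) := by
  have : IsManifold 𝓘(ℝ, E) 1 M := IsManifold.of_le (n := (∞ : ℕ∞ω)) (by norm_cast)
  have : IsManifold 𝓘(ℝ, EN) 1 N := IsManifold.of_le (n := (∞ : ℕ∞ω)) (by norm_cast)
  have h1 : ContMDiffAt ((𝓘(ℝ, EN).prod 𝓘(ℝ, E)).prod 𝓘(ℝ, E)) 𝓘(ℝ, G) ∞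
      (Function.uncurry fun (p : N × M) (y : M) => h (p.1, y)) ((n₀, x₀), x₀) :=
    ContMDiffAt.comp (x := ((n₀, x₀), x₀)) (g := h) (f := fun q : (N × M) × M => (q.1.1, q.2))
      hh ((contMDiffAt_fst.comp _ contMDiffAt_fst).prodMk contMDiffAt_snd)
  have h2 := ContMDiffAt.mfderiv (m := ∞) (n := ∞) (fun (p : N × M) (y : M) => h (p.1, y))
    (fun p => p.2) (x₀ := (n₀, x₀)) h1 contMDiffAt_snd (by norm_cast)
  have h3 : ContMDiffAt (𝓘(ℝ, EN).prod 𝓘(ℝ, E)) (𝓘(ℝ, E).prod 𝓘(ℝ, E)) ∞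
      (fun p : N × M => TotalSpace.mk' E (E := fun x : M => TangentSpace 𝓘(ℝ, E) x) p.2 (X p.2))
      (n₀, x₀) :=
    ContMDiffAt.comp (x := (n₀, x₀)) (f := fun q : N × M => q.2) hX contMDiffAt_snd
  have h4 := ContMDiffAt.clm_apply_of_inCoordinates
    (E₂ := fun x : G => TangentSpace 𝓘(ℝ, G) x) h2 h3 hh
  refine (contMDiffAt_totalSpace.1 h4).2.congr_of_eventuallyEq (Eventually.of_forall fun p => ?_)
  simp [mvfderiv]
  rfl

lemma contMDiffAt_mvfderiv {X : VecField E M} {f : M → G} {x : M} (hX : SmoothVecAt X x)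
    (hf : ContMDiffAt 𝓘(ℝ, E) 𝓘(ℝ, G) ∞ f x) :
    ContMDiffAt 𝓘(ℝ, E) 𝓘(ℝ, G) ∞ (fun y => mvfderiv 𝓘(ℝ, E) f y (X y)) x := by
  -- A single function is a constant family over the dummy parameter space `ℝ`.
  have h1 : ContMDiffAt (𝓘(ℝ, ℝ).prod 𝓘(ℝ, E)) 𝓘(ℝ, G) ∞ (fun p : ℝ × M => f p.2) ((0 : ℝ), x) :=
    ContMDiffAt.comp (x := ((0 : ℝ), x)) (f := fun q : ℝ × M => q.2) hf contMDiffAt_snd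
  have h2 := contMDiffAt_mvfderiv_prod hX h1
  exact ContMDiffAt.comp (f := fun y : M => ((0 : ℝ), y)) x h2
    (contMDiffAt_const.prodMk contMDiffAt_id)

/-- If `h` is a smooth function on `N × M`, its derivative along a tangent vector of `N` is a
smooth function on `M`. -/
lemma contMDiffAt_mvfderiv_fst {h : N × M → G} {n₀ : N} {x₀ : M}
    (hh : ContMDiffAt (𝓘(ℝ, EN).prod 𝓘(ℝ, E)) 𝓘(ℝ, G) ∞ h (n₀, x₀))
    (V : TangentSpace 𝓘(ℝ, EN) n₀) :
    ContMDiffAt 𝓘(ℝ, E) 𝓘(ℝ, G) ∞ (fun y => mvfderiv 𝓘(ℝ, EN) (fun n => h (n, y)) n₀ V) x₀ := by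
  have h1 : ContMDiffAt (𝓘(ℝ, E).prod 𝓘(ℝ, EN)) 𝓘(ℝ, G) ∞ (fun p : M × N => h (p.2, p.1)) (x₀, n₀) :=
    ContMDiffAt.comp (x := (x₀, n₀)) (g := h) (f := fun q : M × N => (q.2, q.1)) hh
      (contMDiffAt_snd.prodMk contMDiffAt_fst)
  have h2 := contMDiffAt_mvfderiv_prod (X := extendVec V)
    (FiberBundle.contMDiffAt_extend 𝓘(ℝ, EN) EN V) h1
  have h3 := ContMDiffAt.comp (f := fun y : M => (y, n₀)) x₀ h2
    (contMDiffAt_id.prodMk contMDiffAt_const)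
  refine h3.congr_of_eventuallyEq (Eventually.of_forall fun y => ?_)
  simp only [Function.comp]
  rw [show extendVec V n₀ = V from FiberBundle.extend_apply_self EN V]

omit [IsManifold 𝓘(ℝ, E) ∞ M] in
lemma mvfderiv_eq_fderiv {f : M → G} {x : M} (hf : MDifferentiableAt 𝓘(ℝ, E) 𝓘(ℝ, G) f x)
    (u : TangentSpace 𝓘(ℝ, E) x) :
    mvfderiv 𝓘(ℝ, E) f x u
      = fderiv ℝ (f ∘ (extChartAt 𝓘(ℝ, E) x).symm) (extChartAt 𝓘(ℝ, E) x x) u := by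
  simp only [mvfderiv, mfderiv, hf]
  rw [ContinuousLinearMap.comp_apply, modelWithCornersSelf_coe, Set.range_id, fderivWithin_univ]
  rfl

omit [IsManifold 𝓘(ℝ, E) ∞ M] in
-- In `mvfderiv_mvfderiv_comm` the inner derivative is known only near the base point, as a function
-- of the chart; this computes the outer derivative from such a local expression.
lemma mvfderiv_eq_of_eventuallyEq_comp_chart {f : M → G} {x : M} {l : E → G}
    (hl : DifferentiableAt ℝ l (extChartAt 𝓘(ℝ, E) x x)) (u : TangentSpace 𝓘(ℝ, E) x)
    (h : ∀ᶠ y in nhds x, f y = l (extChartAt 𝓘(ℝ, E) x y)) :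
    mvfderiv 𝓘(ℝ, E) f x u = fderiv ℝ l (extChartAt 𝓘(ℝ, E) x x) u := by
  have h0 : f x = l (extChartAt 𝓘(ℝ, E) x x) := h.self_of_nhds
  have hc : Tendsto (extChartAt 𝓘(ℝ, E) x).symm (nhds (extChartAt 𝓘(ℝ, E) x x)) (nhds x) := by
    have := continuousAt_extChartAt_symm (I := 𝓘(ℝ, E)) x
    rwa [ContinuousAt, extChartAt_to_inv] at this
  have he : f ∘ (extChartAt 𝓘(ℝ, E) x).symm =ᶠ[nhds (extChartAt 𝓘(ℝ, E) x x)] l := by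
    filter_upwards [hc.eventually h, extChartAt_target_mem_nhds (I := 𝓘(ℝ, E)) x] with z hz hz2
    rw [Function.comp, hz, (extChartAt 𝓘(ℝ, E) x).right_inv hz2]
  have hf : MDifferentiableAt 𝓘(ℝ, E) 𝓘(ℝ, G) f x := by
    rw [mdifferentiableAt_iff]
    constructor
    · refine ContinuousAt.congr (f := fun y => l (extChartAt 𝓘(ℝ, E) x y)) ?_ (h.mono fun y hy => hy.symm)
      exact ContinuousAt.comp hl.continuousAt (continuousAt_extChartAt x)
    · simp only [ModelWithCorners.range_eq_univ, differentiableWithinAt_univ]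
      exact hl.congr_of_eventuallyEq he
  rw [mvfderiv_eq_fderiv hf]
  exact DFunLike.congr_fun he.fderiv_eq u

/-- Derivatives of a smooth function on `N × M` along `N` and along `M` commute. -/
lemma mvfderiv_mvfderiv_comm {h : N × M → G} {n₀ : N} {x₀ : M}
    (hh : ContMDiffAt (𝓘(ℝ, EN).prod 𝓘(ℝ, E)) 𝓘(ℝ, G) ∞ h (n₀, x₀))
    (V : EN) (u : E) :
    mvfderiv 𝓘(ℝ, EN) (fun n => mvfderiv 𝓘(ℝ, E) (fun y => h (n, y)) x₀ u) n₀ V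
      = mvfderiv 𝓘(ℝ, E) (fun y => mvfderiv 𝓘(ℝ, EN) (fun n => h (n, y)) n₀ V) x₀ u := by
  set φ := extChartAt 𝓘(ℝ, EN) n₀
  set χ := extChartAt 𝓘(ℝ, E) x₀
  let k : EN × E → G := fun q => h (φ.symm q.1, χ.symm q.2)
  have hk : ContDiffAt ℝ ∞ k (φ n₀, χ x₀) := by
    have := contMDiffAt_iff.1 hh
    have h2 := this.2
    simp only [extChartAt_prod, ModelWithCorners.range_eq_univ, contDiffWithinAt_univ] at h2
    exact h2
  have hnear : ∀ᶠ p in nhds (n₀, x₀), MDifferentiableAt (𝓘(ℝ, EN).prod 𝓘(ℝ, E)) 𝓘(ℝ, G) h p :=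
    ((contMDiffAt_iff_contMDiffAt_nhds (n := 1) (by simp)).1
      (ContMDiffAt.of_le (m := 1) (n := (∞ : ℕ∞ω)) hh (by norm_cast))).mono
      fun y hy => hy.mdifferentiableAt (by simp)
  have hknear : ∀ᶠ q in nhds (φ n₀, χ x₀), DifferentiableAt ℝ k q :=
    ((hk.of_le (m := 1) (by norm_cast)).eventually (by simp)).mono
      fun y hy => hy.differentiableAt (by simp)
  have hk' : DifferentiableAt ℝ (fderiv ℝ k) (φ n₀, χ x₀) :=
    (hk.fderiv_right (m := 1) (by norm_cast)).differentiableAt (by simp)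
  -- In product charts the statement is the symmetry of the second derivative of `k`, applied to
  -- `(V, 0)` and `(0, u)`.
  have hsymm := hk.isSymmSndFDerivAt (by rw [minSmoothness_of_isRCLikeNormedField]; norm_cast)
  have e1 : ∀ᶠ n in nhds n₀, mvfderiv 𝓘(ℝ, E) (fun y => h (n, y)) x₀ u
      = fderiv ℝ k (φ n, χ x₀) ((0 : EN), (u : E)) := by
    have c1 : Tendsto (fun n => (n, x₀)) (nhds n₀) (nhds (n₀, x₀)) :=
      (Continuous.prodMk_left x₀).tendsto n₀
    have c2 : Tendsto (fun n => (φ n, χ x₀)) (nhds n₀) (nhds (φ n₀, χ x₀)) :=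
      (continuousAt_extChartAt n₀).prodMk continuousAt_const
    filter_upwards [c1.eventually hnear, c2.eventually hknear,
      extChartAt_source_mem_nhds (I := 𝓘(ℝ, EN)) n₀] with n hn hn2 hn3
    have d1 : MDifferentiableAt 𝓘(ℝ, E) 𝓘(ℝ, G) (fun y => h (n, y)) x₀ :=
      MDifferentiableAt.comp (f := fun y => (n, y)) x₀ hn
        (mdifferentiableAt_const.prodMk mdifferentiableAt_id)
    have : (fun y => h (n, y)) ∘ χ.symm = k ∘ fun b => (φ n, b) := by
      ext b
      simp only [k, Function.comp]
      rw [φ.left_inv hn3]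
    refine (mvfderiv_eq_fderiv d1 u).trans ?_
    change fderiv ℝ ((fun y => h (n, y)) ∘ χ.symm) (χ x₀) u = _
    rw [this]
    exact DFunLike.congr_fun
      (HasFDerivAt.comp _ hn2.hasFDerivAt (hasFDerivAt_prodMk_right (𝕜 := ℝ) (φ n) (χ x₀))).fderiv u
  have e2 : ∀ᶠ y in nhds x₀, mvfderiv 𝓘(ℝ, EN) (fun n => h (n, y)) n₀ V
      = fderiv ℝ k (φ n₀, χ y) ((V : EN), (0 : E)) := by
    have c1 : Tendsto (fun y => (n₀, y)) (nhds x₀) (nhds (n₀, x₀)) :=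
      (Continuous.prodMk_right n₀).tendsto x₀
    have c2 : Tendsto (fun y => (φ n₀, χ y)) (nhds x₀) (nhds (φ n₀, χ x₀)) :=
      continuousAt_const.prodMk (continuousAt_extChartAt x₀)
    filter_upwards [c1.eventually hnear, c2.eventually hknear,
      extChartAt_source_mem_nhds (I := 𝓘(ℝ, E)) x₀] with y hn hn2 hn3
    have d1 : MDifferentiableAt 𝓘(ℝ, EN) 𝓘(ℝ, G) (fun n => h (n, y)) n₀ :=
      MDifferentiableAt.comp (f := fun n => (n, y)) n₀ hn
        (mdifferentiableAt_id.prodMk mdifferentiableAt_const)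
    have : (fun n => h (n, y)) ∘ φ.symm = k ∘ fun a => (a, χ y) := by
      ext a
      simp only [k, Function.comp]
      rw [χ.left_inv hn3]
    refine (mvfderiv_eq_fderiv d1 V).trans ?_
    change fderiv ℝ ((fun n => h (n, y)) ∘ φ.symm) (φ n₀) V = _
    rw [this]
    exact DFunLike.congr_fun
      (HasFDerivAt.comp (g := k) (f := fun a => (a, χ y)) (φ n₀) hn2.hasFDerivAt
        (hasFDerivAt_prodMk_left (𝕜 := ℝ) (φ n₀) (χ y))).fderiv V
  have f1 : HasFDerivAt (fun a => fderiv ℝ k (a, χ x₀) ((0 : EN), (u : E)))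
      ((ContinuousLinearMap.apply ℝ G ((0 : EN), (u : E))).comp
        ((fderiv ℝ (fderiv ℝ k) (φ n₀, χ x₀)).comp (ContinuousLinearMap.inl ℝ EN E))) (φ n₀) := by
    have := HasFDerivAt.comp (g := fderiv ℝ k) (f := fun a => (a, χ x₀)) (φ n₀) hk'.hasFDerivAt
      (hasFDerivAt_prodMk_left (𝕜 := ℝ) (φ n₀) (χ x₀))
    exact (ContinuousLinearMap.apply ℝ G ((0 : EN), (u : E))).hasFDerivAt.comp (φ n₀) this
  have f2 : HasFDerivAt (fun b => fderiv ℝ k (φ n₀, b) ((V : EN), (0 : E)))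
      ((ContinuousLinearMap.apply ℝ G ((V : EN), (0 : E))).comp
        ((fderiv ℝ (fderiv ℝ k) (φ n₀, χ x₀)).comp (ContinuousLinearMap.inr ℝ EN E))) (χ x₀) := by
    have := HasFDerivAt.comp (g := fderiv ℝ k) (f := fun b => (φ n₀, b)) (χ x₀) hk'.hasFDerivAt
      (hasFDerivAt_prodMk_right (𝕜 := ℝ) (φ n₀) (χ x₀))
    exact (ContinuousLinearMap.apply ℝ G ((V : EN), (0 : E))).hasFDerivAt.comp (χ x₀) this
  refine (mvfderiv_eq_of_eventuallyEq_comp_chart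
    (l := fun a => fderiv ℝ k (a, χ x₀) ((0 : EN), (u : E))) f1.differentiableAt V e1).trans ?_
  refine Eq.trans ?_ (mvfderiv_eq_of_eventuallyEq_comp_chart
    (l := fun b => fderiv ℝ k (φ n₀, b) ((V : EN), (0 : E))) f2.differentiableAt u e2).symm
  have e3 := DFunLike.congr_fun f1.fderiv V
  have e4 := DFunLike.congr_fun f2.fderiv u
  exact e3.trans ((hsymm ((V : EN), (0 : E)) ((0 : EN), (u : E))).trans e4.symm)

end Derivatives

/-! ### Local frames and smoothness of covariant derivatives. -/

section Frames

variable {E : Type*} [NormedAddCommGroup E] [NormedSpace ℝ E]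
  {M : Type*} [TopologicalSpace M] [ChartedSpace E M] [IsManifold 𝓘(ℝ, E) ∞ M]
  [FiniteDimensional ℝ E] {g : BilinField E M}

/-- A map into continuous linear maps on a finite-dimensional space is smooth if its values at all
vectors are. -/
lemma contMDiffAt_clm_of_apply {EN : Type*} [NormedAddCommGroup EN] [NormedSpace ℝ EN]
    {HN : Type*} [TopologicalSpace HN] {I : ModelWithCorners ℝ EN HN}
    {N : Type*} [TopologicalSpace N] [ChartedSpace HN N]
    {G : Type*} [NormedAddCommGroup G] [NormedSpace ℝ G] {n : ℕ∞ω} {f : N → E →L[ℝ] G} {x : N}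
    (h : ∀ v, ContMDiffAt I 𝓘(ℝ, G) n (fun y => f y v) x) :
    ContMDiffAt I 𝓘(ℝ, E →L[ℝ] G) n f x := by
  let b := Module.finBasis ℝ E
  let c : Fin (Module.finrank ℝ E) → (E →L[ℝ] ℝ) := fun i => LinearMap.toContinuousLinearMap (b.coord i)
  have hf : f = fun y => ∑ i, ContinuousLinearMap.smulRightL ℝ E G (c i) (f y (b i)) := by
    ext y v
    conv_lhs => rw [← b.sum_repr v, map_sum]
    simp [c]
  rw [hf]
  exact ContMDiffAt.sum fun i _ =>
    ((ContinuousLinearMap.smulRightL ℝ E G (c i)).contMDiff.contMDiffAt).comp x (h (b i))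

variable (M) in
/-- The vector field that is constant, with value `e`, in the trivialisation at `x₀`. -/
def constVec (x₀ : M) (e : E) : VecField E M := fun y =>
  (trivializationAt E (fun x : M => TangentSpace 𝓘(ℝ, E) x) x₀).symmL ℝ y e

lemma smoothVecAt_constVec (x₀ : M) (e : E) {y : M}
    (hy : y ∈ (trivializationAt E (fun x : M => TangentSpace 𝓘(ℝ, E) x) x₀).baseSet) :
    SmoothVecAt (constVec M x₀ e) y := by
  unfold SmoothVecAt
  rw [(trivializationAt E (fun x : M => TangentSpace 𝓘(ℝ, E) x) x₀).contMDiffAt_section_iff hy]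
  refine (contMDiffAt_const (c := e)).congr_of_eventuallyEq ?_
  filter_upwards [(trivializationAt E (fun x : M => TangentSpace 𝓘(ℝ, E) x) x₀).open_baseSet.mem_nhds hy]
    with z hz
  simp only [constVec]
  rw [Trivialization.symmL_apply _ hz]
  exact congrArg Prod.snd (Trivialization.apply_mk_symm _ hz e)

/-- The coordinates of a vector field in the trivialisation at `x₀`. -/
def vecCoord (x₀ : M) (X : VecField E M) : M → E := fun y =>
  (trivializationAt E (fun x : M => TangentSpace 𝓘(ℝ, E) x) x₀ ⟨y, X y⟩).2

/-- A basis of vector fields near `x₀`. -/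
def vecFrame (x₀ : M) (i : Fin (Module.finrank ℝ E)) : VecField E M :=
  constVec M x₀ (Module.finBasis ℝ E i)

/-- The components of a vector field with respect to `vecFrame`. -/
def vecComp (x₀ : M) (X : VecField E M) (i : Fin (Module.finrank ℝ E)) : M → ℝ := fun y =>
  (Module.finBasis ℝ E).coord i (vecCoord x₀ X y)

lemma mem_baseSet (x₀ : M) :
    x₀ ∈ (trivializationAt E (fun x : M => TangentSpace 𝓘(ℝ, E) x) x₀).baseSet :=
  FiberBundle.mem_baseSet_trivializationAt' x₀

lemma eventually_mem_baseSet (x₀ : M) : ∀ᶠ y in nhds x₀,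
    y ∈ (trivializationAt E (fun x : M => TangentSpace 𝓘(ℝ, E) x) x₀).baseSet :=
  (trivializationAt E (fun x : M => TangentSpace 𝓘(ℝ, E) x) x₀).open_baseSet.mem_nhds
    (mem_baseSet x₀)

lemma sum_vecComp (x₀ : M) (X : VecField E M) {y : M}
    (hy : y ∈ (trivializationAt E (fun x : M => TangentSpace 𝓘(ℝ, E) x) x₀).baseSet) :
    X y = ∑ i, vecComp x₀ X i y • vecFrame x₀ i y := by
  set t := trivializationAt E (fun x : M => TangentSpace 𝓘(ℝ, E) x) x₀
  have h1 : X y = t.symmL ℝ y (vecCoord x₀ X y) := by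
    rw [t.symmL_apply hy]
    exact (t.symm_apply_apply_mk hy (X y)).symm
  have h2 : vecCoord x₀ X y = ∑ i, vecComp x₀ X i y • Module.finBasis ℝ E i :=
    ((Module.finBasis ℝ E).sum_repr (vecCoord x₀ X y)).symm
  rw [h1, h2, map_sum]
  simp only [map_smul]
  rfl

lemma vecComp_smooth {x₀ : M} {X : VecField E M} (hX : SmoothVecAt X x₀) (i) :
    ContMDiffAt 𝓘(ℝ, E) 𝓘(ℝ, ℝ) ∞ (vecComp x₀ X i) x₀ :=
  ((LinearMap.toContinuousLinearMap ((Module.finBasis ℝ E).coord i)).contMDiff.contMDiffAt).comp x₀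
    ((contMDiffAt_section x₀).1 hX)

lemma vecComp_mdiff {x₀ : M} {X : VecField E M} (hX : DiffVecAt X x₀) (i) :
    MDifferentiableAt 𝓘(ℝ, E) 𝓘(ℝ, ℝ) (vecComp x₀ X i) x₀ :=
  ((LinearMap.toContinuousLinearMap
    ((Module.finBasis ℝ E).coord i)).contMDiff.mdifferentiableAt one_ne_zero).comp x₀
    ((mdifferentiableAt_section _ _).1 hX)

lemma smoothVecAt_vecFrame {x₀ y : M}
    (hy : y ∈ (trivializationAt E (fun x : M => TangentSpace 𝓘(ℝ, E) x) x₀).baseSet)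
    (i : Fin (Module.finrank ℝ E)) :
    SmoothVecAt (vecFrame x₀ i) y := smoothVecAt_constVec x₀ _ hy

omit [FiniteDimensional ℝ E] in
lemma SmoothVecAt.congr {X Y : VecField E M} {x : M} (h : SmoothVecAt X x)
    (e : ∀ᶠ y in nhds x, Y y = X y) : SmoothVecAt Y x :=
  ContMDiffAt.congr_of_eventuallyEq h (e.mono fun y hy => by simp [hy])

omit [FiniteDimensional ℝ E] in
lemma DiffVecAt.congr {X Y : VecField E M} {x : M} (h : DiffVecAt X x)
    (e : ∀ᶠ y in nhds x, Y y = X y) : DiffVecAt Y x :=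
  MDifferentiableAt.congr_of_eventuallyEq h (e.mono fun y hy => by simp [hy])

/-- Expanding `X` in the frame reduces the claim to the frame fields. In this way smoothness of `J`
on smooth fields also controls `J` on fields that are merely differentiable. -/
lemma diffVecAt_endField {A : EndField E M} {X : VecField E M} {x : M} (hX : DiffVecAt X x)
    (h : ∀ i, DiffVecAt (fun y => A y (vecFrame x i y)) x) : DiffVecAt (fun y => A y (X y)) x := by
  have : DiffVecAt (fun y => ∑ i, (vecComp x X i • fun y => A y (vecFrame x i y)) y) x :=
    MDifferentiableAt.sum_section (fun i _ => MDifferentiableAt.smul_section (vecComp_mdiff hX i) (h i))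
  refine this.congr ?_
  filter_upwards [eventually_mem_baseSet (E := E) x] with y hy
  conv_lhs => rw [sum_vecComp x X hy, map_sum]
  simp

/-- A vector field is smooth if its pairings with smooth vector fields are. -/
theorem smoothVecAt_of_pairing (hg : IsNondegForm g) {W : VecField E M} {x : M}
    (h : ∀ Z, SmoothVecAt Z x → ContMDiffAt 𝓘(ℝ, E) 𝓘(ℝ, ℝ) ∞ (fun y => g y (W y) (Z y)) x) :
    SmoothVecAt W x := by
  set t := trivializationAt E (fun x : M => TangentSpace 𝓘(ℝ, E) x) x with ht
  -- `A` is the form read in the trivialisation. The coordinates of `W` are the inverse of `A`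
  -- applied to the smooth covector `hw`, and inversion of operators is smooth at an invertible one.
  let A : M → E →L[ℝ] E →L[ℝ] ℝ := fun y =>
    (ContinuousLinearMap.precomp ℝ (t.symmL ℝ y)).comp ((g y).comp (t.symmL ℝ y))
  have hA : ContMDiffAt 𝓘(ℝ, E) 𝓘(ℝ, E →L[ℝ] E →L[ℝ] ℝ) ∞ A x := by
    refine contMDiffAt_clm_of_apply fun u => contMDiffAt_clm_of_apply fun v => ?_
    exact hg.smooth (smoothVecAt_constVec x u (mem_baseSet (E := E) x))
      (smoothVecAt_constVec x v (mem_baseSet (E := E) x))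
  have hinj : ∀ y ∈ t.baseSet, Function.Injective (A y) := by
    intro y hy
    rw [injective_iff_map_eq_zero]
    intro u hu
    have h0 : t.symmL ℝ y u = 0 := by
      apply hg.nondegenerate
      intro v
      have := DFunLike.congr_fun hu (t.continuousLinearMapAt ℝ y v)
      simp only [A, ContinuousLinearMap.comp_apply, ContinuousLinearMap.precomp_apply] at this
      rw [t.symmL_continuousLinearMapAt hy] at this
      exact this
    have := t.continuousLinearMapAt_symmL (R := ℝ) hy u
    rw [← this, h0, map_zero]
  have heq : ∀ y ∈ t.baseSet, ∃ e : E ≃L[ℝ] (E →L[ℝ] ℝ), (e : E →L[ℝ] (E →L[ℝ] ℝ)) = A y := by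
    intro y hy
    refine ⟨ContinuousLinearEquiv.ofBijective (A y) (LinearMap.ker_eq_bot.2 (hinj y hy))
      (LinearMap.range_eq_top.2 ?_), by ext; rfl⟩
    refine (LinearMap.injective_iff_surjective_of_finrank_eq_finrank ?_).1 (hinj y hy)
    rw [← LinearEquiv.finrank_eq (LinearMap.toContinuousLinearMap : (E →ₗ[ℝ] ℝ) ≃ₗ[ℝ] _)]
    exact (Subspace.dual_finrank_eq).symm
  have hw : ContMDiffAt 𝓘(ℝ, E) 𝓘(ℝ, E →L[ℝ] ℝ) ∞
      (fun y => (g y (W y)).comp (t.symmL ℝ y)) x :=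
    contMDiffAt_clm_of_apply fun v => h _ (smoothVecAt_constVec x v (mem_baseSet (E := E) x))
  obtain ⟨e, he⟩ := heq x (mem_baseSet (E := E) x)
  have hinv : ContMDiffAt 𝓘(ℝ, E) 𝓘(ℝ, (E →L[ℝ] ℝ) →L[ℝ] E) ∞
      (fun y => ContinuousLinearMap.inverse (A y)) x := by
    have h1 := contDiffAt_map_inverse (𝕜 := ℝ) (n := ∞) e
    rw [he] at h1
    exact h1.contMDiffAt.comp x hA
  have := hinv.clm_apply hw
  unfold SmoothVecAt
  rw [contMDiffAt_section]
  refine this.congr_of_eventuallyEq ?_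
  filter_upwards [eventually_mem_baseSet (E := E) x] with y hy
  obtain ⟨e', he'⟩ := heq y hy
  rw [← he', ContinuousLinearMap.inverse_equiv]
  apply e'.injective
  simp only [ContinuousLinearEquiv.coe_coe, ContinuousLinearEquiv.apply_symm_apply]
  rw [← ContinuousLinearEquiv.coe_coe, he']
  ext v
  simp only [A, ContinuousLinearMap.comp_apply, ContinuousLinearMap.precomp_apply]
  congr 2
  rw [t.symmL_apply hy]
  exact t.symm_apply_apply_mk hy (W y)

lemma contMDiffAt_dirDeriv {X : VecField E M} {f : M → ℝ} {x : M} (hX : SmoothVecAt X x)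
    (hf : ContMDiffAt 𝓘(ℝ, E) 𝓘(ℝ, ℝ) ∞ f x) :
    ContMDiffAt 𝓘(ℝ, E) 𝓘(ℝ, ℝ) ∞ (dirDeriv X f) x :=
  contMDiffAt_mvfderiv hX hf

/-- The covariant derivative of a smooth vector field along a smooth vector field is smooth. -/
theorem IsLeviCivita.smooth {D : ConnOp E M} (hg : IsMetric g) (h : IsLeviCivita g D)
    {X Y : VecField E M} {x : M} (hX : SmoothVecAt X x) (hY : SmoothVecAt Y x) :
    SmoothVecAt (fun y => D Y y (X y)) x := by
  -- The pairing with a smooth `Z` is the Koszul expression near `x`, whose ingredients are all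
  -- smooth.
  refine smoothVecAt_of_pairing hg.toIsNondegForm fun Z hZ => ?_
  have : IsManifold 𝓘(ℝ, E) ((((⊤ : ℕ∞) : ℕ∞ω)) + 1) M := inferInstanceAs (IsManifold 𝓘(ℝ, E) ∞ M)
  have hlie : ∀ {U V : VecField E M}, SmoothVecAt U x → SmoothVecAt V x →
      SmoothVecAt (mlieBracket 𝓘(ℝ, E) U V) x := fun hU hV =>
    ContMDiffAt.mlieBracket_vectorField (n := ⊤) (m := ⊤) hU hV (by simp)
  have : ContMDiffAt 𝓘(ℝ, E) 𝓘(ℝ, ℝ) ∞ (koszul g X Y Z) x := by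
    unfold koszul
    refine contMDiffAt_const.mul (((((ContMDiffAt.add ?_ ?_).sub ?_).add ?_).sub ?_).sub ?_)
    · exact contMDiffAt_dirDeriv hX (hg.smooth hY hZ)
    · exact contMDiffAt_dirDeriv hY (hg.smooth hX hZ)
    · exact contMDiffAt_dirDeriv hZ (hg.smooth hX hY)
    · exact hg.smooth (hlie hX hY) hZ
    · exact hg.smooth (hlie hX hZ) hY
    · exact hg.smooth (hlie hY hZ) hX
  refine this.congr_of_eventuallyEq ?_
  filter_upwards [hX.eventually_diffVecAt, hY.eventually_diffVecAt, hZ.eventually_diffVecAt]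
    with y h1 h2 h3
  exact h.eq_koszul hg h1 h2 h3

end Frames

end HitchinWitten

namespace HitchinWitten

open VectorField

/-! ### Symplectic forms and compatible almost complex structures. -/

section Forms

variable {E : Type*} [NormedAddCommGroup E] [NormedSpace ℝ E]
  {M : Type*} [TopologicalSpace M] [ChartedSpace E M] [IsManifold 𝓘(ℝ, E) ∞ M]
  [FiniteDimensional ℝ E] {Ω : BilinField E M}

lemma IsSymplectic.isNondegForm (h : IsSymplectic Ω) : IsNondegForm Ω where
  nondegenerate := h.nondegenerate
  mdiff {Y Z x} hY hZ := by
    have h1 : MDifferentiableAt 𝓘(ℝ, E) (𝓘(ℝ, E).prod 𝓘(ℝ, ℝ))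
        (fun m => TotalSpace.mk' ℝ (E := Bundle.Trivial M ℝ) m (Ω m (Y m) (Z m))) x := by
      apply MDifferentiableAt.clm_bundle_apply₂ (F₁ := E) (F₂ := E)
        (E₁ := fun x : M => TangentSpace 𝓘(ℝ, E) x) (E₂ := fun x : M => TangentSpace 𝓘(ℝ, E) x)
      · exact (h.smooth x).mdifferentiableAt (by simp)
      · exact hY
      · exact hZ
    exact ((mdifferentiableAt_totalSpace _ _).1 h1).2
  smooth {Y Z x} hY hZ := by
    have h1 : ContMDiffAt 𝓘(ℝ, E) (𝓘(ℝ, E).prod 𝓘(ℝ, ℝ)) ∞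
        (fun m => TotalSpace.mk' ℝ (E := Bundle.Trivial M ℝ) m (Ω m (Y m) (Z m))) x := by
      apply ContMDiffAt.clm_bundle_apply₂ (F₁ := E) (F₂ := E)
        (E₁ := fun x : M => TangentSpace 𝓘(ℝ, E) x) (E₂ := fun x : M => TangentSpace 𝓘(ℝ, E) x)
      · exact h.smooth x
      · exact hY
      · exact hZ
    exact (contMDiffAt_totalSpace.1 h1).2

lemma skew_of_alt (h : ∀ x u, Ω x u u = 0) (x : M) (u v : TangentSpace 𝓘(ℝ, E) x) :
    Ω x u v = -Ω x v u := by
  have := h x (u + v)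
  simp only [map_add, _root_.add_apply, h, zero_add, add_zero] at this
  linarith

/-- An almost complex structure that is compatible with a non-degenerate skew form. -/
structure IsCompatible (Ω : BilinField E M) (J : EndField E M) : Prop where
  nondeg : IsNondegForm Ω
  skew : ∀ x u v, Ω x u v = -Ω x v u
  sq : ∀ x u, J x (J x u) = -u
  symm : ∀ x u v, kahlerMetric Ω J x u v = kahlerMetric Ω J x v u
  mdiff : ∀ {Y : VecField E M} {x : M}, DiffVecAt Y x → DiffVecAt (fun y => J y (Y y)) x
  smooth : ∀ {Y : VecField E M} {x : M}, SmoothVecAt Y x → SmoothVecAt (fun y => J y (Y y)) x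

variable {J : EndField E M}

lemma kahlerMetric_apply (x : M) (u v : TangentSpace 𝓘(ℝ, E) x) :
    kahlerMetric Ω J x u v = Ω x u (J x v) := rfl

lemma IsCompatible.isMetric (h : IsCompatible Ω J) : IsMetric (kahlerMetric Ω J) where
  nondegenerate x u hu := by
    refine h.nondeg.nondegenerate x u fun v => ?_
    -- Since `J(-Jv) = v`, pairing with `-Jv` under the metric is pairing with `v` under `Ω`.
    have := hu (-(J x v))
    rw [kahlerMetric_apply, map_neg, h.sq, neg_neg] at this
    exact this
  mdiff hY hZ := h.nondeg.mdiff hY (h.mdiff hZ)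
  smooth hY hZ := h.nondeg.smooth hY (h.smooth hZ)
  symm := h.symm

/-- By symmetry of the metric, `g(J Ω⁻¹α, v) = g(v, J Ω⁻¹α) = -Ω(v, Ω⁻¹α) = α(v)`. In a family with
`Ω` fixed, the factor `J` therefore carries the whole dependence of the inverse metric on the
parameter. -/
lemma IsCompatible.invMetric_kahler (h : IsCompatible Ω J) (x : M)
    (α : TangentSpace 𝓘(ℝ, E) x →L[ℝ] ℝ) :
    invMetric (kahlerMetric Ω J) x α = J x (invMetric Ω x α) := by
  apply h.isMetric.injective x
  rw [apply_invMetric _ (h.isMetric.injective x)]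
  ext v
  rw [h.symm, kahlerMetric_apply, h.sq, h.skew, map_neg, _root_.neg_apply, neg_neg,
    apply_invMetric _ (h.nondeg.injective x)]

/-- The form applied to a smooth vector field, as a smooth family of covectors. -/
lemma IsNondegForm.smoothVecAt_invMetric (h : IsNondegForm Ω) {α : OneForm E M} {x : M}
    (hα : ∀ Z, SmoothVecAt Z x → ContMDiffAt 𝓘(ℝ, E) 𝓘(ℝ, ℝ) ∞ (fun y => α y (Z y)) x) :
    SmoothVecAt (fun y => invMetric Ω y (α y)) x := by
  refine smoothVecAt_of_pairing h fun Z hZ => ?_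
  refine (hα Z hZ).congr_of_eventuallyEq (Eventually.of_forall fun y => ?_)
  simp only []
  rw [apply_invMetric _ (h.injective y)]

end Forms

/-! ### Traces through a form that is symmetric or skew. -/

section Trace

variable {V ι : Type*} [AddCommGroup V] [Module ℝ V] [Fintype ι]

/-- Contracting a bilinear form with an endomorphism on the dual side gives the trace. -/
lemma sum_bilin_dual (b : Module.Basis ι ℝ V) (β : V → V →ₗ[ℝ] ℝ) (w : ι → V)
    (ε : ℝ) (hadd : ∀ u v, β u v = ε * β v u)
    (hw : ∀ v i, β v (w i) = b.repr v i) (A : V →ₗ[ℝ] V) :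
    ∑ i, β (b i) (A (w i)) = ∑ i, b.repr (A (b i)) i := by
  have h1 : ∀ i, w i = ∑ j, β (w i) (w j) • b j := fun i => by
    conv_lhs => rw [← b.sum_repr (w i)]
    simp only [hw]
  have h2 : ∀ i, β (b i) (A (w i)) = ∑ j, ε * (β (w j) (w i) * β (b i) (A (b j))) := fun i => by
    conv_lhs => rw [h1 i]
    rw [map_sum, map_sum]
    refine Finset.sum_congr rfl fun j _ => ?_
    rw [map_smul, map_smul, smul_eq_mul, hadd (w i)]
    ring
  simp_rw [h2]
  rw [Finset.sum_comm]
  refine Finset.sum_congr rfl fun j _ => ?_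
  rw [← Finset.mul_sum, ← hw (A (b j)) j, hadd (A (b j))]
  congr 1
  -- The matrix `β(w j, w i)` raises the index `i`; what remains is a diagonal entry of `A`. The
  -- sign `ε` is used twice and drops out.
  have h3 : ∀ v, β (w j) v = ∑ i, β (w j) (w i) * β (b i) v := fun v => by
    rw [hadd, h1 j, map_sum, Finset.mul_sum]
    refine Finset.sum_congr rfl fun i _ => ?_
    rw [map_smul, smul_eq_mul, ← h1 j, hadd (b i)]
    ring
  exact (h3 _).symm

end Trace

end HitchinWitten

namespace HitchinWitten

open VectorField

/-! ### The divergence depends on the symplectic form only. -/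

section Divergence

variable {E : Type*} [NormedAddCommGroup E] [NormedSpace ℝ E]
  {M : Type*} [TopologicalSpace M] [ChartedSpace E M] [IsManifold 𝓘(ℝ, E) ∞ M]
  [FiniteDimensional ℝ E] {Ω g : BilinField E M} {J : EndField E M}

/-- The divergence `tr ∇X` of a vector field. -/
def divg (g : BilinField E M) (X : VecField E M) : M → ℝ := fun x =>
  ∑ i, tcobasis x i (leviCivita g X x (tbasis x i))

lemma laplacian_eq_divg (g : BilinField E M) (f : M → ℝ) :
    laplacian g f = divg g (grad g f) := rfl

lemma sum_tcobasis_smul (x : M) (v : TangentSpace 𝓘(ℝ, E) x) :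
    ∑ i, tcobasis x i v • tbasis x i = v := (tbasis x).sum_repr v

lemma divg_add (hg : IsMetric g) {X Y : VecField E M} {x : M} (hX : DiffVecAt X x)
    (hY : DiffVecAt Y x) : divg g (X + Y) x = divg g X x + divg g Y x := by
  simp only [divg, (isLeviCivita_leviCivita hg).add hX hY, ← Finset.sum_add_distrib]
  exact Finset.sum_congr rfl fun i _ => map_add (tcobasis x i) _ _

lemma divg_smul (hg : IsMetric g) {X : VecField E M} {f : M → ℝ} {x : M}
    (hf : MDifferentiableAt 𝓘(ℝ, E) 𝓘(ℝ, ℝ) f x) (hX : DiffVecAt X x) :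
    divg g (f • X) x = f x * divg g X x + diff f x (X x) := by
  simp only [divg, (isLeviCivita_leviCivita hg).leibniz hX hf, map_add, map_smul,
    Finset.sum_add_distrib, smul_eq_mul, ← Finset.mul_sum]
  congr 1
  conv_rhs => rw [← sum_tcobasis_smul x (X x), map_sum]
  refine Finset.sum_congr rfl fun i _ => ?_
  rw [map_smul, smul_eq_mul, mul_comm]

lemma divg_congr (hg : IsMetric g) {X Y : VecField E M} {x : M} (hX : DiffVecAt X x)
    (h : ∀ᶠ y in nhds x, Y y = X y) : divg g Y x = divg g X x := by
  simp only [divg, (isLeviCivita_leviCivita hg).congr (hX.congr h) hX h]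

/-- The Lie derivative of the almost complex structure is tensorial. -/
lemma tensorialAt_lie (hJ : IsCompatible Ω J) (X : VecField E M) (x : M) :
    TensorialAt 𝓘(ℝ, E) E (fun V : VecField E M =>
      mlieBracket 𝓘(ℝ, E) X (fun y => J y (V y)) x - J x (mlieBracket 𝓘(ℝ, E) X V x)) x where
  smul {f V} hf hV := by
    have b1 := mlieBracket_smul_right (V := X) hf (hJ.mdiff hV)
    have b2 := mlieBracket_smul_right (V := X) hf hV
    have e : (fun y => J y ((f • V) y)) = f • fun y => J y (V y) := by
      ext y; simp
    simp only [e, b1, b2, map_add, map_smul, smul_sub]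
    abel
  add {V V'} hV hV' := by
    have b1 := mlieBracket_add_right (V := X) (hJ.mdiff hV) (hJ.mdiff hV')
    have b2 := mlieBracket_add_right (V := X) hV hV'
    have e : (fun y => J y ((V + V') y)) = (fun y => J y (V y)) + fun y => J y (V' y) := by
      ext y; simp
    simp only [e, b1, b2, map_add]
    abel

/-- The trace of an endomorphism of a tangent space. -/
lemma trace_eq_sum (x : M) (A : TangentSpace 𝓘(ℝ, E) x →ₗ[ℝ] TangentSpace 𝓘(ℝ, E) x) :
    LinearMap.trace ℝ (TangentSpace 𝓘(ℝ, E) x) A = ∑ i, tcobasis x i (A (tbasis x i)) := by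
  rw [LinearMap.trace_eq_matrix_trace ℝ (tbasis x), Matrix.trace]
  refine Finset.sum_congr rfl fun i _ => ?_
  rw [Matrix.diag, LinearMap.toMatrix_apply]
  rfl

/-- The defect of `J` to commute with brackets with `X`, composed with `J`, is trace-free. -/
lemma exists_lie_tracefree (hJ : IsCompatible Ω J) (X : VecField E M) (x : M) :
    ∃ A : TangentSpace 𝓘(ℝ, E) x →ₗ[ℝ] TangentSpace 𝓘(ℝ, E) x,
      (∀ C : VecField E M, DiffVecAt C x →
        J x (mlieBracket 𝓘(ℝ, E) X (fun y => J y ((-C) y)) x)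
          = mlieBracket 𝓘(ℝ, E) X C x + A (C x)) ∧
      ∑ i, tcobasis x i (A (tbasis x i)) = 0 := by
  let T := TensorialAt.mkHom _ x (tensorialAt_lie hJ X x)
  have hT : ∀ V : VecField E M, DiffVecAt V x → T (V x)
      = mlieBracket 𝓘(ℝ, E) X (fun y => J y (V y)) x - J x (mlieBracket 𝓘(ℝ, E) X V x) :=
    fun V hV => TensorialAt.mkHom_apply _ hV
  have hneg : ∀ V : VecField E M, DiffVecAt V x →
      mlieBracket 𝓘(ℝ, E) X (-V) x = - mlieBracket 𝓘(ℝ, E) X V x := fun V hV => by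
    have := mlieBracket_const_smul_right (V := X) (c := (-1 : ℝ)) hV
    simpa using this
  have hdneg : ∀ V : VecField E M, DiffVecAt V x → DiffVecAt (-V) x := fun V hV =>
    mdifferentiableAt_neg_section hV
  -- `T` is the Lie derivative of `J` along `X`, and the Lie derivative of `J² = -1` vanishes.
  have hanti : ∀ u, T (J x u) = -J x (T u) := by
    intro u
    have hu := diffVecAt_extendVec u
    have h1 := hT _ hu
    have h2 := hT _ (hJ.mdiff hu)
    have e : (fun y => J y (J y (extendVec u y))) = -extendVec u := by
      ext y
      simp only [hJ.sq]
      rfl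
    simp only [e, extendVec_self] at h1 h2
    rw [h2, h1, map_sub, hJ.sq, hneg _ hu]
    abel
  let Tl : TangentSpace 𝓘(ℝ, E) x →ₗ[ℝ] TangentSpace 𝓘(ℝ, E) x := T.toLinearMap
  let Jl : TangentSpace 𝓘(ℝ, E) x →ₗ[ℝ] TangentSpace 𝓘(ℝ, E) x := (J x).toLinearMap
  refine ⟨Tl ∘ₗ Jl, fun C hC => ?_, ?_⟩
  · have h1 := hT _ (hJ.mdiff (hdneg C hC))
    have e : (fun y => J y (J y ((-C) y))) = C := by
      ext y
      simp only [hJ.sq, Pi.neg_apply, neg_neg]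
    simp only [e] at h1
    have h2 : T (J x ((-C) x)) = -T (J x (C x)) := by
      rw [Pi.neg_apply, map_neg, map_neg]
    rw [h2] at h1
    change _ = _ + T (J x (C x))
    rw [neg_eq_iff_eq_neg.1 h1]
    abel
  -- `tr(TJ)` equals `tr(JT)` by cyclicity and `-tr(JT)` by anticommutation.
  · rw [← trace_eq_sum]
    have h1 : Tl ∘ₗ Jl = -(Jl ∘ₗ Tl) := by
      ext u
      exact hanti u
    have h2 := LinearMap.trace_mul_comm ℝ Tl Jl
    have h3 : LinearMap.trace ℝ _ (Tl ∘ₗ Jl) = - LinearMap.trace ℝ _ (Jl ∘ₗ Tl) := by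
      rw [h1, map_neg]
    have h4 : LinearMap.trace ℝ _ (Tl ∘ₗ Jl) = LinearMap.trace ℝ _ (Jl ∘ₗ Tl) := h2
    linarith

/-- A formula for the divergence in terms of a symplectic form alone. -/
def sympDiv (Ω : BilinField E M) (X : VecField E M) : M → ℝ := fun x =>
  (1 / 2 : ℝ) * ∑ i,
    (dirDeriv X (fun y => Ω y (extendVec (tbasis x i) y)
        (extendVec (invMetric Ω x (-tcobasis x i)) y)) x
      - Ω x (mlieBracket 𝓘(ℝ, E) X (extendVec (tbasis x i)) x) (invMetric Ω x (-tcobasis x i))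
      - Ω x (tbasis x i)
        (mlieBracket 𝓘(ℝ, E) X (extendVec (invMetric Ω x (-tcobasis x i))) x))

/-- The divergence with respect to a compatible metric depends on the symplectic form only. -/
theorem divg_eq_sympDiv (hJ : IsCompatible Ω J) {X : VecField E M} {x : M} (hX : DiffVecAt X x) :
    divg (kahlerMetric Ω J) X x = sympDiv Ω X x := by
  have hg := hJ.isMetric
  have hD := isLeviCivita_leviCivita hg
  set D := leviCivita (kahlerMetric Ω J)
  let c : Fin (Module.finrank ℝ E) → TangentSpace 𝓘(ℝ, E) x :=
    fun i => invMetric Ω x (-tcobasis x i)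
  -- Because `Ω` is skew, the minus sign in `c` makes this family dual to the basis in the second
  -- argument of `Ω`.
  have hc : ∀ v i, Ω x v (c i) = tcobasis x i v := fun v i => by
    rw [hJ.skew, apply_invMetric _ (hJ.nondeg.injective x), _root_.neg_apply, neg_neg]
  -- The vectors dual to the basis for the metric: `g(v, -J c i) = Ω(v, c i)`.
  let w : Fin (Module.finrank ℝ E) → TangentSpace 𝓘(ℝ, E) x := fun i => J x (-c i)
  have hJw : ∀ i, J x (w i) = c i := fun i => by rw [hJ.sq, neg_neg]
  have hw : ∀ v i, kahlerMetric Ω J x v (w i) = tcobasis x i v := fun v i => by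
    rw [kahlerMetric_apply, hJw, hc]
  obtain ⟨A, hA, hA0⟩ := exists_lie_tracefree hJ X x
  have hC : ∀ i, DiffVecAt (extendVec (c i)) x := fun i => diffVecAt_extendVec _
  have hW : ∀ i, DiffVecAt (fun y => J y ((-extendVec (c i)) y)) x := fun i =>
    hJ.mdiff (mdifferentiableAt_neg_section (hC i))
  -- The sums `s1` and `s3` are both the trace of `∇X`, which accounts for the factor `1/2` in
  -- `sympDiv`.
  have s1 : ∑ i, kahlerMetric Ω J x (tbasis x i) (D X x (w i)) = divg (kahlerMetric Ω J) X x :=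
    sum_bilin_dual (tbasis x) (fun u => (kahlerMetric Ω J x u).toLinearMap) w 1
      (fun u v => by simpa using hJ.symm x u v) hw (D X x).toLinearMap
  have s2 : ∑ i, Ω x (tbasis x i) (A (c i)) = 0 := by
    rw [← hA0]
    exact sum_bilin_dual (tbasis x) (fun u => (Ω x u).toLinearMap) c (-1)
      (fun u v => by simpa using hJ.skew x u v) hc A
  have s3 : ∑ i, kahlerMetric Ω J x (D X x (tbasis x i)) (w i)
      = divg (kahlerMetric Ω J) X x := by
    simp only [hw]
    rfl
  -- The left side is the Lie derivative of `Ω` on the pair `(tbasis x i, c i)`. Writing `Ω(E, C)`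
  -- as `g(E, J(-C))`, metric compatibility and vanishing torsion turn it into the symmetrised `∇X`.
  -- Moving `J` out of the bracket costs the term with `A`, whose sum is zero by `s2`.
  have key : ∀ i, dirDeriv X (fun y => Ω y (extendVec (tbasis x i) y) (extendVec (c i) y)) x
      - Ω x (mlieBracket 𝓘(ℝ, E) X (extendVec (tbasis x i)) x) (c i)
      - Ω x (tbasis x i) (mlieBracket 𝓘(ℝ, E) X (extendVec (c i)) x)
      = kahlerMetric Ω J x (D X x (tbasis x i)) (w i)
        + kahlerMetric Ω J x (tbasis x i) (D X x (w i)) + Ω x (tbasis x i) (A (c i)) := by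
    intro i
    have hB : DiffVecAt (extendVec (tbasis x i)) x := diffVecAt_extendVec _
    have m := hD.metric _ _ x hB (hW i) (X x)
    have t1 := hD.torsion_free _ _ x hX hB
    have t2 := hD.torsion_free _ _ x hX (hW i)
    have a := hA _ (hC i)
    have e : (fun y => kahlerMetric Ω J y (extendVec (tbasis x i) y)
        (J y ((-extendVec (c i)) y)))
        = fun y => Ω y (extendVec (tbasis x i) y) (extendVec (c i) y) := by
      ext y
      rw [kahlerMetric_apply, hJ.sq, Pi.neg_apply, neg_neg]
    have e2 : J x ((-extendVec (c i)) x) = w i := by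
      rw [Pi.neg_apply, extendVec_self]
    simp only [e, e2, extendVec_self] at m t1 t2 a
    rw [dirDeriv, m, ← t1, ← sub_eq_iff_eq_add.2 a, ← t2]
    simp only [map_sub, _root_.sub_apply, kahlerMetric_apply, hJw]
    ring
  rw [sympDiv]
  rw [Finset.sum_congr rfl fun i _ => key i, Finset.sum_add_distrib, Finset.sum_add_distrib, s1, s2, s3]
  ring

/-- The divergence does not depend on the compatible almost complex structure. -/
theorem divg_eq_divg {J' : EndField E M} (hJ : IsCompatible Ω J) (hJ' : IsCompatible Ω J')
    {X : VecField E M} {x : M} (hX : DiffVecAt X x) :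
    divg (kahlerMetric Ω J) X x = divg (kahlerMetric Ω J') X x := by
  rw [divg_eq_sympDiv hJ hX, divg_eq_sympDiv hJ' hX]

end Divergence

end HitchinWitten

namespace HitchinWitten

open VectorField

/-! ### Smooth families of vector fields and their divergences. -/

section VecFamilies

variable {E : Type*} [NormedAddCommGroup E] [NormedSpace ℝ E]
  {M : Type*} [TopologicalSpace M] [ChartedSpace E M] [IsManifold 𝓘(ℝ, E) ∞ M]
  [FiniteDimensional ℝ E] {g : BilinField E M}
  {EN : Type*} [NormedAddCommGroup EN] [NormedSpace ℝ EN]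
  {N : Type*} [TopologicalSpace N] [ChartedSpace EN N] [IsManifold 𝓘(ℝ, EN) ∞ N]
  {G : Type*} [NormedAddCommGroup G] [NormedSpace ℝ G]

variable (EN) in
/-- Families of vector fields that are smooth at a point of `N × M`. -/
def SmoothVecFamAt (Y : N → VecField E M) (n₀ : N) (x₀ : M) : Prop :=
  ContMDiffAt (𝓘(ℝ, EN).prod 𝓘(ℝ, E)) (𝓘(ℝ, E).prod 𝓘(ℝ, E)) ∞
    (fun p : N × M => TotalSpace.mk' E (E := fun x : M => TangentSpace 𝓘(ℝ, E) x) p.2 (Y p.1 p.2))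
    (n₀, x₀)

/-- The derivative of a family of vector fields along a vector tangent to the parameter space. -/
def famDeriv (Y : N → VecField E M) (n₀ : N) (V : TangentSpace 𝓘(ℝ, EN) n₀) : VecField E M :=
  fun y => mvfderiv (F := E) 𝓘(ℝ, EN) (fun n => Y n y) n₀ V

variable {Y : N → VecField E M} {n₀ : N} {x₀ : M}

lemma SmoothVecFamAt.smoothVecAt (h : SmoothVecFamAt EN Y n₀ x₀) : SmoothVecAt (Y n₀) x₀ :=
  ContMDiffAt.comp (f := fun y : M => (n₀, y)) x₀ h (contMDiffAt_const.prodMk contMDiffAt_id)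

lemma SmoothVecFamAt.contMDiffAt_vecComp (h : SmoothVecFamAt EN Y n₀ x₀) (i) :
    ContMDiffAt (𝓘(ℝ, EN).prod 𝓘(ℝ, E)) 𝓘(ℝ, ℝ) ∞
      (fun p : N × M => vecComp x₀ (Y p.1) i p.2) (n₀, x₀) :=
  ((LinearMap.toContinuousLinearMap ((Module.finBasis ℝ E).coord i)).contMDiff.contMDiffAt).comp _
    (contMDiffAt_totalSpace.1 h).2

lemma mvfderiv_congr {f f' : N → G} (h : ∀ᶠ n in nhds n₀, f n = f' n)
    (V : TangentSpace 𝓘(ℝ, EN) n₀) : mvfderiv 𝓘(ℝ, EN) f n₀ V = mvfderiv 𝓘(ℝ, EN) f' n₀ V := by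
  have h1 := Filter.EventuallyEq.mfderiv_eq (I := 𝓘(ℝ, EN)) (I' := 𝓘(ℝ, G)) h
  have h2 := DFunLike.congr_fun h1 V
  exact h2

lemma eventually_mdifferentiableAt_fst {h : N × M → G}
    (hh : ContMDiffAt (𝓘(ℝ, EN).prod 𝓘(ℝ, E)) 𝓘(ℝ, G) ∞ h (n₀, x₀)) :
    ∀ᶠ y in nhds x₀, MDifferentiableAt 𝓘(ℝ, EN) 𝓘(ℝ, G) (fun n => h (n, y)) n₀ := by
  have h1 : IsManifold (𝓘(ℝ, EN).prod 𝓘(ℝ, E)) ∞ (N × M) := inferInstance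
  have : IsManifold (𝓘(ℝ, EN).prod 𝓘(ℝ, E)) 1 (N × M) :=
    IsManifold.of_le (n := (∞ : ℕ∞ω)) (by norm_cast)
  have hnear : ∀ᶠ p in nhds (n₀, x₀), MDifferentiableAt (𝓘(ℝ, EN).prod 𝓘(ℝ, E)) 𝓘(ℝ, G) h p :=
    ((contMDiffAt_iff_contMDiffAt_nhds (n := 1) (by simp)).1
      (ContMDiffAt.of_le (m := 1) (n := (∞ : ℕ∞ω)) hh (by norm_cast))).mono
      fun y hy => hy.mdifferentiableAt (by simp)
  have c1 : Tendsto (fun y => (n₀, y)) (nhds x₀) (nhds (n₀, x₀)) :=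
    (Continuous.prodMk_right n₀).tendsto x₀
  filter_upwards [c1.eventually hnear] with y hn
  exact MDifferentiableAt.comp (f := fun n => (n, y)) n₀ hn
    (mdifferentiableAt_id.prodMk mdifferentiableAt_const)

lemma eventually_mdifferentiableAt_snd {h : N × M → G}
    (hh : ContMDiffAt (𝓘(ℝ, EN).prod 𝓘(ℝ, E)) 𝓘(ℝ, G) ∞ h (n₀, x₀)) :
    ∀ᶠ p in nhds (n₀, x₀), MDifferentiableAt 𝓘(ℝ, E) 𝓘(ℝ, G) (fun y => h (p.1, y)) p.2 := by
  have h1 : IsManifold (𝓘(ℝ, EN).prod 𝓘(ℝ, E)) ∞ (N × M) := inferInstance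
  have : IsManifold (𝓘(ℝ, EN).prod 𝓘(ℝ, E)) 1 (N × M) :=
    IsManifold.of_le (n := (∞ : ℕ∞ω)) (by norm_cast)
  have hnear : ∀ᶠ p in nhds (n₀, x₀), MDifferentiableAt (𝓘(ℝ, EN).prod 𝓘(ℝ, E)) 𝓘(ℝ, G) h p :=
    ((contMDiffAt_iff_contMDiffAt_nhds (n := 1) (by simp)).1
      (ContMDiffAt.of_le (m := 1) (n := (∞ : ℕ∞ω)) hh (by norm_cast))).mono
      fun y hy => hy.mdifferentiableAt (by simp)
  filter_upwards [hnear] with p hp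
  exact MDifferentiableAt.comp (f := fun y => (p.1, y)) p.2 hp
    (mdifferentiableAt_const.prodMk mdifferentiableAt_id)

lemma ContMDiffAt.mdifferentiableAt_fst {h : N × M → G}
    (hh : ContMDiffAt (𝓘(ℝ, EN).prod 𝓘(ℝ, E)) 𝓘(ℝ, G) ∞ h (n₀, x₀)) :
    MDifferentiableAt 𝓘(ℝ, EN) 𝓘(ℝ, G) (fun n => h (n, x₀)) n₀ :=
  (eventually_mdifferentiableAt_fst hh).self_of_nhds

lemma mdifferentiableAt_clm_comp {H : Type*} [NormedAddCommGroup H] [NormedSpace ℝ H]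
    (A : G →L[ℝ] H) {f : N → G} (hf : MDifferentiableAt 𝓘(ℝ, EN) 𝓘(ℝ, G) f n₀) :
    MDifferentiableAt 𝓘(ℝ, EN) 𝓘(ℝ, H) (fun n => A (f n)) n₀ :=
  MDifferentiableAt.comp (g := A) n₀ A.mdifferentiableAt hf

lemma mvfderiv_clm_comp {H : Type*} [NormedAddCommGroup H] [NormedSpace ℝ H] (A : G →L[ℝ] H)
    {f : N → G} (hf : MDifferentiableAt 𝓘(ℝ, EN) 𝓘(ℝ, G) f n₀) (V : TangentSpace 𝓘(ℝ, EN) n₀) :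
    mvfderiv 𝓘(ℝ, EN) (fun n => A (f n)) n₀ V = A (mvfderiv 𝓘(ℝ, EN) f n₀ V) := by
  have h1 := mdifferentiableAt_clm_comp A hf
  refine (mvfderiv_eq_fderiv h1 V).trans ?_
  rw [mvfderiv_eq_fderiv hf V]
  have hd : DifferentiableAt ℝ (f ∘ (extChartAt 𝓘(ℝ, EN) n₀).symm) (extChartAt 𝓘(ℝ, EN) n₀ n₀) := by
    have := hf.differentiableWithinAt_writtenInExtChartAt
    rw [ModelWithCorners.range_eq_univ, differentiableWithinAt_univ] at this
    exact this
  exact DFunLike.congr_fun (A.hasFDerivAt.comp _ hd.hasFDerivAt).fderiv V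

/-- Near `x₀`, members of a smooth family are differentiable in the parameter. -/
lemma SmoothVecFamAt.eventually_mdifferentiableAt (h : SmoothVecFamAt EN Y n₀ x₀) :
    ∀ᶠ y in nhds x₀, MDifferentiableAt (M' := E) 𝓘(ℝ, EN) 𝓘(ℝ, E) (fun n => Y n y) n₀ := by
  have h1 := eventually_mdifferentiableAt_fst (contMDiffAt_totalSpace.1 h).2
  filter_upwards [h1, eventually_mem_baseSet (E := E) x₀] with y hy hyb
  set t := trivializationAt E (fun x : M => TangentSpace 𝓘(ℝ, E) x) x₀
  -- The base point `y` is fixed while `n` varies, so the vectors stay in one tangent space and are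
  -- a fixed linear image of their coordinates.
  let A : E →L[ℝ] E := t.symmL ℝ y
  have h2 := mdifferentiableAt_clm_comp A hy
  refine h2.congr_of_eventuallyEq (Eventually.of_forall fun n => ?_)
  change Y n y = t.symmL ℝ y ((t ⟨y, Y n y⟩).2)
  rw [t.symmL_apply hyb]
  exact (t.symm_apply_apply_mk hyb (Y n y)).symm

lemma vecComp_eq_clm {x₀ y : M}
    (hy : y ∈ (trivializationAt E (fun x : M => TangentSpace 𝓘(ℝ, E) x) x₀).baseSet) (i) :
    ∃ A : E →L[ℝ] ℝ, ∀ X : VecField E M, vecComp x₀ X i y = A (X y) := by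
  set t := trivializationAt E (fun x : M => TangentSpace 𝓘(ℝ, E) x) x₀
  refine ⟨(LinearMap.toContinuousLinearMap ((Module.finBasis ℝ E).coord i)).comp
    (t.continuousLinearMapAt ℝ y : E →L[ℝ] E), fun X => ?_⟩
  change _ = (Module.finBasis ℝ E).coord i (t.continuousLinearMapAt ℝ y (X y))
  rw [t.continuousLinearMapAt_apply (R := ℝ), t.linearMapAt_apply, if_pos hy]
  rfl

/-- At a fixed point the components depend linearly and continuously on the vector, so they pass
through the parameter derivative. -/
lemma vecComp_famDeriv {x₀ y : M}
    (hy : y ∈ (trivializationAt E (fun x : M => TangentSpace 𝓘(ℝ, E) x) x₀).baseSet)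
    (hd : MDifferentiableAt (M' := E) 𝓘(ℝ, EN) 𝓘(ℝ, E) (fun n => Y n y) n₀)
    (V : TangentSpace 𝓘(ℝ, EN) n₀) (i) :
    vecComp x₀ (famDeriv Y n₀ V) i y
      = mvfderiv 𝓘(ℝ, EN) (fun n => vecComp x₀ (Y n) i y) n₀ V := by
  obtain ⟨A, hA⟩ := vecComp_eq_clm hy i
  simp only [hA]
  exact (mvfderiv_clm_comp A hd V).symm

/-- A field is smooth when its components are. -/
lemma smoothVecAt_of_vecComp {X : VecField E M} {x₀ : M}
    (h : ∀ i, ContMDiffAt 𝓘(ℝ, E) 𝓘(ℝ, ℝ) ∞ (vecComp x₀ X i) x₀) : SmoothVecAt X x₀ := by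
  have : SmoothVecAt (fun y => ∑ i, (vecComp x₀ X i • vecFrame x₀ i) y) x₀ :=
    ContMDiffAt.sum_section (fun i _ => ContMDiffAt.smul_section (h i)
      (smoothVecAt_vecFrame (mem_baseSet (E := E) x₀) i))
  refine this.congr ?_
  filter_upwards [eventually_mem_baseSet (E := E) x₀] with y hy
  rw [sum_vecComp x₀ X hy]
  rfl

lemma SmoothVecFamAt.smoothVecAt_famDeriv (h : SmoothVecFamAt EN Y n₀ x₀)
    (V : TangentSpace 𝓘(ℝ, EN) n₀) : SmoothVecAt (famDeriv Y n₀ V) x₀ := by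
  refine smoothVecAt_of_vecComp fun i => ?_
  refine (contMDiffAt_mvfderiv_fst (h.contMDiffAt_vecComp i) V).congr_of_eventuallyEq ?_
  filter_upwards [eventually_mem_baseSet (E := E) x₀, h.eventually_mdifferentiableAt] with y h1 h2
  exact vecComp_famDeriv h1 h2 V i

/-- The divergence of a vector field in components. -/
lemma divg_eq_sum (hg : IsMetric g) {X : VecField E M} {x₀ x : M}
    (hx : x ∈ (trivializationAt E (fun x : M => TangentSpace 𝓘(ℝ, E) x) x₀).baseSet)
    (hX : ∀ i, MDifferentiableAt 𝓘(ℝ, E) 𝓘(ℝ, ℝ) (vecComp x₀ X i) x) :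
    divg g X x = ∑ i, (vecComp x₀ X i x * divg g (vecFrame x₀ i) x
      + diff (vecComp x₀ X i) x (vecFrame x₀ i x)) := by
  have hf : ∀ i, DiffVecAt (vecFrame x₀ i) x := fun i => (smoothVecAt_vecFrame hx i).diffVecAt
  -- The sum and product rules need differentiability of every partial sum, so this is carried along
  -- in the induction.
  have hs : ∀ s : Finset (Fin (Module.finrank ℝ E)),
      DiffVecAt (∑ i ∈ s, vecComp x₀ X i • vecFrame x₀ i) x ∧
      divg g (∑ i ∈ s, vecComp x₀ X i • vecFrame x₀ i) x
        = ∑ i ∈ s, (vecComp x₀ X i x * divg g (vecFrame x₀ i) x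
          + diff (vecComp x₀ X i) x (vecFrame x₀ i x)) := by
    classical
    intro s
    induction s using Finset.induction_on with
    | empty =>
      have h0 : DiffVecAt (0 : VecField E M) x := by
        have := diffVecAt_smul (f := fun _ => (0 : ℝ)) mdifferentiableAt_const
          (diffVecAt_extendVec (0 : TangentSpace 𝓘(ℝ, E) x))
        convert this using 1
        ext y
        simp
      refine ⟨by simpa using h0, ?_⟩
      have h2 := divg_add hg h0 h0
      simp only [add_zero, left_eq_add] at h2
      simpa using h2
    | insert i s his ih =>
      have h1 := diffVecAt_smul (hX i) (hf i)
      rw [Finset.sum_insert his, Finset.sum_insert his]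
      exact ⟨diffVecAt_add h1 ih.1, by rw [divg_add hg h1 ih.1, ih.2, divg_smul hg (hX i) (hf i)]⟩
  rw [← (hs Finset.univ).2]
  refine divg_congr hg (hs Finset.univ).1 ?_
  filter_upwards [(trivializationAt E (fun x : M => TangentSpace 𝓘(ℝ, E) x) x₀).open_baseSet.mem_nhds hx]
    with y hy
  rw [sum_vecComp x₀ X hy, Finset.sum_apply]
  rfl

/-- The basis `tbasis` need not be a smooth frame. The trace is therefore rewritten in `vecFrame x`,
where each diagonal entry is a component of a smooth covariant derivative. -/
lemma contMDiffAt_divg (hg : IsMetric g) {X : VecField E M} {x : M} (hX : SmoothVecAt X x) :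
    ContMDiffAt 𝓘(ℝ, E) 𝓘(ℝ, ℝ) ∞ (divg g X) x := by
  have hD := isLeviCivita_leviCivita hg
  have h1 : ContMDiffAt 𝓘(ℝ, E) 𝓘(ℝ, ℝ) ∞
      (fun y => ∑ i, vecComp x (fun z => leviCivita g X z (vecFrame x i z)) i y) x :=
    ContMDiffAt.sum fun i _ => vecComp_smooth
      (hD.smooth hg (smoothVecAt_vecFrame (mem_baseSet (E := E) x) i) hX) i
  refine h1.congr_of_eventuallyEq ?_
  filter_upwards [eventually_mem_baseSet (E := E) x] with y hy
  set t := trivializationAt E (fun x : M => TangentSpace 𝓘(ℝ, E) x) x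
  let e : E ≃ₗ[ℝ] TangentSpace 𝓘(ℝ, E) y := (t.linearEquivAt ℝ y hy).symm
  let b : Module.Basis (Fin (Module.finrank ℝ E)) ℝ (TangentSpace 𝓘(ℝ, E) y) :=
    (Module.finBasis ℝ E).map e
  refine (trace_eq_sum y (leviCivita g X y).toLinearMap).symm.trans ?_
  rw [LinearMap.trace_eq_matrix_trace ℝ b, Matrix.trace]
  refine Finset.sum_congr rfl fun i _ => ?_
  rw [Matrix.diag, LinearMap.toMatrix_apply]
  have hb : b i = vecFrame x i y := by
    rw [Module.Basis.map_apply]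
    change t.symm y _ = t.symmL ℝ y _
    rw [t.symmL_apply hy]
  rw [hb]
  rfl

/-- The divergence of a smooth family of vector fields is smooth. -/
theorem SmoothVecFamAt.contMDiffAt_divg (hg : IsMetric g) (h : SmoothVecFamAt EN Y n₀ x₀) :
    ContMDiffAt (𝓘(ℝ, EN).prod 𝓘(ℝ, E)) 𝓘(ℝ, ℝ) ∞ (fun p : N × M => divg g (Y p.1) p.2)
      (n₀, x₀) := by
  have hs := smoothVecAt_vecFrame (mem_baseSet (E := E) x₀)
  have h1 : ContMDiffAt (𝓘(ℝ, EN).prod 𝓘(ℝ, E)) 𝓘(ℝ, ℝ) ∞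
      (fun p : N × M => ∑ i, (vecComp x₀ (Y p.1) i p.2 * divg g (vecFrame x₀ i) p.2
      + mvfderiv 𝓘(ℝ, E) (fun y => vecComp x₀ (Y p.1) i y) p.2 (vecFrame x₀ i p.2)))
      (n₀, x₀) := by
    refine ContMDiffAt.sum fun i _ => ?_
    have a1 : ContMDiffAt (𝓘(ℝ, EN).prod 𝓘(ℝ, E)) 𝓘(ℝ, ℝ) ∞
        (fun p : N × M => divg g (vecFrame x₀ i) p.2) (n₀, x₀) :=
      ContMDiffAt.comp (f := fun p : N × M => p.2) (n₀, x₀)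
        (_root_.HitchinWitten.contMDiffAt_divg hg (hs i)) contMDiffAt_snd
    have a2 := h.contMDiffAt_vecComp i
    have a3 := contMDiffAt_mvfderiv_prod (hs i) a2
    exact (a2.mul a1).add a3
  refine h1.congr_of_eventuallyEq ?_
  have h2 : ∀ᶠ p in nhds (n₀, x₀), ∀ i,
      MDifferentiableAt 𝓘(ℝ, E) 𝓘(ℝ, ℝ) (fun y => vecComp x₀ (Y p.1) i y) p.2 :=
    eventually_all.2 fun i => eventually_mdifferentiableAt_snd (h.contMDiffAt_vecComp i)
  have c1 : Tendsto (fun p : N × M => p.2) (nhds (n₀, x₀)) (nhds x₀) := continuous_snd.tendsto _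
  filter_upwards [h2, c1.eventually (eventually_mem_baseSet (E := E) x₀)] with p hp hp2
  exact divg_eq_sum hg hp2 hp

lemma mvfderiv_sum' {ι : Type*} (s : Finset ι) {f : ι → N → ℝ}
    (hf : ∀ i, MDifferentiableAt 𝓘(ℝ, EN) 𝓘(ℝ, ℝ) (f i) n₀) (V : TangentSpace 𝓘(ℝ, EN) n₀) :
    MDifferentiableAt 𝓘(ℝ, EN) 𝓘(ℝ, ℝ) (fun n => ∑ i ∈ s, f i n) n₀ ∧
    mvfderiv 𝓘(ℝ, EN) (fun n => ∑ i ∈ s, f i n) n₀ V = ∑ i ∈ s, mvfderiv 𝓘(ℝ, EN) (f i) n₀ V := by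
  classical
  induction s using Finset.induction_on with
  | empty =>
    simp only [Finset.sum_empty]
    refine ⟨mdifferentiableAt_const, ?_⟩
    rw [mvfderiv_const]
    rfl
  | insert i s his ih =>
    simp only [Finset.sum_insert his]
    exact ⟨(hf i).add ih.1, by rw [← ih.2]; exact diff_add (hf i) ih.1 V⟩

lemma mvfderiv_mul_const {f : N → ℝ} (hf : MDifferentiableAt 𝓘(ℝ, EN) 𝓘(ℝ, ℝ) f n₀) (c : ℝ)
    (V : TangentSpace 𝓘(ℝ, EN) n₀) :
    mvfderiv 𝓘(ℝ, EN) (fun n => f n * c) n₀ V = mvfderiv 𝓘(ℝ, EN) f n₀ V * c := by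
  have h := diff_mul hf (mdifferentiableAt_const (c := c)) V
  have : diff (E := EN) (fun _ : N => c) n₀ V = 0 := by
    rw [diff, mvfderiv_const]; rfl
  rw [this, mul_zero, zero_add, mul_comm] at h
  exact h

lemma mvfderiv_sum_mul_add {ι : Type*} (s : Finset ι) {f h : ι → N → ℝ}
    (hf : ∀ i, MDifferentiableAt 𝓘(ℝ, EN) 𝓘(ℝ, ℝ) (f i) n₀)
    (hh : ∀ i, MDifferentiableAt 𝓘(ℝ, EN) 𝓘(ℝ, ℝ) (h i) n₀) (c : ι → ℝ)
    (V : TangentSpace 𝓘(ℝ, EN) n₀) :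
    mvfderiv 𝓘(ℝ, EN) (fun n => ∑ i ∈ s, (f i n * c i + h i n)) n₀ V
      = ∑ i ∈ s, (mvfderiv 𝓘(ℝ, EN) (f i) n₀ V * c i + mvfderiv 𝓘(ℝ, EN) (h i) n₀ V) := by
  have hm : ∀ i, MDifferentiableAt 𝓘(ℝ, EN) 𝓘(ℝ, ℝ) (fun n => f i n * c i) n₀ := fun i =>
    MDifferentiableAt.mul (hf i) mdifferentiableAt_const
  refine (mvfderiv_sum' s (fun i => (hm i).add (hh i)) V).2.trans ?_
  refine Finset.sum_congr rfl fun i _ => ?_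
  refine (diff_add (hm i) (hh i) V).trans ?_
  exact congrArg₂ (· + ·) (mvfderiv_mul_const (hf i) _ V) rfl

/-- The divergence commutes with derivatives in the parameter. -/
theorem SmoothVecFamAt.mvfderiv_divg (hg : IsMetric g) (h : SmoothVecFamAt EN Y n₀ x₀)
    (V : TangentSpace 𝓘(ℝ, EN) n₀) :
    mvfderiv 𝓘(ℝ, EN) (fun n => divg g (Y n) x₀) n₀ V = divg g (famDeriv Y n₀ V) x₀ := by
  have hs := smoothVecAt_vecFrame (mem_baseSet (E := E) x₀)
  have hc := fun i => h.contMDiffAt_vecComp i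
  have hm : ∀ i, MDifferentiableAt 𝓘(ℝ, EN) 𝓘(ℝ, ℝ) (fun n => vecComp x₀ (Y n) i x₀) n₀ :=
    fun i => ContMDiffAt.mdifferentiableAt_fst (h := fun p : N × M => vecComp x₀ (Y p.1) i p.2) (hc i)
  have hd := fun i => contMDiffAt_mvfderiv_prod (hs i) (hc i)
  have hm' : ∀ i, MDifferentiableAt 𝓘(ℝ, EN) 𝓘(ℝ, ℝ)
      (fun n => mvfderiv 𝓘(ℝ, E) (fun y => vecComp x₀ (Y n) i y) x₀
        (vecFrame x₀ i x₀)) n₀ := fun i =>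
    ContMDiffAt.mdifferentiableAt_fst (hd i)
  have c1 : Tendsto (fun n : N => (n, x₀)) (nhds n₀) (nhds (n₀, x₀)) :=
    (Continuous.prodMk_left x₀).tendsto n₀
  -- In components the divergence involves `n` only through the components and their first
  -- derivatives in `M`; the numbers `divg g (vecFrame x₀ i) x₀` are constants.
  have e1 : ∀ᶠ n in nhds n₀, divg g (Y n) x₀ = ∑ i, (vecComp x₀ (Y n) i x₀
        * divg g (vecFrame x₀ i) x₀
      + mvfderiv 𝓘(ℝ, E) (fun y => vecComp x₀ (Y n) i y) x₀ (vecFrame x₀ i x₀)) := by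
    have h2 : ∀ᶠ p in nhds (n₀, x₀), ∀ i,
        MDifferentiableAt 𝓘(ℝ, E) 𝓘(ℝ, ℝ) (fun y => vecComp x₀ (Y p.1) i y) p.2 :=
      eventually_all.2 fun i => eventually_mdifferentiableAt_snd (h.contMDiffAt_vecComp i)
    have h3 := c1.eventually h2
    exact h3.mono fun n hn => divg_eq_sum hg (mem_baseSet (E := E) x₀) hn
  have e2 : mvfderiv 𝓘(ℝ, EN) (fun n => divg g (Y n) x₀) n₀ V
      = ∑ i, (mvfderiv 𝓘(ℝ, EN) (fun n => vecComp x₀ (Y n) i x₀) n₀ V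
          * divg g (vecFrame x₀ i) x₀
        + mvfderiv 𝓘(ℝ, EN) (fun n => mvfderiv 𝓘(ℝ, E)
            (fun y => vecComp x₀ (Y n) i y) x₀ (vecFrame x₀ i x₀)) n₀ V) := by
    have h5 := mvfderiv_congr e1 V
    have h6 := mvfderiv_sum_mul_add Finset.univ hm hm' (fun i => divg g (vecFrame x₀ i) x₀) V
    rw [h5, h6]
  have hev : ∀ i, ∀ᶠ y in nhds x₀, vecComp x₀ (famDeriv Y n₀ V) i y
      = mvfderiv 𝓘(ℝ, EN) (fun n => vecComp x₀ (Y n) i y) n₀ V := fun i =>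
    (eventually_mem_baseSet (E := E) x₀).mp (h.eventually_mdifferentiableAt.mono
      fun y h2 h1 => vecComp_famDeriv h1 h2 V i)
  -- Derivatives along the parameter space and along `M` are interchanged here.
  have h4 : ∀ i, mvfderiv 𝓘(ℝ, EN) (fun n => mvfderiv 𝓘(ℝ, E) (fun y => vecComp x₀ (Y n) i y) x₀
      (vecFrame x₀ i x₀)) n₀ V = diff (vecComp x₀ (famDeriv Y n₀ V) i) x₀ (vecFrame x₀ i x₀) := by
    intro i
    have h1 := mvfderiv_mvfderiv_comm (h := fun p : N × M => vecComp x₀ (Y p.1) i p.2) (hc i) V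
      (vecFrame x₀ i x₀)
    have h2 := mvfderiv_congr (hev i) (vecFrame x₀ i x₀)
    exact h1.trans h2.symm
  have h5 := divg_eq_sum hg (mem_baseSet (E := E) x₀) fun i =>
    vecComp_mdiff (h.smoothVecAt_famDeriv V).diffVecAt i
  rw [e2, h5]
  simp only [h4, fun i => (hev i).self_of_nhds]

end VecFamilies

end HitchinWitten

namespace HitchinWitten

open VectorField

/-! ### The real manifold underlying a complex manifold, and product rules. -/

section RealStructure

/-- Transition maps that are smooth over `ℂ` are smooth over `ℝ`; all derivatives in the parameter
are taken over `ℝ`. -/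
lemma isManifold_real {P : Type*} [NormedAddCommGroup P] [NormedSpace ℂ P]
    {S : Type*} [TopologicalSpace S] [ChartedSpace P S] [h : IsManifold 𝓘(ℂ, P) ∞ S] :
    IsManifold 𝓘(ℝ, P) ∞ S := by
  refine isManifold_of_contDiffOn _ _ _ fun e e' he he' => ?_
  have h1 := h.compatible he he'
  rw [contDiffGroupoid, mem_groupoid_of_pregroupoid] at h1
  have h2 := h1.1
  simp only [contDiffPregroupoid] at h2
  exact ContDiffOn.restrict_scalars ℝ h2

end RealStructure

lemma mvfderiv_clm_apply {EN : Type*} [NormedAddCommGroup EN] [NormedSpace ℝ EN]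
    {N : Type*} [TopologicalSpace N] [ChartedSpace EN N] [IsManifold 𝓘(ℝ, EN) ∞ N]
    {G H : Type*} [NormedAddCommGroup G] [NormedSpace ℝ G] [NormedAddCommGroup H] [NormedSpace ℝ H]
    {B : N → H →L[ℝ] G} {n₀ : N} (hB : MDifferentiableAt 𝓘(ℝ, EN) 𝓘(ℝ, H →L[ℝ] G) B n₀) (a : H)
    (V : TangentSpace 𝓘(ℝ, EN) n₀) :
    mvfderiv 𝓘(ℝ, EN) (fun n => B n a) n₀ V = mvfderiv 𝓘(ℝ, EN) B n₀ V a :=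
  mvfderiv_clm_comp (ContinuousLinearMap.apply ℝ G a) hB V

lemma differentiableAt_chart {EN : Type*} [NormedAddCommGroup EN] [NormedSpace ℝ EN]
    {N : Type*} [TopologicalSpace N] [ChartedSpace EN N]
    {G : Type*} [NormedAddCommGroup G] [NormedSpace ℝ G] {f : N → G} {n₀ : N}
    (hf : MDifferentiableAt 𝓘(ℝ, EN) 𝓘(ℝ, G) f n₀) :
    DifferentiableAt ℝ (f ∘ (extChartAt 𝓘(ℝ, EN) n₀).symm) (extChartAt 𝓘(ℝ, EN) n₀ n₀) := by
  have := hf.differentiableWithinAt_writtenInExtChartAt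
  rw [ModelWithCorners.range_eq_univ, differentiableWithinAt_univ] at this
  exact this

/-- The product rule for the evaluation of continuous linear maps. -/
lemma mvfderiv_clm_apply_fun {EN : Type*} [NormedAddCommGroup EN] [NormedSpace ℝ EN]
    {N : Type*} [TopologicalSpace N] [ChartedSpace EN N]
    {G H : Type*} [NormedAddCommGroup G] [NormedSpace ℝ G] [NormedAddCommGroup H] [NormedSpace ℝ H]
    {B : N → H →L[ℝ] G} {Y : N → H} {n₀ : N}
    (hB : MDifferentiableAt 𝓘(ℝ, EN) 𝓘(ℝ, H →L[ℝ] G) B n₀)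
    (hY : MDifferentiableAt 𝓘(ℝ, EN) 𝓘(ℝ, H) Y n₀) (V : TangentSpace 𝓘(ℝ, EN) n₀) :
    mvfderiv 𝓘(ℝ, EN) (fun n => B n (Y n)) n₀ V
      = B n₀ (mvfderiv 𝓘(ℝ, EN) Y n₀ V) + mvfderiv 𝓘(ℝ, EN) B n₀ V (Y n₀) := by
  have h1 : MDifferentiableAt 𝓘(ℝ, EN) 𝓘(ℝ, G) (fun n => B n (Y n)) n₀ := hB.clm_apply hY
  have h2 := (differentiableAt_chart hB).hasFDerivAt.clm_apply (differentiableAt_chart hY).hasFDerivAt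
  refine (mvfderiv_eq_fderiv h1 V).trans ?_
  rw [mvfderiv_eq_fderiv hB V, mvfderiv_eq_fderiv hY V]
  refine (DFunLike.congr_fun h2.fderiv V).trans ?_
  simp only [Function.comp, extChartAt_to_inv]
  rfl

/-! ### Variation of gradients and Laplacians in a Kähler family. -/

section KahlerFamilies

variable {E : Type*} [NormedAddCommGroup E] [NormedSpace ℝ E] [FiniteDimensional ℝ E]
  {M : Type*} [TopologicalSpace M] [ChartedSpace E M] [IsManifold 𝓘(ℝ, E) ∞ M]
  {P : Type*} [NormedAddCommGroup P] [NormedSpace ℂ P]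
  {S : Type*} [TopologicalSpace S] [ChartedSpace P S] [IsManifold 𝓘(ℝ, P) ∞ S]
  {Ω : BilinField E M} {J : S → EndField E M}

lemma SmoothVecFamAt.contMDiffAt_param {Y : S → VecField E M} {n₀ : S} {x₀ : M}
    (h : SmoothVecFamAt P Y n₀ x₀) :
    ContMDiffAt (M' := E) 𝓘(ℝ, P) 𝓘(ℝ, E) ∞ (fun n => Y n x₀) n₀ := by
  set t := trivializationAt E (fun x : M => TangentSpace 𝓘(ℝ, E) x) x₀
  have h1 : ContMDiffAt 𝓘(ℝ, P) 𝓘(ℝ, E) ∞ (fun n => (t ⟨x₀, Y n x₀⟩).2) n₀ :=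
    ContMDiffAt.comp (f := fun n : S => (n, x₀)) n₀ (contMDiffAt_totalSpace.1 h).2
      (contMDiffAt_id.prodMk contMDiffAt_const)
  let A : E →L[ℝ] E := t.symmL ℝ x₀
  have h2 : ContMDiffAt 𝓘(ℝ, P) 𝓘(ℝ, E) ∞ (fun n => A ((t ⟨x₀, Y n x₀⟩).2)) n₀ :=
    A.contMDiff.contMDiffAt.comp n₀ h1
  refine h2.congr_of_eventuallyEq (Eventually.of_forall fun n => ?_)
  change Y n x₀ = t.symmL ℝ x₀ ((t ⟨x₀, Y n x₀⟩).2)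
  rw [t.symmL_apply (mem_baseSet (E := E) x₀)]
  exact (t.symm_apply_apply_mk (mem_baseSet (E := E) x₀) (Y n x₀)).symm

lemma IsKahlerFamily.smoothVecFamAt (hJ : IsKahlerFamily (P := P) Ω J) {X : VecField E M} {x : M}
    (hX : SmoothVecAt X x) (σ : S) : SmoothVecFamAt P (fun τ y => J τ y (X y)) σ x := by
  have h1 : ContMDiffAt (𝓘(ℝ, P).prod 𝓘(ℝ, E)) (𝓘(ℝ, E).prod 𝓘(ℝ, E)) ∞
      (fun p : S × M => TotalSpace.mk' E (E := fun x : M => TangentSpace 𝓘(ℝ, E) x) p.2 (X p.2))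
      (σ, x) :=
    ContMDiffAt.comp (x := (σ, x)) (f := fun q : S × M => q.2) hX contMDiffAt_snd
  exact ContMDiffAt.clm_bundle_apply (hJ.smooth (σ, x)) h1

lemma IsKahlerFamily.isCompatible (hJ : IsKahlerFamily (P := P) Ω J) (hΩ : IsSymplectic Ω) (σ : S) :
    IsCompatible Ω (J σ) where
  nondeg := hΩ.isNondegForm
  skew := skew_of_alt hΩ.alt
  sq := hJ.sq σ
  symm := hJ.symm σ
  smooth hY := (hJ.smoothVecFamAt hY σ).smoothVecAt
  mdiff {Y x} hY := by
    refine diffVecAt_endField hY fun i => ?_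
    exact (hJ.smoothVecFamAt (smoothVecAt_vecFrame (mem_baseSet (E := E) x) i)
      σ).smoothVecAt.diffVecAt

/-- The derivative `V[J]` of a family of endomorphism fields, applied to a vector. -/
def paramDerivEnd (J : S → EndField E M) (σ : S) (V : TangentSpace 𝓘(ℝ, P) σ) (x : M)
    (v : TangentSpace 𝓘(ℝ, E) x) : TangentSpace 𝓘(ℝ, E) x :=
  mvfderiv (F := E) 𝓘(ℝ, P) (fun τ => J τ x v) σ V

/-- `G̃(V)` is minus the derivative of the complex structure, composed with the Poisson tensor. -/
lemma gtilde_apply (hJ : IsKahlerFamily (P := P) Ω J) (hΩ : IsSymplectic Ω) (σ : S)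
    (V : TangentSpace 𝓘(ℝ, P) σ) (x : M) (α : TangentSpace 𝓘(ℝ, E) x →L[ℝ] ℝ) :
    Gtilde Ω J σ V x α = -paramDerivEnd J σ V x (invMetric Ω x α) := by
  let B : S → (E →L[ℝ] ℝ) →L[ℝ] E := fun τ => invMetric (kahlerMetric Ω (J τ)) x
  have hB : ∀ (τ : S) (β : TangentSpace 𝓘(ℝ, E) x →L[ℝ] ℝ), B τ β = J τ x (invMetric Ω x β) :=
    fun τ β => (hJ.isCompatible hΩ τ).invMetric_kahler x β
  -- `Gtilde` differentiates an operator-valued map, so differentiability has to be shown for the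
  -- operator; in finite dimension it follows from that of its values.
  have h1 : ContMDiffAt 𝓘(ℝ, P) 𝓘(ℝ, (E →L[ℝ] ℝ) →L[ℝ] E) ∞ B σ := by
    refine contMDiffAt_clm_of_apply fun β => ?_
    have h2 := (hJ.smoothVecFamAt (smoothVecAt_extendVec (invMetric Ω x β)) σ).contMDiffAt_param
    refine h2.congr_of_eventuallyEq (Eventually.of_forall fun τ => ?_)
    refine (hB τ β).trans ?_
    exact congrArg (J τ x) (extendVec_self _).symm
  let α' : E →L[ℝ] ℝ := α
  have h2 := mvfderiv_clm_apply (h1.mdifferentiableAt (by simp)) α' V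
  have h3 := mvfderiv_congr (G := E) (Eventually.of_forall fun τ => hB τ α) V
  exact congrArg (fun e : E => -e) (h2.symm.trans h3)

lemma gtilde_apply_field (hJ : IsKahlerFamily (P := P) Ω J) (hΩ : IsSymplectic Ω) (σ : S)
    (V : TangentSpace 𝓘(ℝ, P) σ) (α : OneForm E M) :
    (fun y => Gtilde Ω J σ V y (α y))
      = -famDeriv (fun τ y => J τ y (invMetric Ω y (α y))) σ V := by
  ext y
  exact gtilde_apply hJ hΩ σ V y (α y)

/-- One-forms whose values on smooth vector fields are smooth. -/
def SmoothFormAt (α : OneForm E M) (x : M) : Prop :=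
  ∀ Z, SmoothVecAt Z x → ContMDiffAt 𝓘(ℝ, E) 𝓘(ℝ, ℝ) ∞ (fun y => α y (Z y)) x

/-- A contravariant tensor that maps smooth one-forms to smooth vector fields. -/
def SmoothBivector (T : Bivector E M) : Prop :=
  ∀ (α : OneForm E M) (x : M), SmoothFormAt α x → SmoothVecAt (fun y => T y (α y)) x

/-- A symmetric contravariant tensor. -/
def SymmBivector (T : Bivector E M) : Prop :=
  ∀ x (α β : TangentSpace 𝓘(ℝ, E) x →L[ℝ] ℝ), α (T x β) = β (T x α)

lemma smoothFormAt_diff {f : M → ℝ} {x : M} (hf : ContMDiffAt 𝓘(ℝ, E) 𝓘(ℝ, ℝ) ∞ f x) :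
    SmoothFormAt (E := E) (diff f) x := fun _ hZ => contMDiffAt_dirDeriv hZ hf

lemma smoothBivector_gtilde (hJ : IsKahlerFamily (P := P) Ω J) (hΩ : IsSymplectic Ω) (σ : S)
    (V : TangentSpace 𝓘(ℝ, P) σ) : SmoothBivector (Gtilde Ω J σ V) := by
  intro α x hα
  rw [gtilde_apply_field hJ hΩ]
  have h1 := hΩ.isNondegForm.smoothVecAt_invMetric hα
  exact ContMDiffAt.neg_section ((hJ.smoothVecFamAt h1 σ).smoothVecAt_famDeriv V)

lemma smoothVecAt_grad {g : BilinField E M} (hg : IsMetric g) {f : M → ℝ} {x : M}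
    (hf : ContMDiffAt 𝓘(ℝ, E) 𝓘(ℝ, ℝ) ∞ f x) : SmoothVecAt (grad g f) x :=
  hg.toIsNondegForm.smoothVecAt_invMetric (smoothFormAt_diff hf)

lemma mdifferentiableAt_param (hJ : IsKahlerFamily (P := P) Ω J) (σ : S) (x : M)
    (v : TangentSpace 𝓘(ℝ, E) x) :
    MDifferentiableAt (M' := E) 𝓘(ℝ, P) 𝓘(ℝ, E) (fun τ => J τ x v) σ := by
  have h := (hJ.smoothVecFamAt (smoothVecAt_extendVec v) σ).contMDiffAt_param
  simp only [extendVec_self] at h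
  exact h.mdifferentiableAt (by simp)

/-- Every `g̃_τ` is symmetric, and symmetry is a linear condition that passes to the derivative in
`τ`. -/
lemma symmBivector_gtilde (hJ : IsKahlerFamily (P := P) Ω J) (hΩ : IsSymplectic Ω) (σ : S)
    (V : TangentSpace 𝓘(ℝ, P) σ) : SymmBivector (Gtilde Ω J σ V) := by
  intro x α β
  rw [gtilde_apply hJ hΩ, gtilde_apply hJ hΩ, map_neg, map_neg]
  let α' : E →L[ℝ] ℝ := α
  let β' : E →L[ℝ] ℝ := β
  have h1 := mvfderiv_clm_comp α' (mdifferentiableAt_param hJ σ x (invMetric Ω x β)) V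
  have h2 := mvfderiv_clm_comp β' (mdifferentiableAt_param hJ σ x (invMetric Ω x α)) V
  refine congrArg Neg.neg (h1.symm.trans (Eq.trans ?_ h2))
  refine mvfderiv_congr (Eventually.of_forall fun τ => ?_) V
  have hc := hJ.isCompatible hΩ τ
  have hs := hc.symm x (invMetric (kahlerMetric Ω (J τ)) x α)
    (invMetric (kahlerMetric Ω (J τ)) x β)
  rw [apply_invMetric _ (hc.isMetric.injective x), apply_invMetric _ (hc.isMetric.injective x),
    hc.invMetric_kahler, hc.invMetric_kahler] at hs
  exact hs

variable (hJ : IsKahlerFamily (P := P) Ω J) (hΩ : IsSymplectic Ω)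
include hJ hΩ

/-- The gradient is `J τ` applied to a field built from `Ω` and `df` that does not depend on `τ`;
smoothness and the derivative in `τ` reduce to those of `J`. -/
lemma grad_eq (τ : S) (f : M → ℝ) :
    grad (kahlerMetric Ω (J τ)) f = fun y => J τ y (invMetric Ω y (diff f y)) := by
  ext y
  exact (hJ.isCompatible hΩ τ).invMetric_kahler y _

/-- Gradients form a smooth family. -/
lemma smoothVecFamAt_grad {f : M → ℝ} {x : M} (hf : ContMDiffAt 𝓘(ℝ, E) 𝓘(ℝ, ℝ) ∞ f x) (σ : S) :
    SmoothVecFamAt P (fun τ => grad (kahlerMetric Ω (J τ)) f) σ x := by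
  simp only [grad_eq hJ hΩ]
  exact hJ.smoothVecFamAt (hΩ.isNondegForm.smoothVecAt_invMetric (smoothFormAt_diff hf)) σ

lemma famDeriv_grad (f : M → ℝ) (σ : S) (V : TangentSpace 𝓘(ℝ, P) σ) :
    famDeriv (fun τ => grad (kahlerMetric Ω (J τ)) f) σ V
      = -fun y => Gtilde Ω J σ V y (diff f y) := by
  simp only [grad_eq hJ hΩ]
  rw [gtilde_apply_field hJ hΩ, neg_neg]

/-- The connection is frozen at `σ`, by independence of the divergence from the complex structure;
only the gradient still moves with `τ`. -/
lemma laplacian_eq (σ τ : S) {f : M → ℝ} {x : M} (hf : ContMDiffAt 𝓘(ℝ, E) 𝓘(ℝ, ℝ) ∞ f x) :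
    laplacian (kahlerMetric Ω (J τ)) f x
      = divg (kahlerMetric Ω (J σ)) (grad (kahlerMetric Ω (J τ)) f) x :=
  divg_eq_divg (hJ.isCompatible hΩ τ) (hJ.isCompatible hΩ σ)
    (smoothVecFamAt_grad hJ hΩ hf τ).smoothVecAt.diffVecAt

lemma contMDiff_laplacian {f : M → ℝ} (hf : ContMDiff 𝓘(ℝ, E) 𝓘(ℝ, ℝ) ∞ f) :
    ContMDiff (𝓘(ℝ, P).prod 𝓘(ℝ, E)) 𝓘(ℝ, ℝ) ∞
      (fun p : S × M => laplacian (kahlerMetric Ω (J p.1)) f p.2) := by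
  intro p
  have h := (smoothVecFamAt_grad hJ hΩ (hf p.2) p.1).contMDiffAt_divg
    (hJ.isCompatible hΩ p.1).isMetric
  refine ContMDiffAt.congr_of_eventuallyEq h (Eventually.of_forall fun q => ?_)
  exact laplacian_eq hJ hΩ p.1 q.1 (hf q.2)

/-- `V[Δf] = -div (G̃(V) · df)`. -/
lemma paramDeriv_laplacian {f : M → ℝ} (hf : ContMDiff 𝓘(ℝ, E) 𝓘(ℝ, ℝ) ∞ f) (σ : S)
    (V : TangentSpace 𝓘(ℝ, P) σ) (x : M) :
    paramDeriv (fun τ => laplacian (kahlerMetric Ω (J τ)) f) σ V x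
      = -divg (kahlerMetric Ω (J σ)) (fun y => Gtilde Ω J σ V y (diff f y)) x := by
  have hm := (hJ.isCompatible hΩ σ).isMetric
  -- With the connection frozen, the derivative passes under the divergence onto the gradient.
  have h := (smoothVecFamAt_grad hJ hΩ (hf x) σ).mvfderiv_divg hm V
  rw [famDeriv_grad hJ hΩ] at h
  have h2 := divg_smul hm (f := fun _ : M => (-1 : ℝ)) (X := fun y => Gtilde Ω J σ V y (diff f y)) (x := x)
    mdifferentiableAt_const
    (smoothBivector_gtilde hJ hΩ σ V _ x (smoothFormAt_diff (hf x))).diffVecAt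
  have h3 : diff (E := E) (fun _ : M => (-1 : ℝ)) x = 0 := mvfderiv_const _
  have h4 : ((fun _ : M => (-1 : ℝ)) • fun y => Gtilde Ω J σ V y (diff f y))
      = -fun y => Gtilde Ω J σ V y (diff f y) := by
    ext y
    simp
  rw [h3, h4] at h2
  have h5 : ∀ τ, laplacian (kahlerMetric Ω (J τ)) f x
      = divg (kahlerMetric Ω (J σ)) (grad (kahlerMetric Ω (J τ)) f) x := fun τ =>
    laplacian_eq hJ hΩ σ τ (hf x)
  simp only [paramDeriv, h5]
  rw [h, h2]
  simp

omit hJ hΩ in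
lemma contMDiffAt_diff_param {F : S → M → ℝ}
    (hF : ContMDiff (𝓘(ℝ, P).prod 𝓘(ℝ, E)) 𝓘(ℝ, ℝ) ∞ (fun p : S × M => F p.1 p.2)) (σ : S) (x : M) :
    ContMDiffAt (M' := E →L[ℝ] ℝ) 𝓘(ℝ, P) 𝓘(ℝ, E →L[ℝ] ℝ) ∞ (fun τ => diff (F τ) x) σ := by
  refine contMDiffAt_clm_of_apply fun v => ?_
  let v' : TangentSpace 𝓘(ℝ, E) x := v
  have h1 := contMDiffAt_mvfderiv_prod (smoothVecAt_extendVec v') (hF (σ, x))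
  have h2 := ContMDiffAt.comp (f := fun τ : S => (τ, x)) σ h1
    (contMDiffAt_id.prodMk contMDiffAt_const)
  refine h2.congr_of_eventuallyEq (Eventually.of_forall fun τ => ?_)
  exact congrArg (diff (F τ) x) (extendVec_self v').symm

/-- `V[dF · g̃ · df] = d(V[F]) · g̃ · df - dF · G̃(V) · df`. -/
lemma paramDeriv_diff_grad {F : S → M → ℝ}
    (hF : ContMDiff (𝓘(ℝ, P).prod 𝓘(ℝ, E)) 𝓘(ℝ, ℝ) ∞ (fun p : S × M => F p.1 p.2))
    {f : M → ℝ} (hf : ContMDiff 𝓘(ℝ, E) 𝓘(ℝ, ℝ) ∞ f) (σ : S)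
    (V : TangentSpace 𝓘(ℝ, P) σ) (x : M) :
    paramDeriv (fun τ y => diff (F τ) y (grad (kahlerMetric Ω (J τ)) f y)) σ V x
      = diff (paramDeriv F σ V) x (grad (kahlerMetric Ω (J σ)) f x)
        - diff (F σ) x (Gtilde Ω J σ V x (diff f x)) := by
  have h1 := (contMDiffAt_diff_param hF σ x).mdifferentiableAt (by simp)
  have h2 := (smoothVecFamAt_grad hJ hΩ (hf x) σ).contMDiffAt_param.mdifferentiableAt (by simp)
  have h3 := mvfderiv_clm_apply_fun h1 h2 V
  have h4 := congrFun (famDeriv_grad hJ hΩ f σ V) x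
  -- The parameter derivative of `dF` is `d(V[F])`, by commutation of mixed derivatives.
  have h5 : (mvfderiv (F := E →L[ℝ] ℝ) 𝓘(ℝ, P) (fun τ => diff (F τ) x) σ V)
      (grad (kahlerMetric Ω (J σ)) f x)
      = diff (paramDeriv F σ V) x (grad (kahlerMetric Ω (J σ)) f x) :=
    (mvfderiv_clm_apply h1 _ V).symm.trans (mvfderiv_mvfderiv_comm (hF (σ, x)) V _)
  have h6 : diff (F σ) x (famDeriv (fun τ => grad (kahlerMetric Ω (J τ)) f) σ V x)
      = - diff (F σ) x (Gtilde Ω J σ V x (diff f x)) := by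
    rw [h4, Pi.neg_apply, map_neg]
  refine h3.trans ?_
  refine (congrArg₂ (· + ·) h6 h5).trans ?_
  ring

lemma contMDiff_diff_grad {F : S → M → ℝ}
    (hF : ContMDiff (𝓘(ℝ, P).prod 𝓘(ℝ, E)) 𝓘(ℝ, ℝ) ∞ (fun p : S × M => F p.1 p.2))
    {f : M → ℝ} (hf : ContMDiff 𝓘(ℝ, E) 𝓘(ℝ, ℝ) ∞ f) :
    ContMDiff (𝓘(ℝ, P).prod 𝓘(ℝ, E)) 𝓘(ℝ, ℝ) ∞
      (fun p : S × M => diff (F p.1) p.2 (grad (kahlerMetric Ω (J p.1)) f p.2)) := by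
  rintro ⟨σ, x⟩
  have hY := smoothVecFamAt_grad hJ hΩ (hf x) σ
  have h1 : ContMDiffAt (𝓘(ℝ, P).prod 𝓘(ℝ, E)) 𝓘(ℝ, ℝ) ∞
      (fun p : S × M => ∑ i, vecComp x (grad (kahlerMetric Ω (J p.1)) f) i p.2
        * mvfderiv 𝓘(ℝ, E) (fun y => F p.1 y) p.2 (vecFrame x i p.2)) (σ, x) := by
    refine ContMDiffAt.sum fun i _ => ?_
    have a1 := hY.contMDiffAt_vecComp i
    have a2 := contMDiffAt_mvfderiv_prod
      (smoothVecAt_vecFrame (mem_baseSet (E := E) x) i) (hF (σ, x))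
    exact a1.mul a2
  refine h1.congr_of_eventuallyEq ?_
  have c1 : Tendsto (fun p : S × M => p.2) (nhds (σ, x)) (nhds x) := continuous_snd.tendsto _
  refine (c1.eventually (eventually_mem_baseSet (E := E) x)).mono fun p hp => ?_
  change diff (F p.1) p.2 (grad (kahlerMetric Ω (J p.1)) f p.2) = _
  rw [sum_vecComp x (grad (kahlerMetric Ω (J p.1)) f) hp, map_sum]
  refine Finset.sum_congr rfl fun i _ => ?_
  rw [map_smul]
  rfl

end KahlerFamilies

end HitchinWitten

namespace HitchinWitten

open VectorField

/-! ### Coordinates on the fibres of `L^k`. -/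

section Powers

variable {M : Type*} [TopologicalSpace M]
  {L : M → Type*} [∀ x, AddCommGroup (L x)] [∀ x, Module ℂ (L x)]
  [∀ x, TopologicalSpace (L x)] [TopologicalSpace (TotalSpace ℂ L)] [FiberBundle ℂ L]
  [VectorBundle ℂ ℂ L]

/-- The domain of the preferred trivialisation of `L` at `x₀`. -/
abbrev lbase (L : M → Type*) [∀ x, TopologicalSpace (L x)] [TopologicalSpace (TotalSpace ℂ L)]
    [FiberBundle ℂ L] (x₀ : M) : Set M := (trivializationAt ℂ L x₀).baseSet

/-- The coordinate on the fibres of `L` in the preferred trivialisation at `x₀`. -/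
abbrev lcoord (x₀ y : M) : L y →ₗ[ℂ] ℂ := (trivializationAt ℂ L x₀).linearMapAt ℂ y

lemma mem_lbase (x : M) : x ∈ lbase L x := FiberBundle.mem_baseSet_trivializationAt' x

lemma lbase_mem_nhds {x₀ y : M} (hy : y ∈ lbase L x₀) : lbase L x₀ ∈ nhds y :=
  (trivializationAt ℂ L x₀).open_baseSet.mem_nhds hy

lemma lcoord_frame {x₀ y : M} (hy : y ∈ lbase L x₀) : lcoord x₀ y (frame (L := L) x₀ y) = 1 :=
  (trivializationAt ℂ L x₀).linearMapAt_symm (R := ℂ) hy 1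

lemma lcoord_smul_frame {x₀ y : M} (hy : y ∈ lbase L x₀) (a : L y) :
    lcoord x₀ y a • frame (L := L) x₀ y = a := by
  have h1 := (trivializationAt ℂ L x₀).symm_linearMapAt (R := ℂ) hy a
  have h2 : ∀ z : ℂ, (trivializationAt ℂ L x₀).symm y z = z • frame (L := L) x₀ y := fun z => by
    have h3 := ((trivializationAt ℂ L x₀).symmₗ ℂ y).map_smul z (1 : ℂ)
    rw [smul_eq_mul, mul_one, Trivialization.symmₗ_apply _ hy, Trivialization.symmₗ_apply _ hy] at h3
    exact h3
  rw [← h2]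
  exact h1

/-- The power `a ⊗ ⋯ ⊗ a`. -/
def tpow (k : ℕ) {x : M} (a : L x) : LPow L k x := PiTensorProduct.tprod ℂ fun _ => a

lemma tpow_smul (k : ℕ) {x : M} (c : ℂ) (a : L x) : tpow k (c • a) = c ^ k • tpow k a := by
  have := (PiTensorProduct.tprod ℂ (s := fun _ : Fin k => L x)).map_smul_univ
    (fun _ => c) (fun _ => a)
  simpa [tpow] using this

lemma coord_tpow (k : ℕ) (x₀ : M) {y : M} (a : L y) :
    coord k x₀ y (tpow k a) = lcoord x₀ y a ^ k := by
  simp [coord, tpow]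

/-- Each factor of a pure tensor is a multiple of the frame vector, and multilinearity collects the
scalars. So the fibre of `L^k` is a line, and identities in it may be checked after applying
`coord`. -/
lemma coord_smul_tpow {k : ℕ} {x₀ y : M} (hy : y ∈ lbase L x₀) (z : LPow L k y) :
    coord k x₀ y z • tpow k (frame x₀ y) = z := by
  induction z using PiTensorProduct.induction_on with
  | smul_tprod r f =>
    rw [map_smul, smul_assoc]
    congr 1
    have h1 := (PiTensorProduct.tprod ℂ (s := fun _ : Fin k => L y)).map_smul_univ
      (fun j => lcoord x₀ y (f j)) (fun _ => frame x₀ y)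
    simp only [lcoord_smul_frame hy] at h1
    conv_rhs => rw [h1]
    simp [coord, tpow]
  | add a b ha hb => rw [map_add, add_smul, ha, hb]

lemma coord_injective {k : ℕ} {x₀ y : M} (hy : y ∈ lbase L x₀) {z w : LPow L k y}
    (h : coord k x₀ y z = coord k x₀ y w) : z = w := by
  rw [← coord_smul_tpow hy z, h, coord_smul_tpow hy]

lemma framePow_eq (k : ℕ) (x : M) : framePow k x = tpow k (frame (L := L) x x) := rfl

end Powers

/-! ### Smooth sections of `L` and their extension from a neighbourhood. -/

section Sections

variable {E : Type*} [NormedAddCommGroup E] [NormedSpace ℝ E] [FiniteDimensional ℝ E]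
  {M : Type*} [TopologicalSpace M] [ChartedSpace E M] [IsManifold 𝓘(ℝ, E) ∞ M]
  {L : M → Type*} [∀ x, AddCommGroup (L x)] [∀ x, Module ℂ (L x)]
  [∀ x, TopologicalSpace (L x)] [∀ x, IsTopologicalAddGroup (L x)] [∀ x, ContinuousSMul ℝ (L x)]
  [TopologicalSpace (TotalSpace ℂ L)] [FiberBundle ℂ L] [VectorBundle ℝ ℂ L] [VectorBundle ℂ ℂ L]
  [ContMDiffVectorBundle ∞ ℂ L 𝓘(ℝ, E)]

/-- Sections of `L` that are smooth at a point. -/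
def SmoothSecAt (s : Π x, L x) (x : M) : Prop :=
  ContMDiffAt 𝓘(ℝ, E) (𝓘(ℝ, E).prod 𝓘(ℝ, ℂ)) ∞ (fun x => TotalSpace.mk' ℂ x (s x)) x

/-- Sections of `L` that are differentiable at a point. -/
def DiffSecAt (s : Π x, L x) (x : M) : Prop :=
  MDifferentiableAt 𝓘(ℝ, E) (𝓘(ℝ, E).prod 𝓘(ℝ, ℂ)) (fun x => TotalSpace.mk' ℂ x (s x)) x

lemma SmoothSecAt.diffSecAt {s : Π x, L x} {x : M} (h : SmoothSecAt (E := E) s x) :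
    DiffSecAt (E := E) s x := ContMDiffAt.mdifferentiableAt h (by simp)

lemma lcoord_eventuallyEq {x₀ x : M} (hx : x ∈ lbase L x₀) (s : Π x, L x) :
    ∀ᶠ y in nhds x, (trivializationAt ℂ L x₀ ⟨y, s y⟩).2 = lcoord x₀ y (s y) := by
  filter_upwards [lbase_mem_nhds hx] with y hy
  rw [Trivialization.linearMapAt_apply, if_pos hy]

lemma smoothSecAt_iff {s : Π x, L x} {x₀ x : M} (hx : x ∈ lbase L x₀) :
    SmoothSecAt (E := E) s x
      ↔ ContMDiffAt 𝓘(ℝ, E) 𝓘(ℝ, ℂ) ∞ (fun y => lcoord x₀ y (s y)) x := by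
  unfold SmoothSecAt
  rw [(trivializationAt ℂ L x₀).contMDiffAt_section_iff hx]
  exact ⟨fun h => h.congr_of_eventuallyEq ((lcoord_eventuallyEq hx s).mono fun _ h => h.symm),
    fun h => h.congr_of_eventuallyEq (lcoord_eventuallyEq hx s)⟩

lemma diffSecAt_iff {s : Π x, L x} {x : M} :
    DiffSecAt (E := E) s x
      ↔ MDifferentiableAt 𝓘(ℝ, E) 𝓘(ℝ, ℂ) (fun y => lcoord x y (s y)) x := by
  unfold DiffSecAt
  rw [mdifferentiableAt_section]
  exact ⟨fun h => h.congr_of_eventuallyEq ((lcoord_eventuallyEq (mem_lbase x) s).mono fun _ h => h.symm),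
    fun h => h.congr_of_eventuallyEq (lcoord_eventuallyEq (mem_lbase x) s)⟩

lemma smoothSecAt_frame {x₀ x : M} (hx : x ∈ lbase L x₀) :
    SmoothSecAt (E := E) (frame (L := L) x₀) x := by
  rw [smoothSecAt_iff hx]
  refine (contMDiffAt_const (c := (1 : ℂ))).congr_of_eventuallyEq ?_
  filter_upwards [lbase_mem_nhds hx] with y hy
  exact lcoord_frame hy

/-- A section that is smooth near a point agrees near the point with a smooth section. -/
lemma exists_smoothSec_eventuallyEq [T2Space M] {s : Π x, L x} {x : M}
    (hs : ∀ᶠ y in nhds x, SmoothSecAt (E := E) s y) :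
    ∃ s' : Π x, L x, SmoothSec (E := E) s' ∧ ∀ᶠ y in nhds x, s' y = s y := by
  obtain ⟨u, hu, hou, hxu⟩ := eventually_nhds_iff.1 hs
  obtain ⟨f, -, hf⟩ := (SmoothBumpFunction.nhds_basis_tsupport (I := 𝓘(ℝ, E)) x).mem_iff.1
    (hou.mem_nhds hxu)
  refine ⟨(f : M → ℝ) • s, ?_, ?_⟩
  · exact ContMDiffOn.smul_section_of_tsupport (V := L) f.contMDiff.contMDiffOn hou hf
      fun y hy => (hu y hy).contMDiffWithinAt
  · filter_upwards [f.eventuallyEq_one] with y hy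
    simp [hy]

end Sections

end HitchinWitten

namespace HitchinWitten

open VectorField

/-! ### The connection induced on `L^k`. -/

section Nabla

variable {E : Type*} [NormedAddCommGroup E] [NormedSpace ℝ E] [FiniteDimensional ℝ E]
  {M : Type*} [TopologicalSpace M] [ChartedSpace E M] [IsManifold 𝓘(ℝ, E) ∞ M] [T2Space M]
  {L : M → Type*} [∀ x, AddCommGroup (L x)] [∀ x, Module ℂ (L x)]
  [∀ x, TopologicalSpace (L x)] [∀ x, IsTopologicalAddGroup (L x)] [∀ x, ContinuousSMul ℝ (L x)]
  [TopologicalSpace (TotalSpace ℂ L)] [FiberBundle ℂ L] [VectorBundle ℝ ℂ L] [VectorBundle ℂ ℂ L]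
  [ContMDiffVectorBundle ∞ ℂ L 𝓘(ℝ, E)] {Ω : BilinField E M} (B : Prequantum L Ω)

lemma contMDiffAt_mul_complex {EN HN N : Type*} [NormedAddCommGroup EN] [NormedSpace ℝ EN]
    [TopologicalSpace HN] {I : ModelWithCorners ℝ EN HN} [TopologicalSpace N] [ChartedSpace HN N]
    {f h : N → ℂ} {x : N} (hf : ContMDiffAt I 𝓘(ℝ, ℂ) ∞ f x) (hh : ContMDiffAt I 𝓘(ℝ, ℂ) ∞ h x) :
    ContMDiffAt I 𝓘(ℝ, ℂ) ∞ (fun y => f y * h y) x := by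
  have h1 : ContMDiffAt I 𝓘(ℝ, ℂ × ℂ) ∞ (fun y => (f y, h y)) x := hf.prodMk_space hh
  exact (contDiff_mul (𝕜 := ℝ) (𝔸 := ℂ)).contMDiff.contMDiffAt.comp x h1

lemma fderiv_mul_pow {h c : E → ℂ} {z : E} (k : ℕ) (hh : DifferentiableAt ℝ h z)
    (hc : DifferentiableAt ℝ c z) (u : E) :
    fderiv ℝ (fun y => h y * c y ^ k) z u
      = fderiv ℝ h z u * c z ^ k + h z * (k * c z ^ (k - 1) * fderiv ℝ c z u) := by
  have h1 := (hh.hasFDerivAt.mul (hc.hasFDerivAt.pow k)).fderiv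
  refine (DFunLike.congr_fun h1 u).trans ?_
  simp
  ring

lemma DiffSecAt.smul_complex {c : M → ℂ} {s : Π x, L x} {x : M}
    (hc : MDifferentiableAt 𝓘(ℝ, E) 𝓘(ℝ, ℂ) c x) (hs : DiffSecAt (E := E) s x) :
    DiffSecAt (E := E) (fun y => c y • s y) x := by
  rw [diffSecAt_iff] at hs ⊢
  simp only [map_smul, smul_eq_mul]
  exact hc.mul hs

lemma eventually_smoothSecAt_frame (x₀ : M) {x : M} (hx : x ∈ lbase L x₀) :
    ∀ᶠ y in nhds x, SmoothSecAt (E := E) (frame (L := L) x₀) y := by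
  filter_upwards [lbase_mem_nhds hx] with y hy
  exact smoothSecAt_frame hy

lemma conn_congr {s s' : Π x, L x} {x : M} (hs : DiffSecAt (E := E) s x)
    (hs' : DiffSecAt (E := E) s' x) (h : ∀ᶠ y in nhds x, s y = s' y) :
    B.conn s x = B.conn s' x :=
  B.conn.isCovariantDerivativeOnUniv.congr_of_eventuallyEq hs hs' Filter.univ_mem h

/-- Complex linearity is part of `Prequantum` for global smooth sections only. A cut-off and
locality of the connection bring it to sections defined near `x`, such as frames. -/
lemma conn_I_smul {s : Π x, L x} {x : M} (hs : ∀ᶠ y in nhds x, SmoothSecAt (E := E) s y)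
    (u : TangentSpace 𝓘(ℝ, E) x) :
    B.conn (fun y => Complex.I • s y) x u = Complex.I • B.conn s x u := by
  obtain ⟨s', hs', he⟩ := exists_smoothSec_eventuallyEq hs
  have d := hs.self_of_nhds.diffSecAt
  have d' : DiffSecAt (E := E) s' x := SmoothSecAt.diffSecAt (hs' x)
  have hI : MDifferentiableAt 𝓘(ℝ, E) 𝓘(ℝ, ℂ) (fun _ : M => Complex.I) x := mdifferentiableAt_const
  rw [conn_congr B (d.smul_complex hI) (d'.smul_complex hI) (he.mono fun y hy => by rw [hy]),
    B.conn_complex s' hs' x u, conn_congr B d' d he]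

/-- The Leibniz rule for complex functions. -/
lemma conn_smul {c : M → ℂ} {s : Π x, L x} {x : M}
    (hc : MDifferentiableAt 𝓘(ℝ, E) 𝓘(ℝ, ℂ) c x)
    (hs : ∀ᶠ y in nhds x, SmoothSecAt (E := E) s y) (u : TangentSpace 𝓘(ℝ, E) x) :
    B.conn (fun y => c y • s y) x u
      = mvfderiv 𝓘(ℝ, E) c x u • s x + c x • B.conn s x u := by
  have d := hs.self_of_nhds.diffSecAt
  have hI : MDifferentiableAt 𝓘(ℝ, E) 𝓘(ℝ, ℂ) (fun _ : M => Complex.I) x := mdifferentiableAt_const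
  have dI := d.smul_complex hI
  have hre := mdifferentiableAt_clm_comp Complex.reCLM hc
  have him := mdifferentiableAt_clm_comp Complex.imCLM hc
  have d1 : DiffSecAt (E := E) ((fun y => Complex.reCLM (c y)) • s) x :=
    MDifferentiableAt.smul_section hre d
  have d2 : DiffSecAt (E := E) ((fun y => Complex.imCLM (c y)) • fun y => Complex.I • s y) x :=
    MDifferentiableAt.smul_section him dI
  -- The covariant derivative obeys the Leibniz rule for real functions only, so `c` is split and
  -- `I` is absorbed into the section.
  have e : (fun y => c y • s y) = ((fun y => Complex.reCLM (c y)) • s)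
      + ((fun y => Complex.imCLM (c y)) • fun y => Complex.I • s y) := by
    ext y
    change c y • s y = ((c y).re : ℝ) • s y + ((c y).im : ℝ) • Complex.I • s y
    rw [← Complex.coe_smul, ← Complex.coe_smul, smul_smul, ← add_smul, Complex.re_add_im]
  have h1 := B.conn.isCovariantDerivativeOnUniv.add d1 d2 trivial
  have h2 := B.conn.isCovariantDerivativeOnUniv.leibniz d hre trivial
  have h3 := B.conn.isCovariantDerivativeOnUniv.leibniz dI him trivial
  have h4 := mvfderiv_clm_comp Complex.reCLM hc u
  have h5 := mvfderiv_clm_comp Complex.imCLM hc u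
  have h6 : B.conn (fun y => c y • s y) x u = B.conn ((fun y => Complex.reCLM (c y)) • s) x u
      + B.conn ((fun y => Complex.imCLM (c y)) • fun y => Complex.I • s y) x u := by
    rw [e, h1]; rfl
  have h7 : B.conn ((fun y => Complex.reCLM (c y)) • s) x u
      = (c x).re • B.conn s x u + (mvfderiv 𝓘(ℝ, E) c x u).re • s x := by
    rw [h2]
    exact congrArg (fun r : ℝ => (c x).re • B.conn s x u + r • s x) h4
  have h8 : B.conn ((fun y => Complex.imCLM (c y)) • fun y => Complex.I • s y) x u
      = (c x).im • B.conn (fun y => Complex.I • s y) x u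
        + (mvfderiv 𝓘(ℝ, E) c x u).im • Complex.I • s x := by
    rw [h3]
    exact congrArg (fun r : ℝ => (c x).im • B.conn (fun y => Complex.I • s y) x u
      + r • Complex.I • s x) h5
  rw [h6, h7, h8, conn_I_smul B hs]
  conv_rhs => rw [← Complex.re_add_im (mvfderiv 𝓘(ℝ, E) c x u), ← Complex.re_add_im (c x)]
  simp only [← Complex.coe_smul, add_smul, mul_smul]
  abel

/-- Differentiating the coordinates of `c • s`. -/
lemma mvfderiv_mul_pow {h c : M → ℂ} {x : M} (k : ℕ)
    (hh : MDifferentiableAt 𝓘(ℝ, E) 𝓘(ℝ, ℂ) h x) (hc : MDifferentiableAt 𝓘(ℝ, E) 𝓘(ℝ, ℂ) c x)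
    (u : TangentSpace 𝓘(ℝ, E) x) :
    mvfderiv 𝓘(ℝ, E) (fun y => h y * c y ^ k) x u
      = mvfderiv 𝓘(ℝ, E) h x u * c x ^ k
        + h x * (k * c x ^ (k - 1) * mvfderiv 𝓘(ℝ, E) c x u) := by
  have d : MDifferentiableAt 𝓘(ℝ, E) 𝓘(ℝ, ℂ) (fun y => h y * c y ^ k) x := hh.mul (hc.pow k)
  rw [mvfderiv_eq_fderiv d u, mvfderiv_eq_fderiv hh u, mvfderiv_eq_fderiv hc u]
  refine (fderiv_mul_pow k (differentiableAt_chart hh) (differentiableAt_chart hc) u).trans ?_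
  simp only [Function.comp, extChartAt_to_inv]

/-- The induced connection in terms of a local section `s` with `∇_u s = θ s`. -/
theorem nabla_of_local {k : ℕ} {s : Π x, L x} {h : M → ℂ} {ψ : Sec L k} {x : M}
    (hs : ∀ᶠ y in nhds x, SmoothSecAt (E := E) s y)
    (hh : MDifferentiableAt 𝓘(ℝ, E) 𝓘(ℝ, ℂ) h x)
    (hψ : ∀ᶠ y in nhds x, ψ y = h y • tpow k (s y)) {u : TangentSpace 𝓘(ℝ, E) x} {θ : ℂ}
    (hθ : B.conn s x u = θ • s x) :
    nabla B.conn ψ x u = (mvfderiv 𝓘(ℝ, E) h x u + k * θ * h x) • tpow k (s x) := by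
  let c : M → ℂ := fun y => lcoord x y (s y)
  have hc : MDifferentiableAt 𝓘(ℝ, E) 𝓘(ℝ, ℂ) c x := diffSecAt_iff.1 hs.self_of_nhds.diffSecAt
  have hb := lbase_mem_nhds (mem_lbase (L := L) x)
  have he : ∀ᶠ y in nhds x, s y = c y • frame x y := by
    filter_upwards [hb] with y hy
    exact (lcoord_smul_frame hy _).symm
  have hfr := eventually_smoothSecAt_frame (E := E) (L := L) x (mem_lbase x)
  have h1 : B.conn s x u = mvfderiv 𝓘(ℝ, E) c x u • frame x x + c x • B.conn (frame x) x u := by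
    rw [conn_congr B hs.self_of_nhds.diffSecAt (hfr.self_of_nhds.diffSecAt.smul_complex hc) he,
      conn_smul B hc hfr]
  -- The gauge transformation law of the connection form, kept free of division because `s` may
  -- vanish at `x`.
  have h2 : θ * c x = mvfderiv 𝓘(ℝ, E) c x u + c x * lcoord x x (B.conn (frame x) x u) := by
    have := congrArg (lcoord x x) (hθ.symm.trans h1)
    simpa only [map_add, map_smul, smul_eq_mul, lcoord_frame (mem_lbase (L := L) x), mul_one]
      using this
  have h3 : ∀ᶠ y in nhds x, coord k x y (ψ y) = h y * c y ^ k := by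
    filter_upwards [hψ] with y hy
    rw [hy, map_smul, coord_tpow, smul_eq_mul]
  have h4 : mvfderiv 𝓘(ℝ, E) (fun y => coord k x y (ψ y)) x u
      = mvfderiv 𝓘(ℝ, E) h x u * c x ^ k
        + h x * (k * c x ^ (k - 1) * mvfderiv 𝓘(ℝ, E) c x u) :=
    (mvfderiv_congr h3 u).trans (mvfderiv_mul_pow k hh hc u)
  rw [nabla, h4, h3.self_of_nhds, he.self_of_nhds, tpow_smul, smul_smul, framePow_eq]
  congr 1
  -- The exponent `k - 1` is truncated at `k = 0`, where the factor `k` makes both sides zero.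
  have h5 : (k : ℂ) * c x ^ (k - 1) * c x = k * c x ^ k := by
    rcases k with _ | k
    · simp
    · rw [Nat.add_sub_cancel, pow_succ]; ring
  change _ + _ * lcoord x x (B.conn (frame x) x u) * _ = _
  linear_combination (h x * (k : ℂ) * c x ^ (k - 1)) * (-h2)
    + (h x * θ - h x * lcoord x x (B.conn (frame x) x u)) * h5

variable (L) in
/-- The connection form in the preferred trivialisation at `x₀`. -/
def connForm (x₀ : M) {y : M} (u : TangentSpace 𝓘(ℝ, E) y) : ℂ :=
  lcoord (L := L) x₀ y (B.conn (frame x₀) y u)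

/-- The induced connection in an arbitrary preferred trivialisation. -/
theorem coord_nabla {k : ℕ} {x₀ y : M} (hy : y ∈ lbase L x₀) {ψ : Sec L k}
    (hψ : MDifferentiableAt 𝓘(ℝ, E) 𝓘(ℝ, ℂ) (fun z => coord k x₀ z (ψ z)) y)
    (u : TangentSpace 𝓘(ℝ, E) y) :
    coord k x₀ y (nabla B.conn ψ y u) = mvfderiv 𝓘(ℝ, E) (fun z => coord k x₀ z (ψ z)) y u
      + k * connForm L B x₀ u * coord k x₀ y (ψ y) := by
  have h := nabla_of_local B (s := frame x₀) (h := fun z => coord k x₀ z (ψ z)) (ψ := ψ) (u := u)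
    (θ := connForm L B x₀ u) (eventually_smoothSecAt_frame x₀ hy) hψ
    (by filter_upwards [lbase_mem_nhds hy] with z hz using (coord_smul_tpow hz _).symm)
    (lcoord_smul_frame hy _).symm
  rw [h, map_smul, coord_tpow, lcoord_frame hy, one_pow, smul_eq_mul, mul_one]

/-- Smoothness of the connection speaks of global smooth sections, so the frame is replaced by a
smooth section that agrees with it near `x`. -/
lemma contMDiffAt_connForm {x₀ x : M} (hx : x ∈ lbase L x₀) {X : VecField E M}
    (hX : SmoothVecAt X x) :
    ContMDiffAt 𝓘(ℝ, E) 𝓘(ℝ, ℂ) ∞ (fun y => connForm L B x₀ (X y)) x := by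
  obtain ⟨s, hs, he⟩ := exists_smoothSec_eventuallyEq
    (eventually_smoothSecAt_frame (E := E) (L := L) x₀ hx)
  have h1 := (B.conn_smooth.contMDiff.contMDiff (σ := s) (by
    rw [contMDiffOn_univ]
    exact hs)).contMDiffAt (Filter.univ_mem (f := nhds x))
  have h2 : SmoothSecAt (E := E) (fun y => B.conn s y (X y)) x :=
    ContMDiffAt.clm_bundle_apply h1 hX
  rw [smoothSecAt_iff hx] at h2
  refine h2.congr_of_eventuallyEq ?_
  filter_upwards [he.eventually_nhds, eventually_smoothSecAt_frame (E := E) (L := L) x₀ hx]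
    with y hy hy2
  have hd : DiffSecAt (E := E) s y := SmoothSecAt.diffSecAt (hs y)
  rw [connForm, conn_congr B hy2.diffSecAt hd (hy.mono fun _ h => h.symm)]

end Nabla

end HitchinWitten

namespace HitchinWitten

open VectorField

/-! ### Calculus of sections of `L^k`. -/

section PowSections

variable {E : Type*} [NormedAddCommGroup E] [NormedSpace ℝ E] [FiniteDimensional ℝ E]
  {M : Type*} [TopologicalSpace M] [ChartedSpace E M] [IsManifold 𝓘(ℝ, E) ∞ M] [T2Space M]
  {L : M → Type*} [∀ x, AddCommGroup (L x)] [∀ x, Module ℂ (L x)]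
  [∀ x, TopologicalSpace (L x)] [∀ x, IsTopologicalAddGroup (L x)] [∀ x, ContinuousSMul ℝ (L x)]
  [TopologicalSpace (TotalSpace ℂ L)] [FiberBundle ℂ L] [VectorBundle ℝ ℂ L] [VectorBundle ℂ ℂ L]
  [ContMDiffVectorBundle ∞ ℂ L 𝓘(ℝ, E)] {Ω g : BilinField E M} (B : Prequantum L Ω) {k : ℕ}

/-- Sections of `L^k` that are smooth at a point. -/
def SmoothPowAt (ψ : Sec L k) (x : M) : Prop :=
  ContMDiffAt 𝓘(ℝ, E) 𝓘(ℝ, ℂ) ∞ (fun y => coord k x y (ψ y)) x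

/-- Sections of `L^k` that are differentiable at a point. -/
def DiffPowAt (ψ : Sec L k) (x : M) : Prop :=
  MDifferentiableAt 𝓘(ℝ, E) 𝓘(ℝ, ℂ) (fun y => coord k x y (ψ y)) x

lemma SmoothPowAt.diffPowAt {ψ : Sec L k} {x : M} (h : SmoothPowAt (E := E) ψ x) :
    DiffPowAt (E := E) ψ x := ContMDiffAt.mdifferentiableAt h (by simp)

lemma eventually_mdifferentiableAt {EN : Type*} [NormedAddCommGroup EN] [NormedSpace ℝ EN]
    {N : Type*} [TopologicalSpace N] [ChartedSpace EN N] [IsManifold 𝓘(ℝ, EN) ∞ N]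
    {G : Type*} [NormedAddCommGroup G] [NormedSpace ℝ G] {f : N → G} {x : N}
    (h : ContMDiffAt 𝓘(ℝ, EN) 𝓘(ℝ, G) ∞ f x) :
    ∀ᶠ y in nhds x, MDifferentiableAt 𝓘(ℝ, EN) 𝓘(ℝ, G) f y := by
  have : IsManifold 𝓘(ℝ, EN) 1 N := IsManifold.of_le (n := (∞ : ℕ∞ω)) (by norm_cast)
  exact ((contMDiffAt_iff_contMDiffAt_nhds (n := 1) (by simp)).1
    (ContMDiffAt.of_le (m := 1) (n := (∞ : ℕ∞ω)) h (by norm_cast))).mono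
    fun y hy => hy.mdifferentiableAt (by simp)

lemma SmoothPowAt.congr {ψ φ : Sec L k} {x : M} (h : SmoothPowAt (E := E) ψ x)
    (e : ∀ᶠ y in nhds x, φ y = ψ y) : SmoothPowAt (E := E) φ x :=
  ContMDiffAt.congr_of_eventuallyEq h (e.mono fun y hy => by simp only [hy])

lemma SmoothPowAt.add {ψ φ : Sec L k} {x : M} (h : SmoothPowAt (E := E) ψ x)
    (h' : SmoothPowAt (E := E) φ x) : SmoothPowAt (E := E) (ψ + φ) x := by
  unfold SmoothPowAt
  simp only [Pi.add_apply, map_add]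
  exact ContMDiffAt.add h h'

lemma SmoothPowAt.mulOp {ψ : Sec L k} {f : M → ℂ} {x : M} (h : SmoothPowAt (E := E) ψ x)
    (hf : ContMDiffAt 𝓘(ℝ, E) 𝓘(ℝ, ℂ) ∞ f x) : SmoothPowAt (E := E) (mulOp f ψ) x := by
  unfold SmoothPowAt
  simp only [HitchinWitten.mulOp, map_smul, smul_eq_mul]
  exact contMDiffAt_mul_complex hf h

lemma SmoothPowAt.smul {ψ : Sec L k} {x : M} (h : SmoothPowAt (E := E) ψ x) (c : ℂ) :
    SmoothPowAt (E := E) (c • ψ) x := h.mulOp (f := fun _ => c) contMDiffAt_const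

lemma SmoothPowAt.sum {ι : Type*} (s : Finset ι) {ψ : ι → Sec L k} {x : M}
    (h : ∀ i ∈ s, SmoothPowAt (E := E) (ψ i) x) :
    SmoothPowAt (E := E) (fun y => ∑ i ∈ s, ψ i y) x := by
  unfold SmoothPowAt
  simp only [map_sum]
  exact ContMDiffAt.sum h

lemma DiffPowAt.add {ψ φ : Sec L k} {x : M} (h : DiffPowAt (E := E) ψ x)
    (h' : DiffPowAt (E := E) φ x) : DiffPowAt (E := E) (ψ + φ) x := by
  unfold DiffPowAt
  simp only [Pi.add_apply, map_add]
  exact MDifferentiableAt.add h h'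

lemma DiffPowAt.mulOp {ψ : Sec L k} {f : M → ℂ} {x : M} (h : DiffPowAt (E := E) ψ x)
    (hf : MDifferentiableAt 𝓘(ℝ, E) 𝓘(ℝ, ℂ) f x) : DiffPowAt (E := E) (mulOp f ψ) x := by
  unfold DiffPowAt
  simp only [HitchinWitten.mulOp, map_smul, smul_eq_mul]
  exact MDifferentiableAt.mul hf h

lemma mvfderiv_mul_complex {f h : M → ℂ} {x : M} (hf : MDifferentiableAt 𝓘(ℝ, E) 𝓘(ℝ, ℂ) f x)
    (hh : MDifferentiableAt 𝓘(ℝ, E) 𝓘(ℝ, ℂ) h x) (u : TangentSpace 𝓘(ℝ, E) x) :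
    mvfderiv 𝓘(ℝ, E) (fun y => f y * h y) x u
      = mvfderiv 𝓘(ℝ, E) f x u * h x + f x * mvfderiv 𝓘(ℝ, E) h x u := by
  have := mvfderiv_mul_pow 1 hf hh u
  simpa using this

lemma mvfderiv_add_apply {f h : M → ℂ} {x : M} (hf : MDifferentiableAt 𝓘(ℝ, E) 𝓘(ℝ, ℂ) f x)
    (hh : MDifferentiableAt 𝓘(ℝ, E) 𝓘(ℝ, ℂ) h x) (u : TangentSpace 𝓘(ℝ, E) x) :
    mvfderiv 𝓘(ℝ, E) (fun y => f y + h y) x u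
      = mvfderiv 𝓘(ℝ, E) f x u + mvfderiv 𝓘(ℝ, E) h x u :=
  DFunLike.congr_fun (mvfderiv_add hf hh) u

lemma nabla_add {ψ φ : Sec L k} {x : M} (h : DiffPowAt (E := E) ψ x)
    (h' : DiffPowAt (E := E) φ x) (u : TangentSpace 𝓘(ℝ, E) x) :
    nabla B.conn (ψ + φ) x u = nabla B.conn ψ x u + nabla B.conn φ x u := by
  have h1 := mvfderiv_add_apply h h' u
  simp only [nabla, Pi.add_apply, map_add, ← add_smul]
  rw [h1]
  congr 1
  ring

lemma nabla_mulOp {ψ : Sec L k} {f : M → ℂ} {x : M} (h : DiffPowAt (E := E) ψ x)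
    (hf : MDifferentiableAt 𝓘(ℝ, E) 𝓘(ℝ, ℂ) f x) (u : TangentSpace 𝓘(ℝ, E) x) :
    nabla B.conn (mulOp f ψ) x u = f x • nabla B.conn ψ x u + mvfderiv 𝓘(ℝ, E) f x u • ψ x := by
  have h1 := mvfderiv_mul_complex hf h u
  conv_rhs => rw [← coord_smul_tpow (mem_lbase x) (ψ x)]
  simp only [nabla, mulOp, map_smul, smul_eq_mul, smul_smul, framePow_eq, ← add_smul]
  rw [h1]
  congr 1
  ring

lemma nabla_smul {ψ : Sec L k} {x : M} (c : ℂ) (h : DiffPowAt (E := E) ψ x)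
    (u : TangentSpace 𝓘(ℝ, E) x) :
    nabla B.conn (c • ψ) x u = c • nabla B.conn ψ x u := by
  have h1 := nabla_mulOp B (f := fun _ => c) h mdifferentiableAt_const u
  rw [mvfderiv_const] at h1
  refine Eq.trans ?_ (h1.trans (by simp))
  rfl

lemma nabla_congr {ψ φ : Sec L k} {x : M} (e : ∀ᶠ y in nhds x, ψ y = φ y)
    (u : TangentSpace 𝓘(ℝ, E) x) : nabla B.conn ψ x u = nabla B.conn φ x u := by
  have h1 : ∀ᶠ y in nhds x, coord k x y (ψ y) = coord k x y (φ y) := e.mono fun y hy => by rw [hy]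
  rw [nabla, nabla, mvfderiv_congr h1 u, e.self_of_nhds]

lemma nabla_add_vec (ψ : Sec L k) (x : M) (u v : TangentSpace 𝓘(ℝ, E) x) :
    nabla B.conn ψ x (u + v) = nabla B.conn ψ x u + nabla B.conn ψ x v := by
  simp only [nabla, map_add, ← add_smul]
  congr 1
  ring

lemma nabla_smul_vec (ψ : Sec L k) (x : M) (c : ℝ) (u : TangentSpace 𝓘(ℝ, E) x) :
    nabla B.conn ψ x (c • u) = (c : ℂ) • nabla B.conn ψ x u := by
  have h1 : lcoord (L := L) x x (B.conn (frame x) x (c • u))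
      = c * lcoord (L := L) x x (B.conn (frame x) x u) := by
    rw [map_smul, ← Complex.coe_smul, map_smul, smul_eq_mul]
  simp only [nabla, smul_smul]
  rw [h1, map_smul, Complex.real_smul]
  congr 1
  ring

variable (L k) in
/-- The covariant derivative at a point, in the preferred trivialisation. -/
def nablaCoord (ψ : Sec L k) (x : M) : TangentSpace 𝓘(ℝ, E) x →ₗ[ℝ] ℂ where
  toFun u := coord k x x (nabla B.conn ψ x u)
  map_add' u v := by rw [nabla_add_vec, map_add]
  map_smul' c u := by rw [nabla_smul_vec, map_smul]; simp

lemma nabla_neg_vec (ψ : Sec L k) (x : M) (u : TangentSpace 𝓘(ℝ, E) x) :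
    nabla B.conn ψ x (-u) = -nabla B.conn ψ x u := by
  have := nabla_smul_vec B ψ x (-1) u
  simpa using this

lemma nabla_sum_vec {ι : Type*} (s : Finset ι) (ψ : Sec L k) (x : M)
    (u : ι → TangentSpace 𝓘(ℝ, E) x) :
    nabla B.conn ψ x (∑ i ∈ s, u i) = ∑ i ∈ s, nabla B.conn ψ x (u i) := by
  apply coord_injective (mem_lbase x)
  rw [map_sum]
  exact map_sum (nablaCoord L B k ψ x) u s

/-- The definition of `nabla` uses a trivialisation that moves with the point. By `coord_nabla` the
one at `x` serves at all nearby points, and there the formula is visibly smooth. -/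
lemma smoothPowAt_nabla {ψ : Sec L k} {X : VecField E M} {x : M} (hψ : SmoothPowAt (E := E) ψ x)
    (hX : SmoothVecAt X x) : SmoothPowAt (E := E) (fun y => nabla B.conn ψ y (X y)) x := by
  have h1 : ContMDiffAt 𝓘(ℝ, E) 𝓘(ℝ, ℂ) ∞ (fun y => mvfderiv 𝓘(ℝ, E)
      (fun z => coord k x z (ψ z)) y (X y) + k * connForm L B x (X y) * coord k x y (ψ y)) x := by
    refine ContMDiffAt.add (contMDiffAt_mvfderiv hX hψ) (contMDiffAt_mul_complex ?_ hψ)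
    exact contMDiffAt_mul_complex contMDiffAt_const (contMDiffAt_connForm B (mem_lbase x) hX)
  refine h1.congr_of_eventuallyEq ?_
  filter_upwards [lbase_mem_nhds (mem_lbase (L := L) x), eventually_mdifferentiableAt hψ] with y h1 h2
  exact coord_nabla B h1 h2 (X y)

end PowSections

end HitchinWitten

namespace HitchinWitten

open VectorField

/-! ### Dual frames and the divergence of a bivector. -/

section DualFrame

variable {E : Type*} [NormedAddCommGroup E] [NormedSpace ℝ E] [FiniteDimensional ℝ E]
  {M : Type*} [TopologicalSpace M] [ChartedSpace E M] [IsManifold 𝓘(ℝ, E) ∞ M]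
  {g : BilinField E M} {T : Bivector E M}

/-- A local frame of the tangent bundle near `x`, with its dual coframe. -/
structure IsDualFrame (s : Fin (Module.finrank ℝ E) → VecField E M)
    (θ : Fin (Module.finrank ℝ E) → OneForm E M) (x : M) : Prop where
  smooth : ∀ i, SmoothVecAt (s i) x
  smooth_form : ∀ i, SmoothFormAt (E := E) (θ i) x
  complete : ∀ᶠ y in nhds x, ∀ v : TangentSpace 𝓘(ℝ, E) y, ∑ i, θ i y v • s i y = v
  dual : ∀ᶠ y in nhds x, ∀ i j, θ i y (s j y) = if i = j then 1 else 0

/-- The coframe dual to `vecFrame`. -/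
def vecCoframe (x₀ : M) (i : Fin (Module.finrank ℝ E)) : OneForm E M := fun y =>
  (LinearMap.toContinuousLinearMap ((Module.finBasis ℝ E).coord i)).comp
    ((trivializationAt E (fun x : M => TangentSpace 𝓘(ℝ, E) x) x₀).continuousLinearMapAt ℝ y
      : E →L[ℝ] E)

lemma vecComp_eq_vecCoframe {x₀ y : M}
    (hy : y ∈ (trivializationAt E (fun x : M => TangentSpace 𝓘(ℝ, E) x) x₀).baseSet)
    (X : VecField E M) (i : Fin (Module.finrank ℝ E)) :
    vecComp x₀ X i y = vecCoframe x₀ i y (X y) := by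
  change _ = (Module.finBasis ℝ E).coord i
    ((trivializationAt E (fun x : M => TangentSpace 𝓘(ℝ, E) x) x₀).continuousLinearMapAt ℝ y (X y))
  rw [(trivializationAt E (fun x : M => TangentSpace 𝓘(ℝ, E) x) x₀).continuousLinearMapAt_apply
    (R := ℝ), Trivialization.linearMapAt_apply, if_pos hy]
  rfl

lemma vecComp_vecFrame {x₀ y : M}
    (hy : y ∈ (trivializationAt E (fun x : M => TangentSpace 𝓘(ℝ, E) x) x₀).baseSet)
    (i j : Fin (Module.finrank ℝ E)) :
    vecComp x₀ (vecFrame x₀ j) i y = if i = j then 1 else 0 := by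
  have h1 : vecCoord x₀ (vecFrame x₀ j) y = Module.finBasis ℝ E j := by
    set t := trivializationAt E (fun x : M => TangentSpace 𝓘(ℝ, E) x) x₀
    change (t ⟨y, t.symmL ℝ y (Module.finBasis ℝ E j)⟩).2 = _
    rw [t.symmL_apply hy, t.apply_mk_symm hy]
  rw [vecComp, h1]
  simp [Finsupp.single_apply, eq_comm]

lemma vecComp_smoothAt {x₀ y : M}
    (hy : y ∈ (trivializationAt E (fun x : M => TangentSpace 𝓘(ℝ, E) x) x₀).baseSet)
    {X : VecField E M} (hX : SmoothVecAt X y) (i) :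
    ContMDiffAt 𝓘(ℝ, E) 𝓘(ℝ, ℝ) ∞ (vecComp x₀ X i) y := by
  have h1 := ((trivializationAt E (fun x : M => TangentSpace 𝓘(ℝ, E) x)
    x₀).contMDiffAt_section_iff hy).1 hX
  exact ((LinearMap.toContinuousLinearMap
    ((Module.finBasis ℝ E).coord i)).contMDiff.contMDiffAt).comp y h1

lemma isDualFrame_vecFrame {x₀ x : M}
    (hx : x ∈ (trivializationAt E (fun x : M => TangentSpace 𝓘(ℝ, E) x) x₀).baseSet) :
    IsDualFrame (E := E) (vecFrame x₀) (vecCoframe x₀) x where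
  smooth := smoothVecAt_vecFrame hx
  smooth_form i Z hZ := by
    refine (vecComp_smoothAt hx hZ i).congr_of_eventuallyEq ?_
    filter_upwards [(trivializationAt E (fun x : M => TangentSpace 𝓘(ℝ, E) x)
      x₀).open_baseSet.mem_nhds hx] with y hy
    exact (vecComp_eq_vecCoframe hy Z i).symm
  complete := by
    filter_upwards [(trivializationAt E (fun x : M => TangentSpace 𝓘(ℝ, E) x)
      x₀).open_baseSet.mem_nhds hx] with y hy v
    have h1 := sum_vecComp x₀ (extendVec v) hy
    rw [extendVec_self] at h1
    conv_rhs => rw [h1]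
    refine Finset.sum_congr rfl fun i _ => ?_
    rw [vecComp_eq_vecCoframe hy, extendVec_self]
  dual := by
    filter_upwards [(trivializationAt E (fun x : M => TangentSpace 𝓘(ℝ, E) x)
      x₀).open_baseSet.mem_nhds hx] with y hy i j
    rw [← vecComp_eq_vecCoframe hy, vecComp_vecFrame hy]

/-- The contraction of a bilinear map does not depend on the choice of dual bases. -/
lemma contraction_eq {W : Type*} [AddCommGroup W] [Module ℝ W] {x : M}
    (β : TangentSpace 𝓘(ℝ, E) x → (TangentSpace 𝓘(ℝ, E) x →L[ℝ] ℝ) → W)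
    (hadd : ∀ u u' α, β (u + u') α = β u α + β u' α)
    (hsmul : ∀ (c : ℝ) u α, β (c • u) α = c • β u α)
    (hadd' : ∀ u α α', β u (α + α') = β u α + β u α')
    (hsmul' : ∀ (c : ℝ) u α, β u (c • α) = c • β u α)
    {ι : Type*} [Fintype ι] {s : ι → TangentSpace 𝓘(ℝ, E) x}
    {θ : ι → TangentSpace 𝓘(ℝ, E) x →L[ℝ] ℝ} (h : ∀ v, ∑ i, θ i v • s i = v) :
    ∑ i, β (tbasis x i) (tcobasis x i) = ∑ i, β (s i) (θ i) := by
  let b : TangentSpace 𝓘(ℝ, E) x →ₗ[ℝ] (TangentSpace 𝓘(ℝ, E) x →L[ℝ] ℝ) →ₗ[ℝ] W :=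
    LinearMap.mk₂ ℝ β hadd hsmul hadd' hsmul'
  have h1 : ∀ φ : TangentSpace 𝓘(ℝ, E) x →L[ℝ] ℝ, φ = ∑ j, φ (s j) • θ j := by
    intro φ
    ext v
    conv_lhs => rw [← h v, map_sum]
    rw [_root_.sum_apply]
    refine Finset.sum_congr rfl fun j _ => ?_
    rw [map_smul, _root_.smul_apply, smul_eq_mul, smul_eq_mul, mul_comm]
  calc ∑ i, b (tbasis x i) (tcobasis x i)
      = ∑ i, ∑ j, tcobasis x i (s j) • b (tbasis x i) (θ j) := by
        refine Finset.sum_congr rfl fun i _ => ?_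
        conv_lhs => rw [h1 (tcobasis x i), map_sum]
        simp only [map_smul]
    _ = ∑ j, b (∑ i, tcobasis x i (s j) • tbasis x i) (θ j) := by
        rw [Finset.sum_comm]
        refine Finset.sum_congr rfl fun j _ => ?_
        rw [map_sum, LinearMap.sum_apply]
        simp only [map_smul, LinearMap.smul_apply]
    _ = ∑ j, b (s j) (θ j) := by
        simp only [sum_tcobasis_smul]

lemma divg_eq_contraction (X : VecField E M) {x : M} {ι : Type*} [Fintype ι]
    {s : ι → TangentSpace 𝓘(ℝ, E) x}
    {θ : ι → TangentSpace 𝓘(ℝ, E) x →L[ℝ] ℝ} (h : ∀ v, ∑ i, θ i v • s i = v) :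
    divg g X x = ∑ i, θ i (leviCivita g X x (s i)) :=
  contraction_eq (fun u α => α (leviCivita g X x u))
    (fun u u' α => by rw [map_add, map_add]) (fun c u α => by rw [map_smul, map_smul])
    (fun u α α' => rfl) (fun c u α => rfl) h

lemma smoothFormAt_bilin (hg : IsNondegForm g) {A : VecField E M} {x : M} (hA : SmoothVecAt A x) :
    SmoothFormAt (E := E) (fun y => g y (A y)) x := fun _ hZ => hg.smooth hA hZ

/-- By symmetry of `T` the function `g(Z, T g(A, ·))` equals `g(A, T g(Z, ·))`. Differentiating both
with metric compatibility moves every derivative of `A` over to `Z`. -/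
lemma leviCivita_bivector_pairing (hg : IsMetric g) (hT : SmoothBivector T) (hs : SymmBivector T)
    {A Z : VecField E M} {x : M} (hA : SmoothVecAt A x) (hZ : SmoothVecAt Z x)
    (u : TangentSpace 𝓘(ℝ, E) x) :
    g x (Z x) (leviCivita g (fun y => T y (g y (A y))) x u - T x (g x (leviCivita g A x u)))
      = g x (A x) (leviCivita g (fun y => T y (g y (Z y))) x u)
        - g x (leviCivita g Z x u) (T x (g x (A x))) := by
  have hD := isLeviCivita_leviCivita hg
  have hTA := (hT _ x (smoothFormAt_bilin hg.toIsNondegForm hA)).diffVecAt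
  have hTZ := (hT _ x (smoothFormAt_bilin hg.toIsNondegForm hZ)).diffVecAt
  have h1 := hD.metric Z _ x hZ.diffVecAt hTA u
  have h2 := hD.metric A _ x hA.diffVecAt hTZ u
  have h3 : (fun y => g y (Z y) (T y (g y (A y)))) = fun y => g y (A y) (T y (g y (Z y))) :=
    funext fun y => hs y _ _
  have h4 : g x (Z x) (T x (g x (leviCivita g A x u)))
      = g x (leviCivita g A x u) (T x (g x (Z x))) := hs x _ _
  rw [map_sub, h4]
  rw [h3] at h1
  have h5 := h1.symm.trans h2
  linarith

/-- The right side contains `α` itself and no extension of it. Hence `nablaBivector` is linear in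
`α`, and every smooth extension gives the same value. -/
lemma nablaBivector_pairing (hg : IsMetric g) (hT : SmoothBivector T) (hs : SymmBivector T)
    {Z : VecField E M} {x : M} (hZ : SmoothVecAt Z x) (u : TangentSpace 𝓘(ℝ, E) x)
    (α : TangentSpace 𝓘(ℝ, E) x →L[ℝ] ℝ) :
    g x (Z x) (nablaBivector g T x u α)
      = α (leviCivita g (fun y => T y (g y (Z y))) x u) - g x (leviCivita g Z x u) (T x α) := by
  have h := leviCivita_bivector_pairing hg hT hs (smoothVecAt_extendVec (invMetric g x α)) hZ u
  rw [extendVec_self, apply_invMetric g (hg.injective x)] at h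
  exact h

lemma IsMetric.ext_smooth (hg : IsMetric g) {x : M} {u v : TangentSpace 𝓘(ℝ, E) x}
    (h : ∀ Z : VecField E M, SmoothVecAt Z x → g x (Z x) u = g x (Z x) v) : u = v := by
  have h1 : ∀ w, g x (u - v) w = 0 := fun w => by
    have := h (extendVec w) (smoothVecAt_extendVec w)
    rw [extendVec_self] at this
    rw [hg.symm, map_sub, this, sub_self]
  exact sub_eq_zero.1 (hg.nondegenerate x _ h1)

/-- In the definition of `∇T`, any smooth extension of a covector may be used. -/
lemma nablaBivector_eq (hg : IsMetric g) (hT : SmoothBivector T) (hs : SymmBivector T)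
    {A : VecField E M} {x : M} (hA : SmoothVecAt A x) (u : TangentSpace 𝓘(ℝ, E) x) :
    nablaBivector g T x u (g x (A x))
      = leviCivita g (fun y => T y (g y (A y))) x u - T x (g x (leviCivita g A x u)) :=
  hg.ext_smooth fun Z hZ => by
    rw [nablaBivector_pairing hg hT hs hZ, leviCivita_bivector_pairing hg hT hs hA hZ]

/-- The divergence of a contravariant tensor in a local frame. -/
lemma divBivector_eq (hg : IsMetric g) (hT : SmoothBivector T) (hs : SymmBivector T)
    {s : Fin (Module.finrank ℝ E) → VecField E M} {θ : Fin (Module.finrank ℝ E) → OneForm E M}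
    {x : M} (h : IsDualFrame s θ x) :
    divBivector g T x = ∑ i, (leviCivita g (fun y => T y (θ i y)) x (s i x)
      + divg g (s i) x • T x (θ i x)) := by
  have hD := isLeviCivita_leviCivita hg
  have h1 : divBivector g T x = ∑ i, nablaBivector g T x (s i x) (θ i x) := by
    refine contraction_eq (nablaBivector g T x) (fun u u' α => ?_) (fun c u α => ?_)
      (fun u α α' => hg.ext_smooth fun Z hZ => ?_)
      (fun c u α => hg.ext_smooth fun Z hZ => ?_) h.complete.self_of_nhds
    · simp only [nablaBivector, map_add]
      abel
    · simp only [nablaBivector, map_smul, smul_sub]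
    · simp only [map_add, nablaBivector_pairing hg hT hs hZ, _root_.add_apply]
      ring
    · simp only [map_smul, nablaBivector_pairing hg hT hs hZ, _root_.smul_apply, smul_eq_mul]
      ring
  let A : Fin (Module.finrank ℝ E) → VecField E M := fun i y => invMetric g y (θ i y)
  have hA : ∀ i, SmoothVecAt (A i) x := fun i =>
    hg.toIsNondegForm.smoothVecAt_invMetric (h.smooth_form i)
  have hgA : ∀ i y, g y (A i y) = θ i y := fun i y => apply_invMetric g (hg.injective y) _
  have h2 : ∀ i, nablaBivector g T x (s i x) (θ i x)
      = leviCivita g (fun y => T y (θ i y)) x (s i x)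
        - T x (g x (leviCivita g (A i) x (s i x))) := fun i => by
    have := nablaBivector_eq hg hT hs (hA i) (s i x)
    simp only [hgA] at this
    exact this
  -- Differentiate the constant function `θ i (s j)`.
  have h3 : ∀ i j, g x (leviCivita g (A i) x (s i x)) (s j x)
      = -θ i x (leviCivita g (s j) x (s i x)) := fun i j => by
    have e1 := hD.metric (A i) (s j) x (hA i).diffVecAt (h.smooth j).diffVecAt (s i x)
    have e2 : ∀ᶠ y in nhds x, g y (A i y) (s j y) = (fun _ : M => if i = j then (1 : ℝ) else 0) y :=
      h.dual.mono fun y hy => by rw [hgA]; exact hy i j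
    have e3 := mvfderiv_congr e2 (s i x)
    rw [mvfderiv_const] at e3
    have e4 : (0 : ℝ) = _ := e3.symm.trans e1
    rw [hgA] at e4
    linarith
  -- In words: the sum of `∇_{s_i} θ_i` is minus the sum of `div(s_j) θ_j`. This is the source of
  -- the divergence terms in the formula for `δT`.
  have h4 : ∑ i, g x (leviCivita g (A i) x (s i x)) = -∑ j, divg g (s j) x • θ j x := by
    ext v
    conv_lhs => rw [← h.complete.self_of_nhds v, map_sum]
    rw [_root_.neg_apply, _root_.sum_apply, ← Finset.sum_neg_distrib]
    refine Finset.sum_congr rfl fun j _ => ?_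
    rw [map_smul, _root_.sum_apply, _root_.smul_apply, smul_eq_mul, smul_eq_mul,
      divg_eq_contraction (s j) h.complete.self_of_nhds, Finset.sum_congr rfl fun i _ => h3 i j,
      Finset.sum_neg_distrib]
    ring
  rw [h1, Finset.sum_congr rfl fun i _ => h2 i, Finset.sum_sub_distrib, ← map_sum, h4, map_neg,
    map_sum, sub_neg_eq_add, Finset.sum_add_distrib]
  simp only [map_smul]

end DualFrame

end HitchinWitten

namespace HitchinWitten

open VectorField

/-! ### The operator `Δ_T` in a local frame. -/

section Lap

variable {E : Type*} [NormedAddCommGroup E] [NormedSpace ℝ E] [FiniteDimensional ℝ E]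
  {M : Type*} [TopologicalSpace M] [ChartedSpace E M] [IsManifold 𝓘(ℝ, E) ∞ M] [T2Space M]
  {L : M → Type*} [∀ x, AddCommGroup (L x)] [∀ x, Module ℂ (L x)]
  [∀ x, TopologicalSpace (L x)] [∀ x, IsTopologicalAddGroup (L x)] [∀ x, ContinuousSMul ℝ (L x)]
  [TopologicalSpace (TotalSpace ℂ L)] [FiberBundle ℂ L] [VectorBundle ℝ ℂ L] [VectorBundle ℂ ℂ L]
  [ContMDiffVectorBundle ∞ ℂ L 𝓘(ℝ, E)] {Ω g : BilinField E M} (B : Prequantum L Ω) {k : ℕ}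
  {T : Bivector E M}

omit [FiniteDimensional ℝ E] [T2Space M] in
lemma contMDiffAt_ofReal {f : M → ℝ} {x : M} (hf : ContMDiffAt 𝓘(ℝ, E) 𝓘(ℝ, ℝ) ∞ f x) :
    ContMDiffAt 𝓘(ℝ, E) 𝓘(ℝ, ℂ) ∞ (fun y => (f y : ℂ)) x :=
  (Complex.ofRealCLM.contMDiff.contMDiffAt).comp x hf

omit [FiniteDimensional ℝ E] [T2Space M] in
lemma mdifferentiableAt_ofReal {f : M → ℝ} {x : M} (hf : MDifferentiableAt 𝓘(ℝ, E) 𝓘(ℝ, ℝ) f x) :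
    MDifferentiableAt 𝓘(ℝ, E) 𝓘(ℝ, ℂ) (fun y => (f y : ℂ)) x :=
  mdifferentiableAt_clm_comp Complex.ofRealCLM hf

omit [FiniteDimensional ℝ E] [T2Space M] in
lemma mvfderiv_ofReal {f : M → ℝ} {x : M} (hf : MDifferentiableAt 𝓘(ℝ, E) 𝓘(ℝ, ℝ) f x)
    (u : TangentSpace 𝓘(ℝ, E) x) :
    mvfderiv 𝓘(ℝ, E) (fun y => (f y : ℂ)) x u = (diff f x u : ℂ) :=
  mvfderiv_clm_comp Complex.ofRealCLM hf u

lemma nabla_zero (x : M) (u : TangentSpace 𝓘(ℝ, E) x) :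
    nabla B.conn (0 : Sec L k) x u = 0 := by
  have h : DiffPowAt (E := E) (0 : Sec L k) x := by
    unfold DiffPowAt
    simp only [Pi.zero_apply, map_zero]
    exact mdifferentiableAt_const
  have := nabla_smul B 0 h u
  rwa [zero_smul, zero_smul] at this

lemma DiffPowAt.sum {ι : Type*} (s : Finset ι) {ψ : ι → Sec L k} {x : M}
    (h : ∀ i, DiffPowAt (E := E) (ψ i) x) :
    DiffPowAt (E := E) (∑ i ∈ s, ψ i) x := by
  classical
  induction s using Finset.induction_on with
  | empty =>
    unfold DiffPowAt
    simp only [Finset.sum_empty, Pi.zero_apply, map_zero]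
    exact mdifferentiableAt_const
  | insert a s ha ih =>
    rw [Finset.sum_insert ha]
    exact (h a).add ih

lemma nabla_sum {ι : Type*} (s : Finset ι) {ψ : ι → Sec L k} {x : M}
    (h : ∀ i, DiffPowAt (E := E) (ψ i) x) (u : TangentSpace 𝓘(ℝ, E) x) :
    nabla B.conn (∑ i ∈ s, ψ i) x u = ∑ i ∈ s, nabla B.conn (ψ i) x u := by
  classical
  induction s using Finset.induction_on with
  | empty => rw [Finset.sum_empty, Finset.sum_empty, nabla_zero]
  | insert a s ha ih =>
    rw [Finset.sum_insert ha, Finset.sum_insert ha, nabla_add B (h a) (DiffPowAt.sum s h), ih]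

omit [T2Space M] in
lemma leviCivita_sum_smul (hg : IsMetric g) {ι : Type*} (s : Finset ι) {f : ι → M → ℝ}
    {X : ι → VecField E M} {x : M} (hf : ∀ i, MDifferentiableAt 𝓘(ℝ, E) 𝓘(ℝ, ℝ) (f i) x)
    (hX : ∀ i, DiffVecAt (X i) x) (u : TangentSpace 𝓘(ℝ, E) x) :
    DiffVecAt (∑ i ∈ s, f i • X i) x ∧
    leviCivita g (∑ i ∈ s, f i • X i) x u
      = ∑ i ∈ s, (f i x • leviCivita g (X i) x u + diff (f i) x u • X i x) := by
  classical
  have hD := isLeviCivita_leviCivita hg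
  induction s using Finset.induction_on with
  | empty =>
    have h0 : DiffVecAt (0 : VecField E M) x :=
      (contMDiff_zeroSection (n := 1) ℝ (fun x : M => TangentSpace 𝓘(ℝ, E) x)).mdifferentiable
        (by simp) x
    have h1 := hD.const_smul 0 h0
    rw [zero_smul, zero_smul] at h1
    rw [Finset.sum_empty, Finset.sum_empty, h1]
    exact ⟨h0, rfl⟩
  | insert a s ha ih =>
    have h2 := diffVecAt_smul (hf a) (hX a)
    rw [Finset.sum_insert ha, Finset.sum_insert ha, hD.add h2 ih.1]
    refine ⟨diffVecAt_add h2 ih.1, ?_⟩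
    rw [_root_.add_apply, ih.2, hD.leibniz (hX a) (hf a)]

omit [T2Space M] in
lemma IsDualFrame.eventually_eq {s : Fin (Module.finrank ℝ E) → VecField E M}
    {θ : Fin (Module.finrank ℝ E) → OneForm E M} {x : M} (h : IsDualFrame s θ x)
    (W : VecField E M) :
    ∀ᶠ y in nhds x, W y = (∑ i, (fun z => θ i z (W z)) • s i) y :=
  h.complete.mono fun y hy => by
    rw [Finset.sum_apply]
    exact (hy (W y)).symm

/-- The second covariant derivative is tensorial in its second argument. -/
lemma nabla_nabla_sub_eq (hg : IsMetric g) {ψ : Sec L k} {W : VecField E M} {x : M}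
    {s : Fin (Module.finrank ℝ E) → VecField E M}
    {θ : Fin (Module.finrank ℝ E) → OneForm E M} (h : IsDualFrame s θ x)
    (hψ : SmoothPowAt (E := E) ψ x) (hW : SmoothVecAt W x) (u : TangentSpace 𝓘(ℝ, E) x) :
    nabla B.conn (fun y => nabla B.conn ψ y (W y)) x u - nabla B.conn ψ x (leviCivita g W x u)
      = ∑ i, (θ i x (W x) : ℂ) • (nabla B.conn (fun y => nabla B.conn ψ y (s i y)) x u
          - nabla B.conn ψ x (leviCivita g (s i) x u)) := by
  have hD := isLeviCivita_leviCivita hg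
  have hd : ∀ i, MDifferentiableAt 𝓘(ℝ, E) 𝓘(ℝ, ℝ) (fun y => θ i y (W y)) x := fun i =>
    (h.smooth_form i W hW).mdifferentiableAt (by simp)
  have hs : ∀ i, DiffPowAt (E := E) (fun y => nabla B.conn ψ y (s i y)) x := fun i =>
    (smoothPowAt_nabla B hψ (h.smooth i)).diffPowAt
  obtain ⟨h1, h2⟩ := leviCivita_sum_smul hg Finset.univ hd (fun i => (h.smooth i).diffVecAt) u
  have h3 : leviCivita g W x u = _ :=
    (congrArg (fun A => A u) (hD.congr hW.diffVecAt h1 (h.eventually_eq W))).trans h2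
  have h4 : ∀ᶠ y in nhds x, nabla B.conn ψ y (W y)
      = (∑ i, mulOp (fun z => (θ i z (W z) : ℂ)) (fun y => nabla B.conn ψ y (s i y))) y :=
    h.complete.mono fun y hy => by
      rw [Finset.sum_apply]
      conv_lhs => rw [← hy (W y), nabla_sum_vec]
      exact Finset.sum_congr rfl fun i _ => nabla_smul_vec B ψ y _ _
  have h5 : nabla B.conn (fun y => nabla B.conn ψ y (W y)) x u
      = ∑ i, ((θ i x (W x) : ℂ) • nabla B.conn (fun y => nabla B.conn ψ y (s i y)) x u
        + (diff (fun y => θ i y (W y)) x u : ℂ) • nabla B.conn ψ x (s i x)) := by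
    rw [nabla_congr B h4, nabla_sum B _ fun i => (hs i).mulOp (mdifferentiableAt_ofReal (hd i))]
    refine Finset.sum_congr rfl fun i _ => ?_
    rw [nabla_mulOp B (hs i) (mdifferentiableAt_ofReal (hd i)), mvfderiv_ofReal (hd i)]
  rw [h3, h5, nabla_sum_vec, ← Finset.sum_sub_distrib]
  refine Finset.sum_congr rfl fun i _ => ?_
  rw [nabla_add_vec, nabla_smul_vec, nabla_smul_vec, smul_sub]
  abel

/-- `hess` extends `v` by a choice that depends on `v`; this form makes the linearity in `v`
visible. -/
lemma hess_eq (hg : IsMetric g) {ψ : Sec L k} {x : M}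
    {s : Fin (Module.finrank ℝ E) → VecField E M}
    {θ : Fin (Module.finrank ℝ E) → OneForm E M} (h : IsDualFrame s θ x)
    (hψ : SmoothPowAt (E := E) ψ x) (u v : TangentSpace 𝓘(ℝ, E) x) :
    hess B.conn g ψ x u v = ∑ i, (θ i x v : ℂ) •
      (nabla B.conn (fun y => nabla B.conn ψ y (s i y)) x u
          - nabla B.conn ψ x (leviCivita g (s i) x u)) := by
  have := nabla_nabla_sub_eq B hg h hψ (smoothVecAt_extendVec v) u
  rwa [extendVec_self] at this

/-- The operator `Δ_T` in a local frame. -/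
theorem lap_eq (hg : IsMetric g) (hT : SmoothBivector T) (hsym : SymmBivector T) {ψ : Sec L k}
    {x : M} {s : Fin (Module.finrank ℝ E) → VecField E M}
    {θ : Fin (Module.finrank ℝ E) → OneForm E M} (h : IsDualFrame s θ x)
    (hψ : SmoothPowAt (E := E) ψ x) :
    lap B.conn g T ψ x = ∑ i, (nabla B.conn (fun y => nabla B.conn ψ y (T y (θ i y))) x (s i x)
      + (divg g (s i) x : ℂ) • nabla B.conn ψ x (T x (θ i x))) := by
  -- The contraction may be taken in any dual pair of bases. The terms `∇_{∇ T θ_i} ψ` then cancel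
  -- between the Hessian and `δT`.
  have h1 : ∑ i, hess B.conn g ψ x (tbasis x i) (T x (tcobasis x i))
      = ∑ i, hess B.conn g ψ x (s i x) (T x (θ i x)) := by
    refine contraction_eq (fun u α => hess B.conn g ψ x u (T x α)) (fun u u' α => ?_)
      (fun c u α => ?_) (fun u α α' => ?_) (fun c u α => ?_) h.complete.self_of_nhds
    · simp only [hess, map_add, nabla_add_vec]
      abel
    · simp only [hess, map_smul, nabla_smul_vec, ← smul_sub]
      exact Complex.coe_smul c _
    · simp only [hess_eq B hg h hψ, map_add, Complex.ofReal_add, add_smul, Finset.sum_add_distrib]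
    · simp only [hess_eq B hg h hψ, map_smul, smul_eq_mul, Complex.ofReal_mul, mul_smul,
        ← Finset.smul_sum]
      exact Complex.coe_smul c _
  rw [lap, h1, divBivector_eq hg hT hsym h, nabla_sum_vec, ← Finset.sum_add_distrib]
  refine Finset.sum_congr rfl fun i _ => ?_
  rw [nabla_add_vec, nabla_smul_vec, hess_eq B hg h hψ,
    ← nabla_nabla_sub_eq B hg h hψ (hT _ x (h.smooth_form i))]
  abel

end Lap

end HitchinWitten

namespace HitchinWitten

open VectorField

/-! ### Linearity, smoothness and the product rule for `Δ_T`. -/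

section LapRules

variable {E : Type*} [NormedAddCommGroup E] [NormedSpace ℝ E] [FiniteDimensional ℝ E]
  {M : Type*} [TopologicalSpace M] [ChartedSpace E M] [IsManifold 𝓘(ℝ, E) ∞ M] [T2Space M]
  {L : M → Type*} [∀ x, AddCommGroup (L x)] [∀ x, Module ℂ (L x)]
  [∀ x, TopologicalSpace (L x)] [∀ x, IsTopologicalAddGroup (L x)] [∀ x, ContinuousSMul ℝ (L x)]
  [TopologicalSpace (TotalSpace ℂ L)] [FiberBundle ℂ L] [VectorBundle ℝ ℂ L] [VectorBundle ℂ ℂ L]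
  [ContMDiffVectorBundle ∞ ℂ L 𝓘(ℝ, E)] {Ω g : BilinField E M} (B : Prequantum L Ω) {k : ℕ}
  {T : Bivector E M}

lemma isDualFrame_self (x : M) : IsDualFrame (E := E) (vecFrame x) (vecCoframe x) x :=
  isDualFrame_vecFrame (mem_baseSet x)

lemma SmoothPow.add {ψ φ : Sec L k} (h : SmoothPow (E := E) ψ) (h' : SmoothPow (E := E) φ) :
    SmoothPow (E := E) (ψ + φ) := fun x => SmoothPowAt.add (h x) (h' x)

lemma SmoothPow.smul {ψ : Sec L k} (h : SmoothPow (E := E) ψ) (c : ℂ) :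
    SmoothPow (E := E) (c • ψ) := fun x => SmoothPowAt.smul (h x) c

lemma SmoothPow.mulOp {ψ : Sec L k} {f : M → ℂ} (h : SmoothPow (E := E) ψ)
    (hf : ContMDiff 𝓘(ℝ, E) 𝓘(ℝ, ℂ) ∞ f) : SmoothPow (E := E) (mulOp f ψ) :=
  fun x => SmoothPowAt.mulOp (h x) (hf x)

/-- The frame at `x` is also a frame at nearby points, so one expression in smooth local data
represents `Δ_T ψ` on a neighbourhood. -/
theorem smoothPow_lap (hg : IsMetric g) (hT : SmoothBivector T) (hsym : SymmBivector T)
    {ψ : Sec L k} (hψ : SmoothPow (E := E) ψ) : SmoothPow (E := E) (lap B.conn g T ψ) := by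
  intro x
  have h := isDualFrame_self (E := E) x
  have h1 : SmoothPowAt (E := E) (fun y => ∑ i, (nabla B.conn (fun z => nabla B.conn ψ z
      (T z (vecCoframe x i z))) y (vecFrame x i y)
      + (divg g (vecFrame x i) y : ℂ) • nabla B.conn ψ y (T y (vecCoframe x i y)))) x := by
    refine SmoothPowAt.sum _ fun i _ => ?_
    have h2 := smoothPowAt_nabla B (hψ x) (hT _ x (h.smooth_form i))
    exact SmoothPowAt.add (E := E) (smoothPowAt_nabla B h2 (h.smooth i))
      (SmoothPowAt.mulOp (E := E) h2 (contMDiffAt_ofReal (contMDiffAt_divg hg (h.smooth i))))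
  refine SmoothPowAt.congr (E := E) h1 ?_
  filter_upwards [eventually_mem_baseSet (E := E) x] with y hy
  exact lap_eq B hg hT hsym (isDualFrame_vecFrame hy) (hψ y)

lemma lap_add (hg : IsMetric g) (hT : SmoothBivector T) (hsym : SymmBivector T)
    {ψ φ : Sec L k} (hψ : SmoothPow (E := E) ψ) (hφ : SmoothPow (E := E) φ) :
    lap B.conn g T (ψ + φ) = lap B.conn g T ψ + lap B.conn g T φ := by
  funext x
  have h := isDualFrame_self (E := E) x
  rw [Pi.add_apply, lap_eq B hg hT hsym h (hψ x), lap_eq B hg hT hsym h (hφ x),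
    lap_eq B hg hT hsym h (SmoothPowAt.add (E := E) (hψ x) (hφ x)), ← Finset.sum_add_distrib]
  refine Finset.sum_congr rfl fun i _ => ?_
  have h1 : (fun y => nabla B.conn (ψ + φ) y (T y (vecCoframe x i y)))
      = (fun y => nabla B.conn ψ y (T y (vecCoframe x i y)))
        + fun y => nabla B.conn φ y (T y (vecCoframe x i y)) :=
    funext fun y => nabla_add B (SmoothPowAt.diffPowAt (hψ y)) (SmoothPowAt.diffPowAt (hφ y)) _
  have h2 := fun {ψ : Sec L k} (hψ : SmoothPow (E := E) ψ) =>
    (smoothPowAt_nabla B (hψ x) (hT _ x (h.smooth_form i))).diffPowAt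
  rw [h1, nabla_add B (h2 hψ) (h2 hφ),
    nabla_add B (SmoothPowAt.diffPowAt (hψ x)) (SmoothPowAt.diffPowAt (hφ x)), smul_add]
  abel

lemma lap_smul (hg : IsMetric g) (hT : SmoothBivector T) (hsym : SymmBivector T)
    {ψ : Sec L k} (c : ℂ) (hψ : SmoothPow (E := E) ψ) :
    lap B.conn g T (c • ψ) = c • lap B.conn g T ψ := by
  funext x
  have h := isDualFrame_self (E := E) x
  rw [Pi.smul_apply, lap_eq B hg hT hsym h (hψ x),
    lap_eq B hg hT hsym h (SmoothPowAt.smul (E := E) (hψ x) c), Finset.smul_sum]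
  refine Finset.sum_congr rfl fun i _ => ?_
  have h1 : (fun y => nabla B.conn (c • ψ) y (T y (vecCoframe x i y)))
      = c • (fun y => nabla B.conn ψ y (T y (vecCoframe x i y))) :=
    funext fun y => nabla_smul B c (SmoothPowAt.diffPowAt (hψ y)) _
  have h2 := (smoothPowAt_nabla B (hψ x) (hT _ x (h.smooth_form i))).diffPowAt
  rw [h1, nabla_smul B c h2, nabla_smul B c (SmoothPowAt.diffPowAt (hψ x)), smul_add,
    smul_comm _ c]

lemma SmoothBivector.neg (hT : SmoothBivector T) : SmoothBivector (-T) :=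
  fun α x hα => ContMDiffAt.neg_section (hT α x hα)

lemma SymmBivector.neg (hT : SymmBivector T) : SymmBivector (-T) := fun x α β => by
  change α (-(T x β)) = β (-(T x α))
  rw [map_neg, map_neg, hT]

lemma lap_neg (hg : IsMetric g) (hT : SmoothBivector T) (hsym : SymmBivector T)
    {ψ : Sec L k} (hψ : SmoothPow (E := E) ψ) :
    lap B.conn g (-T) ψ = -lap B.conn g T ψ := by
  funext x
  have h := isDualFrame_self (E := E) x
  rw [Pi.neg_apply, lap_eq B hg hT hsym h (hψ x), lap_eq B hg hT.neg hsym.neg h (hψ x),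
    ← Finset.sum_neg_distrib]
  refine Finset.sum_congr rfl fun i _ => ?_
  have h1 : (fun y => nabla B.conn ψ y ((-T) y (vecCoframe x i y)))
      = (-1 : ℂ) • (fun y => nabla B.conn ψ y (T y (vecCoframe x i y))) :=
    funext fun y => (nabla_neg_vec B ψ y (T y (vecCoframe x i y))).trans (neg_one_smul ℂ _).symm
  have h2 := (smoothPowAt_nabla B (hψ x) (hT _ x (h.smooth_form i))).diffPowAt
  have h3 : nabla B.conn ψ x ((-T) x (vecCoframe x i x))
      = -nabla B.conn ψ x (T x (vecCoframe x i x)) := nabla_neg_vec B ψ x _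
  rw [h1, nabla_smul B _ h2, h3, neg_one_smul, smul_neg, neg_add]

/-- The product rule for `Δ_T`. -/
theorem lap_mulOp_ofReal (hg : IsMetric g) (hT : SmoothBivector T) (hsym : SymmBivector T)
    {f : M → ℝ} (hf : ContMDiff 𝓘(ℝ, E) 𝓘(ℝ, ℝ) ∞ f) {ψ : Sec L k} (hψ : SmoothPow (E := E) ψ)
    (x : M) :
    lap B.conn g T (mulOp (fun y => (f y : ℂ)) ψ) x = (f x : ℂ) • lap B.conn g T ψ x
      + (divg g (fun y => T y (diff f y)) x : ℂ) • ψ x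
      + (2 : ℂ) • nabla B.conn ψ x (T x (diff f x)) := by
  have h := isDualFrame_self (E := E) x
  have hfd : ∀ y, MDifferentiableAt 𝓘(ℝ, E) 𝓘(ℝ, ℝ) f y :=
    fun y => (hf y).mdifferentiableAt (by simp)
  have hψd := fun y => SmoothPowAt.diffPowAt (E := E) (hψ y)
  have hX : SmoothVecAt (fun y => T y (diff f y)) x := hT _ x (smoothFormAt_diff (hf x))
  have hp : ∀ i, MDifferentiableAt 𝓘(ℝ, E) 𝓘(ℝ, ℝ)
      (fun y => vecCoframe x i y (T y (diff f y))) x := fun i =>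
    (h.smooth_form i _ hX).mdifferentiableAt (by simp)
  have hTθ : ∀ i, DiffPowAt (E := E) (fun y => nabla B.conn ψ y (T y (vecCoframe x i y))) x :=
    fun i => (smoothPowAt_nabla B (hψ x) (hT _ x (h.smooth_form i))).diffPowAt
  -- Symmetry of `T` rewrites the coefficient `df(T θ_i)` as the component `θ_i(T df)` of one fixed
  -- vector field.
  have h1 : ∀ i, (fun y => nabla B.conn (mulOp (fun z => (f z : ℂ)) ψ) y (T y (vecCoframe x i y)))
      = mulOp (fun z => (f z : ℂ)) (fun y => nabla B.conn ψ y (T y (vecCoframe x i y)))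
        + mulOp (fun y => (vecCoframe x i y (T y (diff f y)) : ℂ)) ψ := fun i => by
    funext y
    rw [nabla_mulOp B (hψd y) (mdifferentiableAt_ofReal (hfd y)), mvfderiv_ofReal (hfd y),
      hsym y (diff f y)]
    rfl
  have h2 : divg g (fun y => T y (diff f y)) x = ∑ i, (vecCoframe x i x (T x (diff f x))
      * divg g (vecFrame x i) x
      + diff (fun y => vecCoframe x i y (T y (diff f y))) x (vecFrame x i x)) := by
    rw [divg_eq_sum hg (mem_baseSet x) (fun i => vecComp_mdiff hX.diffVecAt i)]
    refine Finset.sum_congr rfl fun i _ => ?_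
    have e : ∀ᶠ y in nhds x, vecComp x (fun y => T y (diff f y)) i y
        = vecCoframe x i y (T y (diff f y)) :=
      (eventually_mem_baseSet x).mono fun y hy => vecComp_eq_vecCoframe hy _ i
    rw [e.self_of_nhds]
    congr 1
    exact mvfderiv_congr e _
  have h3 : ∑ i, (diff f x (vecFrame x i x) : ℂ) • nabla B.conn ψ x (T x (vecCoframe x i x))
      = nabla B.conn ψ x (T x (diff f x)) := by
    simp only [← nabla_smul_vec, ← nabla_sum_vec, ← map_smul, ← map_sum]
    congr 2
    ext v
    conv_rhs => rw [← h.complete.self_of_nhds v, map_sum]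
    rw [_root_.sum_apply]
    refine Finset.sum_congr rfl fun j _ => ?_
    rw [map_smul, _root_.smul_apply, smul_eq_mul, smul_eq_mul, mul_comm]
  have h4 : ∑ i, (vecCoframe x i x (T x (diff f x)) : ℂ) • nabla B.conn ψ x (vecFrame x i x)
      = nabla B.conn ψ x (T x (diff f x)) := by
    simp only [← nabla_smul_vec, ← nabla_sum_vec]
    rw [h.complete.self_of_nhds]
  rw [lap_eq B hg hT hsym h (SmoothPowAt.mulOp (hψ x) (contMDiffAt_ofReal (hf x))),
    lap_eq B hg hT hsym h (hψ x), h2, two_smul]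
  -- The two copies of `∇_{T df} ψ` have different origins: `h3` collects the terms in which the
  -- outer derivative hits `f`, and `h4` those in which it hits `ψ` next to the coefficient `θ_i(T
  -- df)`.
  conv_rhs => rw [← h3]
  nth_rewrite 2 [h3]
  rw [← h4, Finset.smul_sum, Complex.ofReal_sum, Finset.sum_smul, ← Finset.sum_add_distrib,
    ← Finset.sum_add_distrib, ← Finset.sum_add_distrib]
  refine Finset.sum_congr rfl fun i _ => ?_
  rw [h1 i, nabla_add B ((hTθ i).mulOp (mdifferentiableAt_ofReal (hfd x)))
      ((hψd x).mulOp (mdifferentiableAt_ofReal (hp i))),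
    nabla_mulOp B (hTθ i) (mdifferentiableAt_ofReal (hfd x)),
    nabla_mulOp B (hψd x) (mdifferentiableAt_ofReal (hp i)),
    nabla_mulOp B (hψd x) (mdifferentiableAt_ofReal (hfd x)), mvfderiv_ofReal (hfd x),
    mvfderiv_ofReal (hfd x), mvfderiv_ofReal (hp i), hsym x (diff f x)]
  push_cast
  module

end LapRules

end HitchinWitten

namespace HitchinWitten

open VectorField

/-! ### Operators that are linear on smooth sections. -/

section SmoothLinear

variable {E : Type*} [NormedAddCommGroup E] [NormedSpace ℝ E] [FiniteDimensional ℝ E]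
  {M : Type*} [TopologicalSpace M] [ChartedSpace E M] [IsManifold 𝓘(ℝ, E) ∞ M] [T2Space M]
  {L : M → Type*} [∀ x, AddCommGroup (L x)] [∀ x, Module ℂ (L x)]
  [∀ x, TopologicalSpace (L x)] [∀ x, IsTopologicalAddGroup (L x)] [∀ x, ContinuousSMul ℝ (L x)]
  [TopologicalSpace (TotalSpace ℂ L)] [FiberBundle ℂ L] [VectorBundle ℝ ℂ L] [VectorBundle ℂ ℂ L]
  [ContMDiffVectorBundle ∞ ℂ L 𝓘(ℝ, E)] {Ω g : BilinField E M} (B : Prequantum L Ω) {k : ℕ}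
  {T : Bivector E M}

variable (E) in
/-- Operators that are linear maps from smooth sections to smooth sections. -/
structure IsSmoothLinear (D : Op L k) : Prop where
  smooth : ∀ {ψ}, SmoothPow (E := E) ψ → SmoothPow (E := E) (D ψ)
  add : ∀ {ψ φ}, SmoothPow (E := E) ψ → SmoothPow (E := E) φ → D (ψ + φ) = D ψ + D φ
  smul : ∀ (c : ℂ) {ψ}, SmoothPow (E := E) ψ → D (c • ψ) = c • D ψ

/-- The covariant derivative along a real vector field. -/
def nablaVec (conn : CovariantDerivative 𝓘(ℝ, E) ℂ L) (X : VecField E M) : Op L k :=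
  fun ψ x => nabla conn ψ x (X x)

lemma isSmoothLinear_add {D D' : Op L k} (h : IsSmoothLinear E D) (h' : IsSmoothLinear E D') :
    IsSmoothLinear E (D + D') where
  smooth hψ := (h.smooth hψ).add (h'.smooth hψ)
  add hψ hφ := by
    simp only [Pi.add_apply]
    rw [h.add hψ hφ, h'.add hψ hφ]
    abel
  smul c ψ hψ := by
    simp only [Pi.add_apply]
    rw [h.smul c hψ, h'.smul c hψ, smul_add]

lemma isSmoothLinear_smul {D : Op L k} (h : IsSmoothLinear E D) (c : ℂ) :
    IsSmoothLinear E (c • D) where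
  smooth hψ := (h.smooth hψ).smul c
  add hψ hφ := by
    simp only [Pi.smul_apply]
    rw [h.add hψ hφ, smul_add]
  smul a ψ hψ := by
    simp only [Pi.smul_apply]
    rw [h.smul a hψ, smul_comm]

lemma isSmoothLinear_sub {D D' : Op L k} (h : IsSmoothLinear E D) (h' : IsSmoothLinear E D') :
    IsSmoothLinear E (D - D') := by
  have := isSmoothLinear_add h (isSmoothLinear_smul h' (-1))
  rwa [neg_one_smul, ← sub_eq_add_neg] at this

lemma isSmoothLinear_mulOp {f : M → ℂ} (hf : ContMDiff 𝓘(ℝ, E) 𝓘(ℝ, ℂ) ∞ f) :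
    IsSmoothLinear E (mulOp f : Op L k) where
  smooth hψ := hψ.mulOp hf
  add _ _ := funext fun _ => smul_add _ _ _
  smul c _ _ := funext fun x => smul_comm (f x) c _

lemma isSmoothLinear_nablaVec {X : VecField E M} (hX : ∀ x, SmoothVecAt X x) :
    IsSmoothLinear E (nablaVec B.conn X : Op L k) where
  smooth hψ x := smoothPowAt_nabla B (hψ x) (hX x)
  add hψ hφ := funext fun x =>
    nabla_add B (SmoothPowAt.diffPowAt (hψ x)) (SmoothPowAt.diffPowAt (hφ x)) _
  smul c _ hψ := funext fun x => nabla_smul B c (SmoothPowAt.diffPowAt (hψ x)) _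

lemma isSmoothLinear_lap (hg : IsMetric g) (hT : SmoothBivector T) (hsym : SymmBivector T) :
    IsSmoothLinear E (lap B.conn g T : Op L k) where
  smooth hψ := smoothPow_lap B hg hT hsym hψ
  add hψ hφ := lap_add B hg hT hsym hψ hφ
  smul c _ hψ := lap_smul B hg hT hsym c hψ

lemma nablaVec_mulOp {ψ : Sec L k} (hψ : SmoothPow (E := E) ψ) {f : M → ℂ}
    (hf : ContMDiff 𝓘(ℝ, E) 𝓘(ℝ, ℂ) ∞ f) (X : VecField E M) (x : M) :
    nablaVec B.conn X (mulOp f ψ) x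
      = f x • nablaVec B.conn X ψ x + mvfderiv 𝓘(ℝ, E) f x (X x) • ψ x :=
  nabla_mulOp B (SmoothPowAt.diffPowAt (hψ x)) ((hf x).mdifferentiableAt (by simp)) _

lemma contMDiff_re {f : M → ℂ} (hf : ContMDiff 𝓘(ℝ, E) 𝓘(ℝ, ℂ) ∞ f) :
    ContMDiff 𝓘(ℝ, E) 𝓘(ℝ, ℝ) ∞ (fun x => (f x).re) :=
  Complex.reCLM.contMDiff.comp hf

lemma contMDiff_im {f : M → ℂ} (hf : ContMDiff 𝓘(ℝ, E) 𝓘(ℝ, ℂ) ∞ f) :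
    ContMDiff 𝓘(ℝ, E) 𝓘(ℝ, ℝ) ∞ (fun x => (f x).im) :=
  Complex.imCLM.contMDiff.comp hf

lemma contMDiff_ofReal {f : M → ℝ} (hf : ContMDiff 𝓘(ℝ, E) 𝓘(ℝ, ℝ) ∞ f) :
    ContMDiff 𝓘(ℝ, E) 𝓘(ℝ, ℂ) ∞ (fun x => (f x : ℂ)) :=
  Complex.ofRealCLM.contMDiff.comp hf

lemma contMDiff_mul_complex {f h : M → ℂ} (hf : ContMDiff 𝓘(ℝ, E) 𝓘(ℝ, ℂ) ∞ f)
    (hh : ContMDiff 𝓘(ℝ, E) 𝓘(ℝ, ℂ) ∞ h) : ContMDiff 𝓘(ℝ, E) 𝓘(ℝ, ℂ) ∞ (fun y => f y * h y) :=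
  fun x => contMDiffAt_mul_complex (hf x) (hh x)

end SmoothLinear

/-! ### The operators `b` and `b̄` and their commutators with functions. -/

section HitchinWittenForm

variable {E : Type*} [NormedAddCommGroup E] [NormedSpace ℝ E] [FiniteDimensional ℝ E]
  {M : Type*} [TopologicalSpace M] [ChartedSpace E M] [IsManifold 𝓘(ℝ, E) ∞ M] [T2Space M]
  {P : Type*} [NormedAddCommGroup P] [NormedSpace ℂ P]
  {S : Type*} [TopologicalSpace S] [ChartedSpace P S] [IsManifold 𝓘(ℝ, P) ∞ S]
  {L : M → Type*} [∀ x, AddCommGroup (L x)] [∀ x, Module ℂ (L x)]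
  [∀ x, TopologicalSpace (L x)] [∀ x, IsTopologicalAddGroup (L x)] [∀ x, ContinuousSMul ℝ (L x)]
  [TopologicalSpace (TotalSpace ℂ L)] [FiberBundle ℂ L] [VectorBundle ℝ ℂ L] [VectorBundle ℂ ℂ L]
  [ContMDiffVectorBundle ∞ ℂ L 𝓘(ℝ, E)] {Ω : BilinField E M} (B : Prequantum L Ω) {k : ℕ}
  {J : S → EndField E M} {F : S → M → ℝ} (lam : ℝ)

section Bivectors

variable (hJ : IsKahlerFamily (P := P) Ω J) (hΩ : IsSymplectic Ω)
include hJ hΩ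

omit [T2Space M] in
lemma smoothBivector_gre (σ : S) (V : TangentSpace 𝓘(ℝ, P) σ) : SmoothBivector (Gre Ω J σ V) :=
  fun α x hα => ContMDiffAt.const_smul_section (a := (1 / 2 : ℝ))
    (smoothBivector_gtilde hJ hΩ σ V α x hα)

omit [T2Space M] in
lemma symmBivector_gre (σ : S) (V : TangentSpace 𝓘(ℝ, P) σ) : SymmBivector (Gre Ω J σ V) := by
  intro x α β
  change α ((1 / 2 : ℝ) • Gtilde Ω J σ V x β) = β ((1 / 2 : ℝ) • Gtilde Ω J σ V x α)
  rw [map_smul, map_smul, symmBivector_gtilde hJ hΩ σ V x α β]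

omit hJ hΩ [T2Space M] [IsManifold 𝓘(ℝ, P) ∞ S] in
-- Holomorphy of the family makes the imaginary part of `G(V)` a real part in the direction `iV`. So
-- its smoothness and symmetry need no separate argument.
lemma gim_eq (hhol : IsHolomorphicFamily (P := P) Ω J) (σ : S) (V : TangentSpace 𝓘(ℝ, P) σ) :
    Gim Ω J σ V = -Gre Ω J σ (mulI V) := funext fun x =>
  ((neg_eq_iff_eq_neg (G := (E →L[ℝ] ℝ) →L[ℝ] E)).2 (hhol σ V x).1).symm

lemma smoothBivector_gim (hhol : IsHolomorphicFamily (P := P) Ω J) (σ : S)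
    (V : TangentSpace 𝓘(ℝ, P) σ) : SmoothBivector (Gim Ω J σ V) := by
  rw [gim_eq hhol]
  exact (smoothBivector_gre hJ hΩ σ _).neg

lemma symmBivector_gim (hhol : IsHolomorphicFamily (P := P) Ω J) (σ : S)
    (V : TangentSpace 𝓘(ℝ, P) σ) : SymmBivector (Gim Ω J σ V) := by
  rw [gim_eq hhol]
  exact (symmBivector_gre hJ hΩ σ _).neg

end Bivectors

omit [T2Space M] [FiniteDimensional ℝ E] in
lemma contMDiff_paramDeriv
    (hF : ContMDiff (𝓘(ℝ, P).prod 𝓘(ℝ, E)) 𝓘(ℝ, ℝ) ∞ (fun p : S × M => F p.1 p.2)) (σ : S)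
    (V : TangentSpace 𝓘(ℝ, P) σ) : ContMDiff 𝓘(ℝ, E) 𝓘(ℝ, ℝ) ∞ (paramDeriv F σ V) := fun x => by
  have h := contMDiffAt_mvfderiv_fst (hF (σ, x)) V
  exact h

omit [T2Space M] [FiniteDimensional ℝ E] in
lemma contMDiff_slice
    (hF : ContMDiff (𝓘(ℝ, P).prod 𝓘(ℝ, E)) 𝓘(ℝ, ℝ) ∞ (fun p : S × M => F p.1 p.2)) (σ : S) :
    ContMDiff 𝓘(ℝ, E) 𝓘(ℝ, ℝ) ∞ (F σ) :=
  hF.comp (contMDiff_const.prodMk contMDiff_id)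

variable (hJ : IsKahlerFamily (P := P) Ω J) (hΩ : IsSymplectic Ω)
  (hhol : IsHolomorphicFamily (P := P) Ω J)
  (hF : ContMDiff (𝓘(ℝ, P).prod 𝓘(ℝ, E)) 𝓘(ℝ, ℝ) ∞ (fun p : S × M => F p.1 p.2))
include hJ hΩ hhol hF

lemma isSmoothLinear_bOp (σ : S) (V : TangentSpace 𝓘(ℝ, P) σ) :
    IsSmoothLinear E (bOp B.conn Ω J lam F σ V : Op L k) := by
  have hg := (hJ.isCompatible hΩ σ).isMetric
  have hd : ∀ x, SmoothFormAt (E := E) (diff (F σ)) x := fun x =>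
    smoothFormAt_diff (contMDiff_slice hF σ x)
  have hm : ContMDiff 𝓘(ℝ, E) 𝓘(ℝ, ℂ) ∞ (derivHol F σ V) :=
    contMDiff_mul_complex contMDiff_const ((contMDiff_ofReal (contMDiff_paramDeriv hF σ V)).sub
      (contMDiff_mul_complex contMDiff_const (contMDiff_ofReal (contMDiff_paramDeriv hF σ (mulI V)))))
  exact isSmoothLinear_sub (isSmoothLinear_add
    (isSmoothLinear_add
      (isSmoothLinear_lap B hg (smoothBivector_gre hJ hΩ σ V) (symmBivector_gre hJ hΩ σ V))
      (isSmoothLinear_smul (isSmoothLinear_lap B hg (smoothBivector_gim hJ hΩ hhol σ V)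
        (symmBivector_gim hJ hΩ hhol σ V)) Complex.I))
    (isSmoothLinear_smul (isSmoothLinear_add
      (isSmoothLinear_nablaVec B fun x => smoothBivector_gre hJ hΩ σ V _ x (hd x))
      (isSmoothLinear_smul (isSmoothLinear_nablaVec B fun x =>
        smoothBivector_gim hJ hΩ hhol σ V _ x (hd x)) Complex.I)) 2))
    (isSmoothLinear_smul (isSmoothLinear_mulOp hm) _)

lemma isSmoothLinear_bBarOp (σ : S) (V : TangentSpace 𝓘(ℝ, P) σ) :
    IsSmoothLinear E (bBarOp B.conn Ω J lam F σ V : Op L k) := by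
  have hg := (hJ.isCompatible hΩ σ).isMetric
  have hd : ∀ x, SmoothFormAt (E := E) (diff (F σ)) x := fun x =>
    smoothFormAt_diff (contMDiff_slice hF σ x)
  have hm : ContMDiff 𝓘(ℝ, E) 𝓘(ℝ, ℂ) ∞ (derivAntihol F σ V) :=
    contMDiff_mul_complex contMDiff_const ((contMDiff_ofReal (contMDiff_paramDeriv hF σ V)).add
      (contMDiff_mul_complex contMDiff_const (contMDiff_ofReal (contMDiff_paramDeriv hF σ (mulI V)))))
  have hT := (smoothBivector_gim hJ hΩ hhol σ V).neg
  exact isSmoothLinear_sub (isSmoothLinear_add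
    (isSmoothLinear_add
      (isSmoothLinear_lap B hg (smoothBivector_gre hJ hΩ σ V) (symmBivector_gre hJ hΩ σ V))
      (isSmoothLinear_smul (isSmoothLinear_lap B hg hT
        (symmBivector_gim hJ hΩ hhol σ V).neg) Complex.I))
    (isSmoothLinear_smul (isSmoothLinear_add
      (isSmoothLinear_nablaVec B fun x => smoothBivector_gre hJ hΩ σ V _ x (hd x))
      (isSmoothLinear_smul (isSmoothLinear_nablaVec B
        (X := fun y => -Gim Ω J σ V y (diff (F σ) y)) fun x => hT _ x (hd x)) Complex.I)) 2))
    (isSmoothLinear_smul (isSmoothLinear_mulOp hm) _)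

/-- The two operators are formally conjugate, so the parts with `Gim` cancel and the two halves of
`V[F]` add up. -/
lemma bOp_add_bBarOp (σ : S) (V : TangentSpace 𝓘(ℝ, P) σ) {ψ : Sec L k}
    (hψ : SmoothPow (E := E) ψ) (x : M) :
    (bOp B.conn Ω J lam F σ V + bBarOp B.conn Ω J lam F σ V : Op L k) ψ x
      = (2 : ℂ) • lap B.conn (kahlerMetric Ω (J σ)) (Gre Ω J σ V) ψ x
        + (4 : ℂ) • nabla B.conn ψ x (Gre Ω J σ V x (diff (F σ) x))
        - (2 * lam * paramDeriv F σ V x : ℂ) • ψ x := by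
  have hg := (hJ.isCompatible hΩ σ).isMetric
  have h1 := congrFun (lap_neg B hg (smoothBivector_gim hJ hΩ hhol σ V)
    (symmBivector_gim hJ hΩ hhol σ V) hψ) x
  simp only [Pi.add_apply, Pi.sub_apply, Pi.smul_apply, Pi.neg_apply, bOp, bBarOp, lapC, nablaC,
    mulOp, nabla_neg_vec, derivHol, derivAntihol] at h1 ⊢
  rw [h1]
  module

/-- The commutator of `b + b̄` with multiplication by a real function. -/
lemma comm_bOp_add_bBarOp {f : M → ℝ} (hf : ContMDiff 𝓘(ℝ, E) 𝓘(ℝ, ℝ) ∞ f) (σ : S)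
    (V : TangentSpace 𝓘(ℝ, P) σ) {ψ : Sec L k} (hψ : SmoothPow (E := E) ψ) (x : M) :
    comm (bOp B.conn Ω J lam F σ V + bBarOp B.conn Ω J lam F σ V : Op L k) (mulOp fun y => (f y : ℂ)) ψ x
      = (divg (kahlerMetric Ω (J σ)) (fun y => Gtilde Ω J σ V y (diff f y)) x : ℂ) • ψ x
        + (2 : ℂ) • nabla B.conn ψ x (Gtilde Ω J σ V x (diff f x))
        + (2 * diff (F σ) x (Gtilde Ω J σ V x (diff f x)) : ℂ) • ψ x := by
  have hg := (hJ.isCompatible hΩ σ).isMetric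
  have hfC := contMDiff_ofReal hf
  have h1 : ∀ y (α : TangentSpace 𝓘(ℝ, E) y →L[ℝ] ℝ),
      Gtilde Ω J σ V y α = (2 : ℝ) • Gre Ω J σ V y α := fun y α => by
    change _ = (2 : ℝ) • ((1 / 2 : ℝ) • Gtilde Ω J σ V y α)
    rw [smul_smul]
    norm_num
  have h2 : divg (kahlerMetric Ω (J σ)) (fun y => Gtilde Ω J σ V y (diff f y)) x
      = 2 * divg (kahlerMetric Ω (J σ)) (fun y => Gre Ω J σ V y (diff f y)) x := by
    have hX := (smoothBivector_gre hJ hΩ σ V _ x (smoothFormAt_diff (hf x))).diffVecAt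
    have e : (fun y => Gtilde Ω J σ V y (diff f y))
        = (fun _ : M => (2 : ℝ)) • fun y => Gre Ω J σ V y (diff f y) := funext fun y => h1 y _
    have e2 : diff (E := E) (fun _ : M => (2 : ℝ)) x = 0 := mvfderiv_const 2
    rw [e, divg_smul hg mdifferentiableAt_const hX, e2]
    simp
  -- The commutator of `∇_{G·dF}` with `f` produces `df·G·dF`; symmetry brings it to the form in
  -- which it occurs in the derivative of `firstSolution`.
  have h3 : diff f x (Gre Ω J σ V x (diff (F σ) x)) = diff (F σ) x (Gre Ω J σ V x (diff f x)) :=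
    symmBivector_gre hJ hΩ σ V x _ _
  change (bOp B.conn Ω J lam F σ V + bBarOp B.conn Ω J lam F σ V : Op L k) (mulOp _ ψ) x
    - (f x : ℂ) • (bOp B.conn Ω J lam F σ V + bBarOp B.conn Ω J lam F σ V : Op L k) ψ x = _
  rw [bOp_add_bBarOp B lam hJ hΩ hhol hF σ V hψ,
    bOp_add_bBarOp B lam hJ hΩ hhol hF σ V (hψ.mulOp hfC),
    lap_mulOp_ofReal B hg (smoothBivector_gre hJ hΩ σ V) (symmBivector_gre hJ hΩ σ V) hf hψ,
    nabla_mulOp B (SmoothPowAt.diffPowAt (hψ x)) ((hfC x).mdifferentiableAt (by simp)),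
    mvfderiv_ofReal ((hf x).mdifferentiableAt (by simp)), h1, h2, nabla_smul_vec, map_smul, h3]
  simp only [mulOp, smul_eq_mul]
  push_cast
  module

end HitchinWittenForm

end HitchinWitten

namespace HitchinWitten

open VectorField

/-! ### The operator `S⁽¹⁾(f)` and its derivative for real `f`. -/

section FirstSolution

variable {E : Type*} [NormedAddCommGroup E] [NormedSpace ℝ E] [FiniteDimensional ℝ E]
  {M : Type*} [TopologicalSpace M] [ChartedSpace E M] [IsManifold 𝓘(ℝ, E) ∞ M] [T2Space M]
  {P : Type*} [NormedAddCommGroup P] [NormedSpace ℂ P]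
  {S : Type*} [TopologicalSpace S] [ChartedSpace P S]
  {L : M → Type*} [∀ x, AddCommGroup (L x)] [∀ x, Module ℂ (L x)]
  [∀ x, TopologicalSpace (L x)] [∀ x, IsTopologicalAddGroup (L x)] [∀ x, ContinuousSMul ℝ (L x)]
  [TopologicalSpace (TotalSpace ℂ L)] [FiberBundle ℂ L] [VectorBundle ℝ ℂ L] [VectorBundle ℂ ℂ L]
  [ContMDiffVectorBundle ∞ ℂ L 𝓘(ℝ, E)] {Ω : BilinField E M} (B : Prequantum L Ω) {k : ℕ}
  {J : S → EndField E M} {F : S → M → ℝ}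

/-- The zeroth order term `2 df·g̃·dF + Δf` of `firstSolution`, for a real function. -/
def solutionPotential (Ω : BilinField E M) (J : S → EndField E M) (F : S → M → ℝ) (f : M → ℝ)
    (σ : S) : M → ℝ := fun x =>
  2 * diff (F σ) x (grad (kahlerMetric Ω (J σ)) f x) + laplacian (kahlerMetric Ω (J σ)) f x

/-- `firstSolution` for a real function. -/
def realSolution (conn : CovariantDerivative 𝓘(ℝ, E) ℂ L) (Ω : BilinField E M)
    (J : S → EndField E M) (F : S → M → ℝ) (f : M → ℝ) (σ : S) : Op L k :=
  (-(Complex.I / 2)) • ((2 : ℂ) • nablaVec conn (grad (kahlerMetric Ω (J σ)) f)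
    + mulOp fun x => (solutionPotential Ω J F f σ x : ℂ))

lemma realSolution_apply (conn : CovariantDerivative 𝓘(ℝ, E) ℂ L) (f : M → ℝ) (σ : S)
    (ψ : Sec L k) (x : M) : realSolution conn Ω J F f σ ψ x
      = (-(Complex.I / 2)) • ((2 : ℂ) • nabla conn ψ x (grad (kahlerMetric Ω (J σ)) f x)
        + (solutionPotential Ω J F f σ x : ℂ) • ψ x) := rfl

lemma firstSolution_eq (conn : CovariantDerivative 𝓘(ℝ, E) ℂ L) (f : M → ℂ) (σ : S) :
    (firstSolution conn Ω J F f σ : Op L k) = realSolution conn Ω J F (fun x => (f x).re) σ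
      + Complex.I • realSolution conn Ω J F (fun x => (f x).im) σ := by
  funext ψ x
  simp only [Pi.add_apply, Pi.smul_apply, realSolution_apply, firstSolution, nablaC, mulOp,
    solutionPotential]
  push_cast
  module

lemma isDiffOp_zero_mulOp {f : M → ℂ} (hf : ContMDiff 𝓘(ℝ, E) 𝓘(ℝ, ℂ) ∞ f) :
    IsDiffOp E 0 (mulOp f : Op L k) :=
  ⟨fun _ h => (isSmoothLinear_mulOp hf).smooth h, fun _ _ h h' => (isSmoothLinear_mulOp hf).add h h',
    fun h _ _ _ => funext fun x => smul_comm (f x) (h x) _⟩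

lemma isDiffOp_zero_congr {D D' : Op L k} (h : IsDiffOp E 0 D)
    (e : ∀ ψ, SmoothPow (E := E) ψ → D' ψ = D ψ) : IsDiffOp E 0 D' :=
  ⟨fun ψ hψ => e ψ hψ ▸ h.1 ψ hψ,
    fun ψ φ hψ hφ => by rw [e _ (hψ.add hφ), e ψ hψ, e φ hφ, h.2.1 ψ φ hψ hφ],
    fun f hf ψ hψ => by rw [e _ (hψ.mulOp hf), e ψ hψ, h.2.2 f hf ψ hψ]⟩

variable [IsManifold 𝓘(ℝ, P) ∞ S]

/-- The derivative of a family of operators is additive. -/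
lemma derivOp_add_smul {D D' : S → Op L k} (c : ℂ) {σ : S} {ψ : Sec L k} {x : M}
    (h : MDifferentiableAt 𝓘(ℝ, P) 𝓘(ℝ, ℂ) (fun τ => coord k x x (D τ ψ x)) σ)
    (h' : MDifferentiableAt 𝓘(ℝ, P) 𝓘(ℝ, ℂ) (fun τ => coord k x x (D' τ ψ x)) σ)
    (V : TangentSpace 𝓘(ℝ, P) σ) :
    derivOp (fun τ => D τ + c • D' τ) σ V ψ x = derivOp D σ V ψ x + c • derivOp D' σ V ψ x := by
  have h1 : MDifferentiableAt 𝓘(ℝ, P) 𝓘(ℝ, ℂ) (fun τ => c * coord k x x (D' τ ψ x)) σ :=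
    MDifferentiableAt.mul mdifferentiableAt_const h'
  have e : (fun τ => coord k x x ((D τ + c • D' τ) ψ x))
      = (fun τ => coord k x x (D τ ψ x)) + fun τ => c * coord k x x (D' τ ψ x) :=
    funext fun τ => by
      change coord k x x (D τ ψ x + c • D' τ ψ x) = _
      rw [map_add, map_smul]
      rfl
  have e2 := mvfderiv_clm_comp (ContinuousLinearMap.mul ℝ ℂ c) h' V
  have e3 : mvfderiv 𝓘(ℝ, P) (fun τ => coord k x x ((D τ + c • D' τ) ψ x)) σ V
      = mvfderiv 𝓘(ℝ, P) (fun τ => coord k x x (D τ ψ x)) σ V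
        + c * mvfderiv 𝓘(ℝ, P) (fun τ => coord k x x (D' τ ψ x)) σ V := by
    rw [e]
    exact (DFunLike.congr_fun (mvfderiv_add h h1) V).trans (congrArg (_ + ·) e2)
  simp only [derivOp]
  rw [e3, add_smul, mul_smul]

variable (hJ : IsKahlerFamily (P := P) Ω J) (hΩ : IsSymplectic Ω)
  (hF : ContMDiff (𝓘(ℝ, P).prod 𝓘(ℝ, E)) 𝓘(ℝ, ℝ) ∞ (fun p : S × M => F p.1 p.2))
  {f : M → ℝ} (hf : ContMDiff 𝓘(ℝ, E) 𝓘(ℝ, ℝ) ∞ f)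
include hJ hΩ hF hf

lemma contMDiff_solutionPotential : ContMDiff (𝓘(ℝ, P).prod 𝓘(ℝ, E)) 𝓘(ℝ, ℝ) ∞
    (fun p : S × M => solutionPotential Ω J F f p.1 p.2) :=
  (contMDiff_const.mul (contMDiff_diff_grad hJ hΩ hF hf)).add (contMDiff_laplacian hJ hΩ hf)

lemma isSmoothLinear_realSolution (σ : S) :
    IsSmoothLinear E (realSolution B.conn Ω J F f σ : Op L k) :=
  isSmoothLinear_smul (isSmoothLinear_add
    (isSmoothLinear_smul (isSmoothLinear_nablaVec B fun x =>
      smoothVecAt_grad (hJ.isCompatible hΩ σ).isMetric (hf x)) _)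
    (isSmoothLinear_mulOp (contMDiff_ofReal
      (contMDiff_slice (contMDiff_solutionPotential hJ hΩ hF hf) σ)))) _

omit hF in
-- Only the first order term fails to commute with `h`, and its coefficient is `-(i/2)·2 = -i`.
lemma comm_realSolution_mulOp (σ : S) {h : M → ℂ} (hh : ContMDiff 𝓘(ℝ, E) 𝓘(ℝ, ℂ) ∞ h)
    {ψ : Sec L k} (hψ : SmoothPow (E := E) ψ) :
    comm (realSolution B.conn Ω J F f σ) (mulOp h) ψ
      = mulOp (fun x => -Complex.I
        * mvfderiv 𝓘(ℝ, E) h x (grad (kahlerMetric Ω (J σ)) f x)) ψ := by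
  funext x
  have h1 := nablaVec_mulOp B hψ hh (grad (kahlerMetric Ω (J σ)) f) x
  simp only [comm, Pi.sub_apply, realSolution, Pi.smul_apply, Pi.add_apply]
  rw [h1]
  simp only [mulOp, Pi.smul_apply, Pi.add_apply]
  module

/-- Near `x₀` the gradient is expanded in a frame that does not depend on `σ`: the components are
jointly smooth in `(σ, x)`, and the covariant derivatives along the frame involve `x` alone. -/
theorem smoothFamily_realSolution :
    SmoothFamily E P (realSolution B.conn Ω J F f : S → Op L k) := by
  intro ψ hψ σ₀ x₀
  have h1 := (smoothVecFamAt_grad hJ hΩ (hf x₀) σ₀).contMDiffAt_vecComp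
  have h2 : ContMDiffAt (𝓘(ℝ, P).prod 𝓘(ℝ, E)) 𝓘(ℝ, ℂ) ∞
      (fun p : S × M => coord k x₀ p.2 (ψ p.2)) (σ₀, x₀) :=
    ContMDiffAt.comp (x := (σ₀, x₀)) (f := fun q : S × M => q.2) (hψ x₀) contMDiffAt_snd
  have h3 : ∀ i, ContMDiffAt (𝓘(ℝ, P).prod 𝓘(ℝ, E)) 𝓘(ℝ, ℂ) ∞
      (fun p : S × M => coord k x₀ p.2 (nabla B.conn ψ p.2 (vecFrame x₀ i p.2))) (σ₀, x₀) :=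
    fun i => ContMDiffAt.comp (x := (σ₀, x₀)) (f := fun q : S × M => q.2)
      (smoothPowAt_nabla B (hψ x₀) ((isDualFrame_self (E := E) x₀).smooth i)) contMDiffAt_snd
  have h4 : ContMDiffAt (𝓘(ℝ, P).prod 𝓘(ℝ, E)) 𝓘(ℝ, ℂ) ∞ (fun p : S × M =>
      (-(Complex.I / 2)) * (2 * ∑ i, (vecComp x₀ (grad (kahlerMetric Ω (J p.1)) f) i p.2 : ℂ)
        * coord k x₀ p.2 (nabla B.conn ψ p.2 (vecFrame x₀ i p.2))
        + (solutionPotential Ω J F f p.1 p.2 : ℂ) * coord k x₀ p.2 (ψ p.2))) (σ₀, x₀) := by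
    refine contMDiffAt_mul_complex contMDiffAt_const (ContMDiffAt.add
      (contMDiffAt_mul_complex contMDiffAt_const (ContMDiffAt.sum fun i _ =>
        contMDiffAt_mul_complex ?_ (h3 i))) (contMDiffAt_mul_complex ?_ h2))
    · exact Complex.ofRealCLM.contMDiff.contMDiffAt.comp (σ₀, x₀) (h1 i)
    · exact Complex.ofRealCLM.contMDiff.contMDiffAt.comp (σ₀, x₀)
        (contMDiff_solutionPotential hJ hΩ hF hf (σ₀, x₀))
  refine h4.congr_of_eventuallyEq ?_
  filter_upwards [(continuous_snd.tendsto (σ₀, x₀)).eventually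
    (eventually_mem_baseSet (E := E) x₀)] with p hp
  have h5 := sum_vecComp x₀ (grad (kahlerMetric Ω (J p.1)) f) hp
  rw [realSolution_apply]
  conv_lhs => rw [h5, nabla_sum_vec]
  simp only [nabla_smul_vec, map_smul, map_add, map_sum, smul_eq_mul]

lemma mdifferentiableAt_coord_realSolution {ψ : Sec L k} (hψ : SmoothPow (E := E) ψ) (σ : S)
    (x : M) : MDifferentiableAt 𝓘(ℝ, P) 𝓘(ℝ, ℂ)
      (fun τ => coord k x x ((realSolution B.conn Ω J F f τ : Op L k) ψ x)) σ :=
  ContMDiffAt.mdifferentiableAt_fst (smoothFamily_realSolution B hJ hΩ hF hf ψ hψ σ x)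

/-- The derivative of `realSolution` along the parameter space. -/
lemma derivOp_realSolution (σ : S) (V : TangentSpace 𝓘(ℝ, P) σ) (ψ : Sec L k) (x : M) :
    derivOp (realSolution B.conn Ω J F f) σ V ψ x = (-(Complex.I / 2)) •
      ((-2 : ℂ) • nabla B.conn ψ x (Gtilde Ω J σ V x (diff f x))
        + ((2 * (diff (paramDeriv F σ V) x (grad (kahlerMetric Ω (J σ)) f x)
            - diff (F σ) x (Gtilde Ω J σ V x (diff f x)))
          - divg (kahlerMetric Ω (J σ)) (fun y => Gtilde Ω J σ V y (diff f y)) x : ℝ) : ℂ)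
          • ψ x) := by
  -- At a fixed `x` the operator depends on `σ` through one vector and one number, on which it acts
  -- linearly by `A` and `c`; the derivative passes through both.
  let A : E →L[ℝ] ℂ := LinearMap.toContinuousLinearMap (nablaCoord L B k ψ x : E →ₗ[ℝ] ℂ)
  let c : ℝ →L[ℝ] ℂ := ContinuousLinearMap.smulRight (1 : ℝ →L[ℝ] ℝ) (coord k x x (ψ x))
  have hY : MDifferentiableAt (M' := E) 𝓘(ℝ, P) 𝓘(ℝ, E)
      (fun τ => grad (kahlerMetric Ω (J τ)) f x) σ :=
    ((smoothVecFamAt_grad hJ hΩ (hf x) σ).contMDiffAt_param).mdifferentiableAt (by simp)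
  have hp : MDifferentiableAt 𝓘(ℝ, P) 𝓘(ℝ, ℝ) (fun τ => solutionPotential Ω J F f τ x) σ :=
    ContMDiffAt.mdifferentiableAt_fst (contMDiff_solutionPotential hJ hΩ hF hf (σ, x))
  have hp1 : MDifferentiableAt 𝓘(ℝ, P) 𝓘(ℝ, ℝ)
      (fun τ => diff (F τ) x (grad (kahlerMetric Ω (J τ)) f x)) σ :=
    ContMDiffAt.mdifferentiableAt_fst (contMDiff_diff_grad hJ hΩ hF hf (σ, x))
  have hp2 : MDifferentiableAt 𝓘(ℝ, P) 𝓘(ℝ, ℝ)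
      (fun τ => laplacian (kahlerMetric Ω (J τ)) f x) σ :=
    ContMDiffAt.mdifferentiableAt_fst (contMDiff_laplacian hJ hΩ hf (σ, x))
  have e1 : mvfderiv 𝓘(ℝ, P) (fun τ => solutionPotential Ω J F f τ x) σ V
      = 2 * (diff (paramDeriv F σ V) x (grad (kahlerMetric Ω (J σ)) f x)
            - diff (F σ) x (Gtilde Ω J σ V x (diff f x)))
          - divg (kahlerMetric Ω (J σ)) (fun y => Gtilde Ω J σ V y (diff f y)) x := by
    have a1 := paramDeriv_diff_grad hJ hΩ hF hf σ V x
    have a2 := paramDeriv_laplacian hJ hΩ hf σ V x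
    have a3 := mvfderiv_clm_comp ((2 : ℝ) • ContinuousLinearMap.id ℝ ℝ) hp1 V
    have a4 := mdifferentiableAt_clm_comp ((2 : ℝ) • ContinuousLinearMap.id ℝ ℝ) hp1
    refine (DFunLike.congr_fun (mvfderiv_add a4 hp2) V).trans ?_
    refine (congrArg₂ (· + ·) a3 a2).trans ?_
    rw [← a1]
    rfl
  have e2 : mvfderiv (F := E) 𝓘(ℝ, P) (fun τ => grad (kahlerMetric Ω (J τ)) f x) σ V
      = -Gtilde Ω J σ V x (diff f x) := congrFun (famDeriv_grad hJ hΩ f σ V) x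
  have e3 : (fun τ => coord k x x ((realSolution B.conn Ω J F f τ : Op L k) ψ x))
      = fun τ => ContinuousLinearMap.mul ℝ ℂ (-(Complex.I / 2))
        (((2 : ℝ) • A) (grad (kahlerMetric Ω (J τ)) f x) + c (solutionPotential Ω J F f τ x)) := by
    funext τ
    rw [realSolution_apply, map_smul, map_add, map_smul, map_smul]
    change _ = -(Complex.I / 2) * ((2 : ℝ) • coord k x x (nabla B.conn ψ x _)
      + (solutionPotential Ω J F f τ x) • coord k x x (ψ x))
    simp
  have b1 := mdifferentiableAt_clm_comp ((2 : ℝ) • A) hY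
  have b2 := mdifferentiableAt_clm_comp c hp
  have e4 := (mvfderiv_clm_comp (ContinuousLinearMap.mul ℝ ℂ (-(Complex.I / 2))) (b1.add b2) V)
  have e5 := (DFunLike.congr_fun (mvfderiv_add b1 b2) V).trans (congrArg₂ (· + ·)
    (mvfderiv_clm_comp ((2 : ℝ) • A) hY V) (mvfderiv_clm_comp c hp V))
  rw [e1] at e5
  have e6 : mvfderiv 𝓘(ℝ, P)
      (fun τ => coord k x x ((realSolution B.conn Ω J F f τ : Op L k) ψ x)) σ V
      = -(Complex.I / 2) * ((2 : ℝ) • coord k x x (nabla B.conn ψ x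
          (-Gtilde Ω J σ V x (diff f x)))
        + (2 * (diff (paramDeriv F σ V) x (grad (kahlerMetric Ω (J σ)) f x)
            - diff (F σ) x (Gtilde Ω J σ V x (diff f x)))
          - divg (kahlerMetric Ω (J σ)) (fun y => Gtilde Ω J σ V y (diff f y)) x)
          • coord k x x (ψ x)) := by
    rw [e3]
    refine e4.trans ?_
    refine congrArg (fun z => -(Complex.I / 2) * z) (e5.trans ?_)
    refine congrArg₂ (· + ·) (congrArg ((2 : ℝ) • A) e2) rfl
  rw [derivOp, e6, framePow_eq]
  apply coord_injective (mem_lbase x)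
  rw [map_smul, coord_tpow, lcoord_frame (mem_lbase x), nabla_neg_vec]
  simp only [map_smul, map_add, map_neg, smul_eq_mul, Complex.real_smul]
  push_cast
  ring

end FirstSolution

end HitchinWitten

namespace HitchinWitten

open VectorField

/-! ### The first step of the recursion. -/

section Recursion

variable {E : Type*} [NormedAddCommGroup E] [NormedSpace ℝ E] [FiniteDimensional ℝ E]
  {M : Type*} [TopologicalSpace M] [ChartedSpace E M] [IsManifold 𝓘(ℝ, E) ∞ M] [T2Space M]
  {P : Type*} [NormedAddCommGroup P] [NormedSpace ℂ P]
  {S : Type*} [TopologicalSpace S] [ChartedSpace P S] [IsManifold 𝓘(ℝ, P) ∞ S]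
  {L : M → Type*} [∀ x, AddCommGroup (L x)] [∀ x, Module ℂ (L x)]
  [∀ x, TopologicalSpace (L x)] [∀ x, IsTopologicalAddGroup (L x)] [∀ x, ContinuousSMul ℝ (L x)]
  [TopologicalSpace (TotalSpace ℂ L)] [FiberBundle ℂ L] [VectorBundle ℝ ℂ L] [VectorBundle ℂ ℂ L]
  [ContMDiffVectorBundle ∞ ℂ L 𝓘(ℝ, E)] {Ω : BilinField E M} (B : Prequantum L Ω) {k : ℕ}
  {J : S → EndField E M} {F : S → M → ℝ}

section

variable (hJ : IsKahlerFamily (P := P) Ω J) (hΩ : IsSymplectic Ω)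
  (hF : ContMDiff (𝓘(ℝ, P).prod 𝓘(ℝ, E)) 𝓘(ℝ, ℝ) ∞ (fun p : S × M => F p.1 p.2))
  {f : M → ℂ} (hf : ContMDiff 𝓘(ℝ, E) 𝓘(ℝ, ℂ) ∞ f)
include hJ hΩ hF hf

lemma isSmoothLinear_firstSolution (σ : S) :
    IsSmoothLinear E (firstSolution B.conn Ω J F f σ : Op L k) := by
  rw [firstSolution_eq]
  exact isSmoothLinear_add (isSmoothLinear_realSolution B hJ hΩ hF (contMDiff_re hf) σ)
    (isSmoothLinear_smul (isSmoothLinear_realSolution B hJ hΩ hF (contMDiff_im hf) σ) _)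

theorem smoothFamily_firstSolution :
    SmoothFamily E P (firstSolution B.conn Ω J F f : S → Op L k) := by
  intro ψ hψ σ₀ x₀
  have h1 := smoothFamily_realSolution B hJ hΩ hF (contMDiff_re hf) ψ hψ σ₀ x₀
  have h2 := smoothFamily_realSolution B hJ hΩ hF (contMDiff_im hf) ψ hψ σ₀ x₀
  refine (ContMDiffAt.add h1 (contMDiffAt_mul_complex
    (contMDiffAt_const (c := Complex.I)) h2)).congr_of_eventuallyEq
    (Eventually.of_forall fun p => ?_)
  simp only [firstSolution_eq, Pi.add_apply, Pi.smul_apply, map_add, map_smul, smul_eq_mul]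

omit hF hf in
lemma contMDiff_mvfderiv_grad {h : M → ℂ} (hh : ContMDiff 𝓘(ℝ, E) 𝓘(ℝ, ℂ) ∞ h) {f : M → ℝ}
    (hf : ContMDiff 𝓘(ℝ, E) 𝓘(ℝ, ℝ) ∞ f) (σ : S) :
    ContMDiff 𝓘(ℝ, E) 𝓘(ℝ, ℂ) ∞
      (fun x => mvfderiv 𝓘(ℝ, E) h x (grad (kahlerMetric Ω (J σ)) f x)) := fun x =>
  contMDiffAt_mvfderiv (smoothVecAt_grad (hJ.isCompatible hΩ σ).isMetric (hf x)) (hh x)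

/-- The commutator with a function is again multiplication by a function, by
`comm_realSolution_mulOp`. -/
theorem isDiffOp_firstSolution (σ : S) :
    IsDiffOp E 1 (firstSolution B.conn Ω J F f σ : Op L k) := by
  have hS := isSmoothLinear_firstSolution B (k := k) hJ hΩ hF hf σ
  refine ⟨fun ψ hψ => hS.smooth hψ, fun ψ φ hψ hφ => hS.add hψ hφ, fun c ψ hψ => hS.smul c hψ,
    fun h hh => ?_⟩
  have hm := fun {f : M → ℝ} (hf : ContMDiff 𝓘(ℝ, E) 𝓘(ℝ, ℝ) ∞ f) =>
    contMDiff_mul_complex (contMDiff_const (c := -Complex.I))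
      (contMDiff_mvfderiv_grad hJ hΩ hh hf σ)
  refine isDiffOp_zero_congr (isDiffOp_zero_mulOp ((hm (contMDiff_re hf)).add
    (contMDiff_mul_complex (contMDiff_const (c := Complex.I)) (hm (contMDiff_im hf)))))
    fun ψ hψ => ?_
  have h1 := comm_realSolution_mulOp B (F := F) hJ hΩ (contMDiff_re hf) σ hh hψ
  have h2 := comm_realSolution_mulOp B (F := F) hJ hΩ (contMDiff_im hf) σ hh hψ
  rw [firstSolution_eq]
  funext x
  have h1 := congrFun h1 x
  have h2 := congrFun h2 x
  simp only [comm, Pi.sub_apply, Pi.add_apply, Pi.smul_apply, mulOp] at h1 h2 ⊢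
  rw [add_smul, mul_smul Complex.I, ← h1, ← h2]
  module

end

variable (hJ : IsKahlerFamily (P := P) Ω J) (hΩ : IsSymplectic Ω)
  (hhol : IsHolomorphicFamily (P := P) Ω J) (lam : ℝ)
  (hF : ContMDiff (𝓘(ℝ, P).prod 𝓘(ℝ, E)) 𝓘(ℝ, ℝ) ∞ (fun p : S × M => F p.1 p.2))
include hJ hΩ hhol hF

/-- Differentiating `2 df·g̃·dF` leaves `-i d(V[F])·g̃·df`, and `[V[F], S⁽¹⁾(f)]` is its negative.
All other terms carry `G̃(V)·df` and match the commutator with `b + b̄` one by one. -/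
lemma twistedDeriv_realSolution {f : M → ℝ} (hf : ContMDiff 𝓘(ℝ, E) 𝓘(ℝ, ℝ) ∞ f) (σ : S)
    (V : TangentSpace 𝓘(ℝ, P) σ) {ψ : Sec L k} (hψ : SmoothPow (E := E) ψ) (x : M) :
    twistedDeriv F (realSolution B.conn Ω J F f) σ V ψ x = (Complex.I / 2) •
      comm (bOp B.conn Ω J lam F σ V + bBarOp B.conn Ω J lam F σ V)
        (mulOp fun y => (f y : ℂ)) ψ x := by
  have hV := contMDiff_paramDeriv hF σ V
  have h1 := comm_realSolution_mulOp B (F := F) hJ hΩ hf σ (contMDiff_ofReal hV) hψ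
  have h2 : comm (dFOp F σ V) (realSolution B.conn Ω J F f σ) ψ x
      = Complex.I • (diff (paramDeriv F σ V) x (grad (kahlerMetric Ω (J σ)) f x) : ℂ) • ψ x := by
    have h3 := congrFun h1 x
    have h4 : comm (dFOp F σ V) (realSolution B.conn Ω J F f σ) ψ x
        = -comm (realSolution B.conn Ω J F f σ) (mulOp fun y => (paramDeriv F σ V y : ℂ)) ψ x :=
      (neg_sub _ _).symm
    rw [h4, h3, mulOp, mvfderiv_ofReal ((hV x).mdifferentiableAt (by simp))]
    module
  rw [comm_bOp_add_bBarOp B lam hJ hΩ hhol hF hf σ V hψ]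
  change derivOp _ σ V ψ x + comm (dFOp F σ V) _ ψ x = _
  rw [h2, derivOp_realSolution B hJ hΩ hF hf]
  push_cast
  module

/-- The first step of the recursion for a formal trivialisation. -/
theorem twistedDeriv_firstSolution {f : M → ℂ} (hf : ContMDiff 𝓘(ℝ, E) 𝓘(ℝ, ℂ) ∞ f) (σ : S)
    (V : TangentSpace 𝓘(ℝ, P) σ) {ψ : Sec L k} (hψ : SmoothPow (E := E) ψ) :
    twistedDeriv F (firstSolution B.conn Ω J F f) σ V ψ = (Complex.I / 2) •
      comm (bOp B.conn Ω J lam F σ V + bBarOp B.conn Ω J lam F σ V) (mulOp f) ψ := by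
  funext x
  have hK := isSmoothLinear_add (isSmoothLinear_bOp B (k := k) lam hJ hΩ hhol hF σ V)
    (isSmoothLinear_bBarOp B lam hJ hΩ hhol hF σ V)
  have hre := contMDiff_re hf
  have him := contMDiff_im hf
  have h1 := twistedDeriv_realSolution B hJ hΩ hhol lam hF hre σ V hψ x
  have h2 := twistedDeriv_realSolution B hJ hΩ hhol lam hF him σ V hψ x
  have e1 : (firstSolution B.conn Ω J F f : S → Op L k) = fun σ =>
      realSolution B.conn Ω J F (fun x => (f x).re) σ
        + Complex.I • realSolution B.conn Ω J F (fun x => (f x).im) σ :=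
    funext fun σ => firstSolution_eq B.conn f σ
  have e2 : mulOp f ψ = mulOp (fun y => ((f y).re : ℂ)) ψ
      + Complex.I • mulOp (fun y => ((f y).im : ℂ)) ψ := by
    funext y
    simp only [mulOp, Pi.add_apply, Pi.smul_apply, smul_smul, ← add_smul]
    congr 1
    rw [mul_comm]
    exact (Complex.re_add_im _).symm
  have e3 := derivOp_add_smul Complex.I
    (mdifferentiableAt_coord_realSolution B hJ hΩ hF hre hψ σ x)
    (mdifferentiableAt_coord_realSolution B hJ hΩ hF him hψ σ x) V
  set K : Op L k := bOp B.conn Ω J lam F σ V + bBarOp B.conn Ω J lam F σ V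
  have e4 : K (mulOp f ψ) = K (mulOp (fun y => ((f y).re : ℂ)) ψ)
      + Complex.I • K (mulOp (fun y => ((f y).im : ℂ)) ψ) := by
    have s1 := hψ.mulOp (contMDiff_ofReal hre)
    have s2 := hψ.mulOp (contMDiff_ofReal him)
    rw [e2, hK.add s1 (s2.smul _), hK.smul _ s2]
  have e5 : comm K (mulOp f) ψ x = comm K (mulOp fun y => ((f y).re : ℂ)) ψ x
      + Complex.I • comm K (mulOp fun y => ((f y).im : ℂ)) ψ x := by
    have e6 := congrFun e2
    simp only [comm, Pi.sub_apply, e4, Pi.add_apply, Pi.smul_apply]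
    have e7 : mulOp f (K ψ) x = mulOp (fun y => ((f y).re : ℂ)) (K ψ) x
        + Complex.I • mulOp (fun y => ((f y).im : ℂ)) (K ψ) x := by
      simp only [mulOp, smul_smul, ← add_smul]
      congr 1
      rw [mul_comm]
      exact (Complex.re_add_im _).symm
    rw [e7]
    module
  rw [Pi.smul_apply, e5, smul_add, ← h1, smul_comm (Complex.I / 2) Complex.I, ← h2, e1]
  simp only [twistedDeriv, Pi.add_apply, comm, Pi.sub_apply, Pi.smul_apply, dFOp, mulOp] at e3 ⊢
  rw [e3]
  module

end Recursion

end HitchinWitten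

namespace HitchinWitten

open VectorField

/-! ### Seminorms and decay in the level. -/

section Asymptotics

variable {W : Type*} [AddCommGroup W] [Module ℂ W] (N : ExtSeminorm W)

lemma ExtSeminorm.ne_top_add_smul {u v : W} (hu : N.toFun u ≠ ⊤) (hv : N.toFun v ≠ ⊤) (a b : ℂ) :
    N.toFun (a • u + b • v) ≠ ⊤ := by
  refine ne_top_of_le_ne_top ?_ (N.add_le _ _)
  rw [N.smul, N.smul]
  exact ENNReal.add_ne_top.2 ⟨ENNReal.mul_ne_top enorm_ne_top hu,
    ENNReal.mul_ne_top enorm_ne_top hv⟩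

/-- Cramer's rule writes `u` and `v` as combinations of two vectors of finite seminorm. -/
lemma ExtSeminorm.ne_top_of_det {u v : W} {a₁ b₁ a₂ b₂ : ℂ} (hd : a₁ * b₂ - a₂ * b₁ ≠ 0)
    (h₁ : N.toFun (a₁ • u + b₁ • v) ≠ ⊤) (h₂ : N.toFun (a₂ • u + b₂ • v) ≠ ⊤) :
    N.toFun u ≠ ⊤ ∧ N.toFun v ≠ ⊤ := by
  constructor
  · have h := N.ne_top_add_smul h₁ h₂ (b₂ / (a₁ * b₂ - a₂ * b₁)) (-b₁ / (a₁ * b₂ - a₂ * b₁))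
    have e : (b₂ / (a₁ * b₂ - a₂ * b₁)) • (a₁ • u + b₁ • v)
        + (-b₁ / (a₁ * b₂ - a₂ * b₁)) • (a₂ • u + b₂ • v)
        = ((a₁ * b₂ - a₂ * b₁) / (a₁ * b₂ - a₂ * b₁)) • u := by
      module
    rwa [e, div_self hd, one_smul] at h
  · have h := N.ne_top_add_smul h₁ h₂ (-a₂ / (a₁ * b₂ - a₂ * b₁)) (a₁ / (a₁ * b₂ - a₂ * b₁))
    have e : (-a₂ / (a₁ * b₂ - a₂ * b₁)) • (a₁ • u + b₁ • v)
        + (a₁ / (a₁ * b₂ - a₂ * b₁)) • (a₂ • u + b₂ • v)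
        = ((a₁ * b₂ - a₂ * b₁) / (a₁ * b₂ - a₂ * b₁)) • v := by
      module
    rwa [e, div_self hd, one_smul] at h

lemma level_ne_zero {k : ℕ} (hk : 0 < k) (s : ℝ) : level k s ≠ 0 := fun h => by
  have := congrArg Complex.re h
  simp only [level, Complex.add_re, Complex.natCast_re, Complex.mul_re, Complex.I_re,
    Complex.ofReal_re, Complex.I_im, Complex.ofReal_im, Complex.zero_re] at this
  have hk' : (0 : ℝ) < k := by exact_mod_cast hk
  linarith

lemma conj_level (k : ℕ) (s : ℝ) : (starRingEnd ℂ) (level k s) = k - Complex.I * s := by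
  simp [level, sub_eq_add_neg]

lemma conj_level_ne_zero {k : ℕ} (hk : 0 < k) (s : ℝ) : (k : ℂ) - Complex.I * s ≠ 0 := by
  rw [← conj_level]
  exact (map_ne_zero _).2 (level_ne_zero hk s)

/-- Up to nonzero factors the determinant is `t₂ t̄₁ - t₁ t̄₂ = 2ik(s₂ - s₁)`. -/
lemma level_det_ne_zero {k : ℕ} (hk : 0 < k) {s₁ s₂ : ℝ} (h₁ : s₁ ≠ 0) (h₂ : s₂ ≠ 0)
    (h : s₁ ≠ s₂) :
    1 / (2 * level k s₁ * s₁) * (1 / (2 * (starRingEnd ℂ) (level k s₂) * s₂))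
      - 1 / (2 * level k s₂ * s₂) * (1 / (2 * (starRingEnd ℂ) (level k s₁) * s₁)) ≠ 0 := by
  have a1 := level_ne_zero hk s₁
  have a2 := level_ne_zero hk s₂
  have b1 := conj_level_ne_zero hk s₁
  have b2 := conj_level_ne_zero hk s₂
  have c1 : (s₁ : ℂ) ≠ 0 := Complex.ofReal_ne_zero.2 h₁
  have c2 : (s₂ : ℂ) ≠ 0 := Complex.ofReal_ne_zero.2 h₂
  have hk' : (k : ℂ) ≠ 0 := Nat.cast_ne_zero.2 hk.ne'
  have hs : (s₂ : ℂ) - s₁ ≠ 0 := sub_ne_zero.2 fun e => h (Complex.ofReal_injective e).symm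
  rw [conj_level, conj_level]
  have e0 : ∀ {t₁ r₁ t₂ r₂ : ℂ}, t₁ ≠ 0 → r₁ ≠ 0 → t₂ ≠ 0 → r₂ ≠ 0 →
      1 / (2 * t₁ * s₁) * (1 / (2 * r₂ * s₂)) - 1 / (2 * t₂ * s₂) * (1 / (2 * r₁ * s₁))
        = (t₂ * r₁ - t₁ * r₂) / (4 * s₁ * s₂ * t₁ * t₂ * r₁ * r₂) := fun h1 h2 h3 h4 => by
    field_simp
    ring
  have e : level k s₂ * ((k : ℂ) - Complex.I * s₁) - level k s₁ * ((k : ℂ) - Complex.I * s₂)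
      = 2 * Complex.I * k * (s₂ - s₁) := by
    simp only [level]
    ring
  rw [e0 a1 b1 a2 b2, e]
  refine div_ne_zero ?_ ?_
  · exact mul_ne_zero (mul_ne_zero (mul_ne_zero two_ne_zero Complex.I_ne_zero) hk') hs
  · have c4 : (4 : ℂ) ≠ 0 := by norm_num
    exact mul_ne_zero (mul_ne_zero (mul_ne_zero (mul_ne_zero (mul_ne_zero (mul_ne_zero c4 c1) c2)
      a1) a2) b1) b2

/-- A combination of two vectors with coefficients `1/(2ts)` and `1/(2t̄s)` is `o(1/|t|)` for every
seminorm that is finite on it for all large `|s|`. -/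
theorem ExtSeminorm.isLittleO_level {k : ℕ} (hk : 0 < k) {u v : W} {D : ℝ → W}
    (hD : ∀ s, s ≠ 0 → D s = (1 / (2 * level k s * s)) • u
      + (1 / (2 * (starRingEnd ℂ) (level k s) * s)) • v)
    (hN : ∀ᶠ s in Bornology.cobounded ℝ, N.toFun (D s) ≠ ⊤) :
    (fun s => (N.toFun (D s)).toReal) =o[Bornology.cobounded ℝ] (fun s => 1 / ‖level k s‖) := by
  -- Two distinct positive values of `s` are enough to get finiteness on `u` and `v`; they are `s₁`
  -- and `s₁ + 1` with `s₁` large.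
  have h0 : ∀ᶠ s in atTop, N.toFun (D s) ≠ ⊤ :=
    hN.filter_mono (by rw [IsOrderBornology.cobounded_eq]; exact le_sup_right)
  obtain ⟨s₁, hs₁⟩ := eventually_atTop.1 (h0.and (eventually_gt_atTop 0))
  obtain ⟨n₁, p₁⟩ := hs₁ s₁ le_rfl
  obtain ⟨n₂, p₂⟩ := hs₁ (s₁ + 1) (by linarith)
  rw [hD _ p₁.ne'] at n₁
  rw [hD _ p₂.ne'] at n₂
  obtain ⟨hu, hv⟩ := N.ne_top_of_det (level_det_ne_zero hk p₁.ne' p₂.ne' (by linarith)) n₁ n₂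
  have hs : ∀ᶠ s in Bornology.cobounded ℝ, s ≠ 0 :=
    Bornology.isBounded_def.1 (Bornology.isBounded_singleton (x := (0 : ℝ)))
  -- Both coefficients have modulus `1/(2|t||s|)`, since `|t̄| = |t|`; the factor `1/s` gives the
  -- gain over `1/|t|`.
  have h1 : (fun s => (N.toFun (D s)).toReal) =O[Bornology.cobounded ℝ]
      (fun s => 1 / ‖level k s‖ * s⁻¹) := by
    refine Asymptotics.IsBigO.of_bound ((N.toFun u).toReal + (N.toFun v).toReal)
      (hs.mono fun s hs0 => ?_)
    have e1 : ‖1 / (2 * level k s * s)‖ = ‖1 / ‖level k s‖ * s⁻¹‖ / 2 := by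
      simp only [norm_div, norm_mul, norm_inv, norm_norm, norm_one, Complex.norm_real,
        Complex.norm_ofNat]
      ring
    have e2 : ‖1 / (2 * (starRingEnd ℂ) (level k s) * s)‖ = ‖1 / ‖level k s‖ * s⁻¹‖ / 2 := by
      simp only [norm_div, norm_mul, norm_inv, norm_norm, norm_one, Complex.norm_real,
        Complex.norm_ofNat, RCLike.norm_conj]
      ring
    have h2 : (N.toFun (D s)).toReal ≤ ‖1 / (2 * level k s * s)‖ * (N.toFun u).toReal
        + ‖1 / (2 * (starRingEnd ℂ) (level k s) * s)‖ * (N.toFun v).toReal := by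
      rw [hD s hs0]
      have h3 := N.add_le ((1 / (2 * level k s * s)) • u)
        ((1 / (2 * (starRingEnd ℂ) (level k s) * s)) • v)
      rw [N.smul, N.smul] at h3
      have m1 := ENNReal.mul_ne_top (enorm_ne_top (x := 1 / (2 * level k s * (s : ℂ)))) hu
      have m2 := ENNReal.mul_ne_top
        (enorm_ne_top (x := 1 / (2 * (starRingEnd ℂ) (level k s) * (s : ℂ)))) hv
      refine (ENNReal.toReal_mono (ENNReal.add_ne_top.2 ⟨m1, m2⟩) h3).trans_eq ?_
      rw [ENNReal.toReal_add m1 m2, ENNReal.toReal_mul, ENNReal.toReal_mul, toReal_enorm,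
        toReal_enorm]
    rw [Real.norm_of_nonneg ENNReal.toReal_nonneg]
    refine h2.trans ?_
    rw [e1, e2]
    nlinarith [norm_nonneg (1 / ‖level k s‖ * s⁻¹), (N.toFun u).toReal_nonneg,
      (N.toFun v).toReal_nonneg, mul_nonneg (norm_nonneg (1 / ‖level k s‖ * s⁻¹))
        (add_nonneg (N.toFun u).toReal_nonneg (N.toFun v).toReal_nonneg)]
  have h2 : (fun s : ℝ => s⁻¹) =o[Bornology.cobounded ℝ] (fun _ => (1 : ℝ)) :=
    (Asymptotics.isLittleO_one_iff ℝ).2 tendsto_inv₀_cobounded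
  refine h1.trans_isLittleO ?_
  have h3 := (Asymptotics.isBigO_refl (fun s => 1 / ‖level k s‖)
    (Bornology.cobounded ℝ)).mul_isLittleO h2
  simpa using h3

end Asymptotics

/-! ### The covariant derivative of `C_f + S⁽¹⁾(f)/s`. -/

section FlatSection

variable {E : Type*} [NormedAddCommGroup E] [NormedSpace ℝ E] [FiniteDimensional ℝ E]
  {M : Type*} [TopologicalSpace M] [ChartedSpace E M] [IsManifold 𝓘(ℝ, E) ∞ M] [T2Space M]
  {P : Type*} [NormedAddCommGroup P] [NormedSpace ℂ P]
  {S : Type*} [TopologicalSpace S] [ChartedSpace P S] [IsManifold 𝓘(ℝ, P) ∞ S]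
  {L : M → Type*} [∀ x, AddCommGroup (L x)] [∀ x, Module ℂ (L x)]
  [∀ x, TopologicalSpace (L x)] [∀ x, IsTopologicalAddGroup (L x)] [∀ x, ContinuousSMul ℝ (L x)]
  [TopologicalSpace (TotalSpace ℂ L)] [FiberBundle ℂ L] [VectorBundle ℝ ℂ L] [VectorBundle ℂ ℂ L]
  [ContMDiffVectorBundle ∞ ℂ L 𝓘(ℝ, E)] {Ω : BilinField E M} (B : Prequantum L Ω) {k : ℕ}
  {J : S → EndField E M} {F : S → M → ℝ}
  (hJ : IsKahlerFamily (P := P) Ω J) (hΩ : IsSymplectic Ω)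
  (hhol : IsHolomorphicFamily (P := P) Ω J) (lam : ℝ)
  (hF : ContMDiff (𝓘(ℝ, P).prod 𝓘(ℝ, E)) 𝓘(ℝ, ℝ) ∞ (fun p : S × M => F p.1 p.2))
  {f : M → ℂ} (hf : ContMDiff 𝓘(ℝ, E) 𝓘(ℝ, ℂ) ∞ f)
include hJ hΩ hhol hF hf

/-- By the recursion the terms linear in `b` and `b̄` are `(i/(2s) + 1/(2t))[b, f]` and `(i/(2s) -
1/(2t̄))[b̄, f]`. Their parts of order `1/s` cancel, leaving `ik/(2ts)` and `ik/(2t̄s)`. -/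
lemma hwDeriv_firstSolution (hk : 0 < k) {s : ℝ} (hs : s ≠ 0) (σ : S)
    (V : TangentSpace 𝓘(ℝ, P) σ) {ψ : Sec L k} (hψ : SmoothPow (E := E) ψ) :
    hwDeriv (k := k) B.conn Ω J lam F s
        (fun τ => mulOp f + (1 / (s : ℂ)) • firstSolution B.conn Ω J F f τ) σ V ψ
      = (1 / (2 * level k s * s)) • ((Complex.I * k) •
            comm (bOp B.conn Ω J lam F σ V) (mulOp f) ψ
          + comm (bOp B.conn Ω J lam F σ V) (firstSolution B.conn Ω J F f σ) ψ)
        + (1 / (2 * (starRingEnd ℂ) (level k s) * s)) • ((Complex.I * k) •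
            comm (bBarOp B.conn Ω J lam F σ V) (mulOp f) ψ
          - comm (bBarOp B.conn Ω J lam F σ V) (firstSolution B.conn Ω J F f σ) ψ) := by
  have hb := isSmoothLinear_bOp B (k := k) lam hJ hΩ hhol hF σ V
  have hbb := isSmoothLinear_bBarOp B (k := k) lam hJ hΩ hhol hF σ V
  have hS := isSmoothLinear_firstSolution B (k := k) hJ hΩ hF hf σ
  have h1 := twistedDeriv_firstSolution B hJ hΩ hhol lam hF hf σ V hψ
  have s1 := hψ.mulOp hf
  have s2 := hS.smooth hψ
  have e1 := hb.add s1 (s2.smul (1 / (s : ℂ)))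
  have e2 := hbb.add s1 (s2.smul (1 / (s : ℂ)))
  rw [hb.smul _ s2] at e1
  rw [hbb.smul _ s2] at e2
  have s3 := hb.smooth hψ
  have s4 := hbb.smooth hψ
  have s5 : SmoothPow (E := E) (dFOp F σ V ψ) :=
    hψ.mulOp (contMDiff_ofReal (contMDiff_paramDeriv hF σ V))
  -- Linearity of `S⁽¹⁾(f)` is available on smooth sections only, so it is applied to the three
  -- smooth summands of the connection form.
  have e3 := hS.add ((s3.smul (1 / (2 * level k s))).add
    (s4.smul (-(1 / (2 * (starRingEnd ℂ) (level k s)))))) s5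
  rw [hS.add (s3.smul _) (s4.smul _), hS.smul _ s3, hS.smul _ s4, neg_smul, ← sub_eq_add_neg,
    neg_smul, ← sub_eq_add_neg, conj_level] at e3
  funext x
  have h2 : derivOp (fun τ => mulOp f + (1 / (s : ℂ)) • firstSolution B.conn Ω J F f τ) σ V ψ x
      = (1 / (s : ℂ)) • derivOp (firstSolution B.conn Ω J F f) σ V ψ x := by
    have h3 := derivOp_add_smul (D := fun _ : S => mulOp f)
      (D' := firstSolution B.conn Ω J F f) (1 / (s : ℂ)) (ψ := ψ) (x := x) (σ := σ)
      mdifferentiableAt_const (ContMDiffAt.mdifferentiableAt_fst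
        (smoothFamily_firstSolution B hJ hΩ hF hf ψ hψ σ x)) V
    have h4 : derivOp (fun _ : S => (mulOp f : Op L k)) σ V ψ x = 0 := by
      rw [derivOp, mvfderiv_const]
      exact zero_smul ℂ _
    rw [h3, h4, zero_add]
  have h3 := congrFun h1 x
  have h4 : derivOp (firstSolution B.conn Ω J F f) σ V ψ x
      = (Complex.I / 2) • (comm (bOp B.conn Ω J lam F σ V + bBarOp B.conn Ω J lam F σ V) (mulOp f)
        ψ x) - comm (dFOp F σ V) (firstSolution B.conn Ω J F f σ) ψ x :=
    eq_sub_of_add_eq h3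
  have h5 : hwDeriv (k := k) B.conn Ω J lam F s
        (fun τ => mulOp f + (1 / (s : ℂ)) • firstSolution B.conn Ω J F f τ) σ V ψ x
      = derivOp (fun τ => mulOp f + (1 / (s : ℂ)) • firstSolution B.conn Ω J F f τ) σ V ψ x
        + comm (hwForm B.conn Ω J lam F s σ V)
          (mulOp f + (1 / (s : ℂ)) • firstSolution B.conn Ω J F f σ) ψ x := rfl
  rw [h5, h2, h4]
  have ht := level_ne_zero hk s
  have htb := conj_level_ne_zero hk s
  have hs' : (s : ℂ) ≠ 0 := Complex.ofReal_ne_zero.2 hs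
  rw [conj_level]
  have e1x := congrFun e1 x
  have e2x := congrFun e2 x
  have e3x := congrFun e3 x
  have d1 : Complex.I * level k s = Complex.I * k - s := by
    rw [level, mul_add, ← mul_assoc, Complex.I_mul_I]
    ring
  have d2 : Complex.I * ((k : ℂ) - Complex.I * s) = Complex.I * k + s := by
    rw [mul_sub, ← mul_assoc, Complex.I_mul_I]
    ring
  -- `c1` and `c2` are the identities `it = ik - s` and `it̄ = ik + s` after division; they are the
  -- only facts about `t` that enter.
  have c1 : 1 / (s : ℂ) * (Complex.I / 2)
      = 1 / (2 * level k s * s) * (Complex.I * k) - 1 / (2 * level k s) := by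
    field_simp
    linear_combination d1
  have c2 : 1 / (s : ℂ) * (Complex.I / 2)
      = 1 / (2 * ((k : ℂ) - Complex.I * s) * s) * (Complex.I * k)
        + 1 / (2 * ((k : ℂ) - Complex.I * s)) := by
    generalize (k : ℂ) - Complex.I * s = r at htb d2 ⊢
    field_simp
    linear_combination d2
  simp only [comm, hwForm, conj_level, Pi.add_apply, Pi.sub_apply, Pi.smul_apply] at e1x e2x e3x ⊢
  rw [e1x, e2x, e3x]
  have m1 : ∀ φ : Sec L k, mulOp f φ x = f x • φ x := fun _ => rfl
  have m2 : ∀ φ : Sec L k, dFOp F σ V φ x = (paramDeriv F σ V x : ℂ) • φ x := fun _ => rfl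
  simp only [m1, m2, Pi.add_apply, Pi.sub_apply, Pi.smul_apply]
  generalize (k : ℂ) - Complex.I * s = r at c2 ⊢
  linear_combination (norm := module) c1 • (bOp B.conn Ω J lam F σ V (mulOp f ψ) x
      - f x • bOp B.conn Ω J lam F σ V ψ x)
    + c2 • (bBarOp B.conn Ω J lam F σ V (mulOp f ψ) x
      - f x • bBarOp B.conn Ω J lam F σ V ψ x)

theorem isLittleOInvLevel_firstSolution (hk : 0 < k) (σ : S) (V : TangentSpace 𝓘(ℝ, P) σ) :
    IsLittleOInvLevel E (fun s : ℝ => hwDeriv (k := k) B.conn Ω J lam F s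
      (fun τ => mulOp f + (1 / (s : ℂ)) • firstSolution B.conn Ω J F f τ) σ V) := by
  intro N hN
  refine N.isLittleO_level hk
    (u := onSmooth ((Complex.I * k : ℂ) • comm (bOp B.conn Ω J lam F σ V) (mulOp f)
      + comm (bOp B.conn Ω J lam F σ V) (firstSolution B.conn Ω J F f σ)))
    (v := onSmooth ((Complex.I * k : ℂ) • comm (bBarOp B.conn Ω J lam F σ V) (mulOp f)
      - comm (bBarOp B.conn Ω J lam F σ V) (firstSolution B.conn Ω J F f σ)))
    (fun s hs => funext fun ψ => ?_) hN
  exact hwDeriv_firstSolution B hJ hΩ hhol lam hF hf hk hs σ V ψ.2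

end FlatSection

end HitchinWitten

namespace HitchinWitten

open VectorField

/-! ### Naturality of connection, gradient and Laplacian under isometries. -/

section Naturality

variable {E : Type*} [NormedAddCommGroup E] [NormedSpace ℝ E]
  {M : Type*} [TopologicalSpace M] [ChartedSpace E M] [IsManifold 𝓘(ℝ, E) ∞ M]
  (φ : M ≃ₘ^(∞ : ℕ∞ω)⟮𝓘(ℝ, E), 𝓘(ℝ, E)⟯ M)

/-- The differential of a diffeomorphism. -/
def dmap (x : M) : TangentSpace 𝓘(ℝ, E) x →L[ℝ] TangentSpace 𝓘(ℝ, E) (φ x) :=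
  mfderiv 𝓘(ℝ, E) 𝓘(ℝ, E) φ x

/-- The pull-back of a vector field along a diffeomorphism. -/
def pull (X : VecField E M) : VecField E M := mpullback 𝓘(ℝ, E) 𝓘(ℝ, E) φ X

lemma dmap_isInvertible (x : M) : (dmap φ x).IsInvertible :=
  ⟨φ.mfderivToContinuousLinearEquiv (by simp) x, rfl⟩

lemma dmap_pull (X : VecField E M) (x : M) : dmap φ x (pull φ X x) = X (φ x) :=
  (dmap_isInvertible φ x).self_apply_inverse _

lemma pull_eq {X : VecField E M} {x : M} {u : TangentSpace 𝓘(ℝ, E) x}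
    (h : dmap φ x u = X (φ x)) : pull φ X x = u :=
  (dmap_isInvertible φ x).bijective.injective ((dmap_pull φ X x).trans h.symm)

lemma mdifferentiable_diffeo (x : M) : MDifferentiableAt 𝓘(ℝ, E) 𝓘(ℝ, E) φ x :=
  (φ.contMDiff x).mdifferentiableAt (by simp)

lemma diff_comp {f : M → ℝ} {x : M} (hf : MDifferentiableAt 𝓘(ℝ, E) 𝓘(ℝ, ℝ) f (φ x))
    (u : TangentSpace 𝓘(ℝ, E) x) : diff f (φ x) (dmap φ x u) = diff (fun y => f (φ y)) x u :=
  (mvfderiv_comp_apply x hf (mdifferentiable_diffeo φ x) u).symm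

variable [FiniteDimensional ℝ E]

lemma smoothVecAt_pull {X : VecField E M} {x : M} (hX : SmoothVecAt X (φ x)) :
    SmoothVecAt (pull φ X) x := by
  have := FiniteDimensional.complete ℝ E
  exact ContMDiffAt.mpullback_vectorField_preimage hX (φ.contMDiff x) (dmap_isInvertible φ x)
    (by norm_cast)

lemma diffVecAt_pull {X : VecField E M} {x : M} (hX : DiffVecAt X (φ x)) :
    DiffVecAt (pull φ X) x := by
  have := FiniteDimensional.complete ℝ E
  exact MDifferentiableAt.mpullback_vectorField hX (φ.contMDiff x) (dmap_isInvertible φ x)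
    (by norm_cast)

lemma dmap_mlieBracket {X Y : VecField E M} {x : M} (hX : DiffVecAt X (φ x))
    (hY : DiffVecAt Y (φ x)) :
    dmap φ x (mlieBracket 𝓘(ℝ, E) (pull φ X) (pull φ Y) x) = mlieBracket 𝓘(ℝ, E) X Y (φ x) := by
  have := FiniteDimensional.complete ℝ E
  have h := mpullback_mlieBracket (n := (∞ : ℕ∞ω)) hX hY (φ.contMDiff x)
    (by rw [minSmoothness_of_isRCLikeNormedField]; norm_cast)
  exact (congrArg (dmap φ x) h.symm).trans (dmap_pull φ _ x)

/-- A coframe at `φ x` for the push-forward of the coordinate frame at `x`. -/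
lemma exists_coframe_dmap (x : M) :
    ∃ θ : Fin (Module.finrank ℝ E) → TangentSpace 𝓘(ℝ, E) (φ x) →L[ℝ] ℝ,
      (∀ i u, θ i (dmap φ x u) = tcobasis x i u) ∧
      ∀ v, ∑ i, θ i v • dmap φ x (tbasis x i) = v := by
  obtain ⟨e, he⟩ := dmap_isInvertible φ x
  have he' : ∀ u, e u = dmap φ x u := fun u => congrArg (fun A => A u) he
  refine ⟨fun i => (tcobasis x i).comp (e.symm : TangentSpace 𝓘(ℝ, E) (φ x) →L[ℝ] _),
    fun i u => ?_, fun v => ?_⟩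
  · rw [← he']
    exact congrArg (tcobasis x i) (e.symm_apply_apply _)
  · have h2 := congrArg e (sum_tcobasis_smul x (e.symm v))
    rw [map_sum, e.apply_symm_apply] at h2
    refine Eq.trans (Finset.sum_congr rfl fun i _ => ?_) h2
    rw [map_smul, he']
    rfl

variable {φ} {g g' : BilinField E M}
  (hφ : ∀ x u v, g' (φ x) (dmap φ x u) (dmap φ x v) = g x u v)
include hφ

lemma bilin_pull (X Y : VecField E M) (x : M) :
    g x (pull φ X x) (pull φ Y x) = g' (φ x) (X (φ x)) (Y (φ x)) := by
  rw [← hφ, dmap_pull, dmap_pull]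

lemma dirDeriv_bilin_pull (hg' : IsMetric g') {X Y Z : VecField E M} {x : M}
    (hY : DiffVecAt Y (φ x)) (hZ : DiffVecAt Z (φ x)) :
    dirDeriv (pull φ X) (fun y => g y (pull φ Y y) (pull φ Z y)) x
      = dirDeriv X (fun y => g' y (Y y) (Z y)) (φ x) := by
  have h1 : (fun y => g y (pull φ Y y) (pull φ Z y)) = fun y => g' (φ y) (Y (φ y)) (Z (φ y)) :=
    funext fun y => bilin_pull hφ Y Z y
  have h2 := diff_comp φ (f := fun y => g' y (Y y) (Z y)) (hg'.mdiff hY hZ) (pull φ X x)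
  rw [dmap_pull] at h2
  rw [h1]
  exact h2.symm

/-- The Koszul expression is made of the metric, directional derivatives and brackets, all of them
natural; the Levi-Civita connection inherits this. -/
lemma koszul_pull (hg' : IsMetric g') {X Y Z : VecField E M} {x : M} (hX : DiffVecAt X (φ x))
    (hY : DiffVecAt Y (φ x)) (hZ : DiffVecAt Z (φ x)) :
    koszul g (pull φ X) (pull φ Y) (pull φ Z) x = koszul g' X Y Z (φ x) := by
  simp only [koszul]
  rw [dirDeriv_bilin_pull hφ hg' hY hZ, dirDeriv_bilin_pull hφ hg' hX hZ,
    dirDeriv_bilin_pull hφ hg' hX hY]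
  simp only [← hφ, dmap_mlieBracket φ hX hY, dmap_mlieBracket φ hX hZ,
    dmap_mlieBracket φ hY hZ, dmap_pull]

/-- The Levi-Civita connection is natural under isometries. -/
theorem dmap_leviCivita (hg : IsMetric g) (hg' : IsMetric g') {Y : VecField E M} {x : M}
    (hY : DiffVecAt Y (φ x)) (u : TangentSpace 𝓘(ℝ, E) x) :
    dmap φ x (leviCivita g (pull φ Y) x u) = leviCivita g' Y (φ x) (dmap φ x u) := by
  refine hg'.ext_smooth fun Z hZ => ?_
  let X : VecField E M := extendVec (dmap φ x u)
  have hX : SmoothVecAt X (φ x) := smoothVecAt_extendVec _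
  have hXx : X (φ x) = dmap φ x u := extendVec_self _
  have hu : pull φ X x = u := pull_eq φ hXx.symm
  have h1 := (isLeviCivita_leviCivita hg').eq_koszul hg' hX.diffVecAt hY hZ.diffVecAt
  have h2 := (isLeviCivita_leviCivita hg).eq_koszul hg (diffVecAt_pull φ hX.diffVecAt)
    (diffVecAt_pull φ hY) (diffVecAt_pull φ hZ.diffVecAt)
  rw [koszul_pull hφ hg' hX.diffVecAt hY hZ.diffVecAt, ← h1, hXx, hu, ← hφ, dmap_pull] at h2
  rw [hg'.symm, h2, hg'.symm]

/-- The two endomorphisms are conjugate by the differential, and the trace at `φ x` may be taken in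
the image of the basis at `x`. -/
lemma divg_pull (hg : IsMetric g) (hg' : IsMetric g') {Y : VecField E M} {x : M}
    (hY : DiffVecAt Y (φ x)) : divg g (pull φ Y) x = divg g' Y (φ x) := by
  obtain ⟨θ, h1, h2⟩ := exists_coframe_dmap φ x
  rw [divg_eq_contraction Y h2]
  refine Finset.sum_congr rfl fun i _ => ?_
  rw [← dmap_leviCivita hφ hg hg' hY, h1]

lemma grad_pull (hg : IsMetric g) (hg' : IsMetric g') {f : M → ℝ} {x : M}
    (hf : MDifferentiableAt 𝓘(ℝ, E) 𝓘(ℝ, ℝ) f (φ x)) :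
    dmap φ x (grad g (fun y => f (φ y)) x) = grad g' f (φ x) := by
  refine hg'.ext_smooth fun Z hZ => ?_
  have h1 : g' (φ x) (grad g' f (φ x)) (Z (φ x)) = diff f (φ x) (Z (φ x)) :=
    congrArg (fun A => A (Z (φ x))) (apply_invMetric g' (hg'.injective (φ x)) _)
  have h2 : g x (grad g (fun y => f (φ y)) x) (pull φ Z x) = diff (fun y => f (φ y)) x (pull φ Z x) :=
    congrArg (fun A => A (pull φ Z x)) (apply_invMetric g (hg.injective x) _)
  rw [← diff_comp φ hf, ← hφ, dmap_pull] at h2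
  rw [hg'.symm, h2, hg'.symm, h1]

lemma laplacian_pull (hg : IsMetric g) (hg' : IsMetric g') {f : M → ℝ}
    (hf : ContMDiff 𝓘(ℝ, E) 𝓘(ℝ, ℝ) ∞ f) (x : M) :
    laplacian g (fun y => f (φ y)) x = laplacian g' f (φ x) := by
  have h1 : grad g (fun y => f (φ y)) = pull φ (grad g' f) := funext fun y =>
    (pull_eq φ (grad_pull hφ hg hg' ((hf (φ y)).mdifferentiableAt (by simp)))).symm
  rw [laplacian_eq_divg, laplacian_eq_divg, h1,
    divg_pull hφ hg hg' (smoothVecAt_grad hg' (hf _)).diffVecAt]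

end Naturality

end HitchinWitten

namespace HitchinWitten

open VectorField

/-! ### Tensoriality and naturality of the curvature. -/

section Curvature

variable {E : Type*} [NormedAddCommGroup E] [NormedSpace ℝ E] [FiniteDimensional ℝ E]
  {M : Type*} [TopologicalSpace M] [ChartedSpace E M] [IsManifold 𝓘(ℝ, E) ∞ M]

lemma SmoothVecAt.mlieBracket {X Y : VecField E M} {x : M} (hX : SmoothVecAt X x)
    (hY : SmoothVecAt Y x) : SmoothVecAt (mlieBracket 𝓘(ℝ, E) X Y) x := by
  have := FiniteDimensional.complete ℝ E
  have : IsManifold 𝓘(ℝ, E) ((((⊤ : ℕ∞) : ℕ∞ω)) + 1) M := inferInstanceAs (IsManifold 𝓘(ℝ, E) ∞ M)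
  exact ContMDiffAt.mlieBracket_vectorField hX hY (by simp)

lemma SmoothVecAt.smul {f : M → ℝ} {X : VecField E M} {x : M}
    (hf : ContMDiffAt 𝓘(ℝ, E) 𝓘(ℝ, ℝ) ∞ f x) (hX : SmoothVecAt X x) : SmoothVecAt (f • X) x :=
  ContMDiffAt.smul_section hf hX

lemma mlieBracket_mlieBracket_smul {f : M → ℝ} {X Y W : VecField E M} {x : M}
    (hf : ContMDiffAt 𝓘(ℝ, E) 𝓘(ℝ, ℝ) ∞ f x) (hY : SmoothVecAt Y x) (hW : SmoothVecAt W x) :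
    mlieBracket 𝓘(ℝ, E) X (mlieBracket 𝓘(ℝ, E) Y (f • W)) x
      = f x • mlieBracket 𝓘(ℝ, E) X (mlieBracket 𝓘(ℝ, E) Y W) x
        + diff f x (X x) • mlieBracket 𝓘(ℝ, E) Y W x
        + diff f x (Y x) • mlieBracket 𝓘(ℝ, E) X W x
        + diff (fun y => diff f y (Y y)) x (X x) • W x := by
  have := FiniteDimensional.complete ℝ E
  have hk : ContMDiffAt 𝓘(ℝ, E) 𝓘(ℝ, ℝ) ∞ (fun y => diff f y (Y y)) x := contMDiffAt_mvfderiv hY hf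
  have hd := hf.mdifferentiableAt (by simp)
  have hkd := hk.mdifferentiableAt (by simp)
  have h1 : mlieBracket 𝓘(ℝ, E) Y (f • W) =ᶠ[nhds x]
      (fun y => diff f y (Y y)) • W + f • mlieBracket 𝓘(ℝ, E) Y W := by
    filter_upwards [eventually_mdifferentiableAt hf, hW.eventually_diffVecAt] with y h1 h2
    exact mlieBracket_smul_right h1 h2
  have h2 := (hY.mlieBracket hW).diffVecAt
  rw [Filter.EventuallyEq.rfl.mlieBracket_vectorField_eq h1,
    mlieBracket_add_right (diffVecAt_smul hkd hW.diffVecAt) (diffVecAt_smul hd h2),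
    mlieBracket_smul_right hkd hW.diffVecAt, mlieBracket_smul_right hd h2]
  change diff (fun y => diff f y (Y y)) x (X x) • W x + diff f x (Y x) • mlieBracket 𝓘(ℝ, E) X W x
    + (diff f x (X x) • mlieBracket 𝓘(ℝ, E) Y W x
      + f x • mlieBracket 𝓘(ℝ, E) X (mlieBracket 𝓘(ℝ, E) Y W) x) = _
  abel

/-- The Lie bracket is the commutator of derivations. -/
theorem diff_diff_sub {f : M → ℝ} {X Y : VecField E M} {x : M}
    (hf : ContMDiffAt 𝓘(ℝ, E) 𝓘(ℝ, ℝ) ∞ f x) (hX : SmoothVecAt X x) (hY : SmoothVecAt Y x) :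
    diff (fun y => diff f y (Y y)) x (X x) - diff (fun y => diff f y (X y)) x (Y x)
      = diff f x (mlieBracket 𝓘(ℝ, E) X Y x) := by
  have := FiniteDimensional.complete ℝ E
  have hjac : ∀ W : VecField E M, SmoothVecAt W x →
      mlieBracket 𝓘(ℝ, E) X (mlieBracket 𝓘(ℝ, E) Y W) x
      = mlieBracket 𝓘(ℝ, E) (mlieBracket 𝓘(ℝ, E) X Y) W x
        + mlieBracket 𝓘(ℝ, E) Y (mlieBracket 𝓘(ℝ, E) X W) x := fun W hW => by
    have h2 : minSmoothness ℝ 2 ≤ (∞ : ℕ∞ω) := by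
      rw [minSmoothness_of_isRCLikeNormedField]; norm_cast
    exact leibniz_identity_mlieBracket_apply (ContMDiffAt.of_le hX h2) (ContMDiffAt.of_le hY h2)
      (ContMDiffAt.of_le hW h2)
  -- Subtract `f` times the Jacobi identity for `W` from the one for `f•W`. The mixed first order
  -- terms cancel and the difference of the two sides, times `W`, remains.
  have key : ∀ w : TangentSpace 𝓘(ℝ, E) x,
      (diff (fun y => diff f y (Y y)) x (X x) - diff (fun y => diff f y (X y)) x (Y x)
        - diff f x (mlieBracket 𝓘(ℝ, E) X Y x)) • w = 0 := fun w => by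
    have hW := smoothVecAt_extendVec w
    have h1 := hjac (extendVec w) hW
    have h2 := hjac (f • extendVec w) (SmoothVecAt.smul hf hW)
    rw [mlieBracket_mlieBracket_smul hf hY hW, mlieBracket_mlieBracket_smul hf hX hW,
      mlieBracket_smul_right (hf.mdifferentiableAt (by simp)) hW.diffVecAt, h1] at h2
    change _ = diff f x (mlieBracket 𝓘(ℝ, E) X Y x) • _ + _ + _ at h2
    rw [extendVec_self] at h2
    linear_combination (norm := module) h2
  by_cases hw : ∃ w : TangentSpace 𝓘(ℝ, E) x, w ≠ 0
  · obtain ⟨w, hw⟩ := hw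
    exact sub_eq_zero.1 ((smul_eq_zero.1 (key w)).resolve_right hw)
  -- If the tangent space is zero there is no `w` to divide by, but then every term vanishes.
  · push Not at hw
    rw [hw (X x), hw (Y x), hw (VectorField.mlieBracket 𝓘(ℝ, E) X Y x), map_zero, map_zero, map_zero,
      sub_zero]

variable {g : BilinField E M}

/-- The second covariant derivative of `A` depends on the direction field `W` only through its value
at `x`: the derivatives of the components of `W` occur once in each term and cancel. -/
lemma leviCivita_leviCivita_eq (hg : IsMetric g) {W : VecField E M} {x : M}
    {s : Fin (Module.finrank ℝ E) → VecField E M}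
    {θ : Fin (Module.finrank ℝ E) → OneForm E M} (h : IsDualFrame s θ x)
    {A : VecField E M} (hA : SmoothVecAt A x) (hW : SmoothVecAt W x) (u : TangentSpace 𝓘(ℝ, E) x) :
    leviCivita g (fun y => leviCivita g A y (W y)) x u - leviCivita g A x (leviCivita g W x u)
      = ∑ i, θ i x (W x) • (leviCivita g (fun y => leviCivita g A y (s i y)) x u
          - leviCivita g A x (leviCivita g (s i) x u)) := by
  have hD := isLeviCivita_leviCivita hg
  have hd : ∀ i, MDifferentiableAt 𝓘(ℝ, E) 𝓘(ℝ, ℝ) (fun y => θ i y (W y)) x := fun i =>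
    (h.smooth_form i W hW).mdifferentiableAt (by simp)
  have hs : ∀ i, DiffVecAt (fun y => leviCivita g A y (s i y)) x := fun i =>
    (hD.smooth hg (h.smooth i) hA).diffVecAt
  obtain ⟨h1, h2⟩ := leviCivita_sum_smul hg Finset.univ hd (fun i => (h.smooth i).diffVecAt) u
  have h3 : leviCivita g W x u = _ :=
    (congrArg (fun A => A u) (hD.congr hW.diffVecAt h1 (h.eventually_eq W))).trans h2
  obtain ⟨h5, h6⟩ := leviCivita_sum_smul hg Finset.univ hd hs u
  have h4 : ∀ᶠ y in nhds x, leviCivita g A y (W y)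
      = (∑ i, (fun z => θ i z (W z)) • (fun y => leviCivita g A y (s i y))) y :=
    h.complete.mono fun y hy => by
      rw [Finset.sum_apply]
      conv_lhs => rw [← hy (W y), map_sum]
      exact Finset.sum_congr rfl fun i _ => map_smul _ _ _
  have h7 := (congrArg (fun A => A u) (hD.congr (hD.smooth hg hW hA).diffVecAt h5 h4)).trans h6
  rw [h7, h3, map_sum, ← Finset.sum_sub_distrib]
  refine Finset.sum_congr rfl fun i _ => ?_
  rw [map_add, map_smul, map_smul, smul_sub]
  abel

/-- The curvature operator on vector fields. -/
def curvField (g : BilinField E M) (X Y W : VecField E M) (x : M) : TangentSpace 𝓘(ℝ, E) x :=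
  leviCivita g (fun y => leviCivita g W y (Y y)) x (X x)
    - leviCivita g (fun y => leviCivita g W y (X y)) x (Y x)
    - leviCivita g W x (mlieBracket 𝓘(ℝ, E) X Y x)

/-- Vanishing torsion writes the curvature as the antisymmetrised second covariant derivative of
`W`, which sees `X` and `Y` only at `x`. -/
lemma curvField_eq (hg : IsMetric g) {X Y W : VecField E M} {x : M}
    (hX : SmoothVecAt X x) (hY : SmoothVecAt Y x) (hW : SmoothVecAt W x) :
    curvField g X Y W x = ∑ i, vecCoframe x i x (Y x) •
        (leviCivita g (fun y => leviCivita g W y (vecFrame x i y)) x (X x)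
          - leviCivita g W x (leviCivita g (vecFrame x i) x (X x)))
      - ∑ i, vecCoframe x i x (X x) •
        (leviCivita g (fun y => leviCivita g W y (vecFrame x i y)) x (Y x)
          - leviCivita g W x (leviCivita g (vecFrame x i) x (Y x))) := by
  have hD := isLeviCivita_leviCivita hg
  have h := isDualFrame_vecFrame (E := E) (mem_baseSet (E := E) x)
  rw [← leviCivita_leviCivita_eq hg h hW hY, ← leviCivita_leviCivita_eq hg h hW hX, curvField,
    ← hD.torsion_free X Y x hX.diffVecAt hY.diffVecAt, map_sub]
  abel

lemma curvField_eq_sum (hg : IsMetric g) {X Y W : VecField E M} {x : M}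
    {s : Fin (Module.finrank ℝ E) → VecField E M}
    {θ : Fin (Module.finrank ℝ E) → OneForm E M} (h : IsDualFrame s θ x)
    (hX : SmoothVecAt X x) (hY : SmoothVecAt Y x) (hW : SmoothVecAt W x) :
    curvField g X Y W x = ∑ i, θ i x (W x) • curvField g X Y (s i) x := by
  have hD := isLeviCivita_leviCivita hg
  have hf : ∀ i, ContMDiffAt 𝓘(ℝ, E) 𝓘(ℝ, ℝ) ∞ (fun y => θ i y (W y)) x := fun i =>
    h.smooth_form i W hW
  have hd := fun i => (hf i).mdifferentiableAt (n := ∞) (by simp)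
  have first : ∀ᶠ y in nhds x, ∀ u, leviCivita g W y u = ∑ i, (θ i y (W y) • leviCivita g (s i) y u
      + diff (fun z => θ i z (W z)) y u • s i y) := by
    filter_upwards [h.complete.eventually_nhds, hW.eventually_diffVecAt,
      eventually_all.2 fun i => eventually_mdifferentiableAt (hf i),
      eventually_all.2 fun i => (h.smooth i).eventually_diffVecAt] with y h1 h2 h3 h4 u
    obtain ⟨h5, h6⟩ := leviCivita_sum_smul hg Finset.univ h3 h4 u
    refine (congrArg (fun A => A u) (hD.congr h2 h5 (h1.mono fun z hz => ?_))).trans h6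
    rw [Finset.sum_apply]
    exact (hz (W z)).symm
  have second : ∀ {Y : VecField E M}, SmoothVecAt Y x → ∀ u,
      leviCivita g (fun y => leviCivita g W y (Y y)) x u
        = ∑ i, (θ i x (W x) • leviCivita g (fun y => leviCivita g (s i) y (Y y)) x u
            + diff (fun z => θ i z (W z)) x u • leviCivita g (s i) x (Y x))
          + ∑ i, (diff (fun z => θ i z (W z)) x (Y x) • leviCivita g (s i) x u
            + diff (fun y => diff (fun z => θ i z (W z)) y (Y y)) x u • s i x) := fun {Y} hY u => by
    have hk : ∀ i, ContMDiffAt 𝓘(ℝ, E) 𝓘(ℝ, ℝ) ∞ (fun y => diff (fun z => θ i z (W z)) y (Y y)) x :=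
      fun i => contMDiffAt_mvfderiv hY (hf i)
    obtain ⟨h1, h2⟩ := leviCivita_sum_smul hg Finset.univ hd
      (fun i => (hD.smooth hg hY (h.smooth i)).diffVecAt) u
    obtain ⟨h3, h4⟩ := leviCivita_sum_smul hg Finset.univ
      (fun i => (hk i).mdifferentiableAt (by simp)) (fun i => (h.smooth i).diffVecAt) u
    have h5 := hD.congr (hD.smooth hg hY hW).diffVecAt (diffVecAt_add h1 h3) (by
      filter_upwards [first] with y hy
      rw [hy, Finset.sum_add_distrib, Pi.add_apply, Finset.sum_apply, Finset.sum_apply]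
      rfl)
    rw [h5, hD.add h1 h3, _root_.add_apply, h2, h4]
  rw [curvField, second hY, second hX, first.self_of_nhds, ← Finset.sum_add_distrib,
    ← Finset.sum_add_distrib, ← Finset.sum_sub_distrib, ← Finset.sum_sub_distrib]
  refine Finset.sum_congr rfl fun i _ => ?_
  -- The second derivatives of the coefficients of `W` combine to the derivative along `[X, Y]`,
  -- which the bracket term of the curvature removes.
  rw [← diff_diff_sub (hf i) hX hY, curvField]
  module

lemma curvature_eq_curvField_extendVec (x : M) (u v w : TangentSpace 𝓘(ℝ, E) x) :
    curvature g x u v w = curvField g (extendVec u) (extendVec v) (extendVec w) x := by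
  rw [curvField, extendVec_self, extendVec_self]
  rfl

/-- The curvature is a tensor. -/
theorem curvature_eq_curvField (hg : IsMetric g) {X Y W : VecField E M} {x : M}
    (hX : SmoothVecAt X x) (hY : SmoothVecAt Y x) (hW : SmoothVecAt W x) :
    curvature g x (X x) (Y x) (W x) = curvField g X Y W x := by
  have h := isDualFrame_vecFrame (E := E) (mem_baseSet (E := E) x)
  have eW := smoothVecAt_extendVec (W x)
  have h1 : curvField g (extendVec (X x)) (extendVec (Y x)) (extendVec (W x)) x
      = curvField g X Y (extendVec (W x)) x := by
    rw [curvField_eq hg (smoothVecAt_extendVec _) (smoothVecAt_extendVec _) eW,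
      curvField_eq hg hX hY eW, extendVec_self, extendVec_self]
  rw [curvature_eq_curvField_extendVec, h1, curvField_eq_sum hg h hX hY eW,
    curvField_eq_sum hg h hX hY hW, extendVec_self]

lemma ricci_eq_contraction (hg : IsMetric g) {x : M} {ι : Type*} [Fintype ι]
    {s : ι → TangentSpace 𝓘(ℝ, E) x} {θ : ι → TangentSpace 𝓘(ℝ, E) x →L[ℝ] ℝ}
    (h : ∀ v, ∑ i, θ i v • s i = v) (v w : TangentSpace 𝓘(ℝ, E) x) :
    ricci g x v w = ∑ i, θ i (curvature g x (s i) v w) := by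
  have key := fun u => (curvature_eq_curvField_extendVec (g := g) x u v w).trans
    (curvField_eq hg (smoothVecAt_extendVec u) (smoothVecAt_extendVec v) (smoothVecAt_extendVec w))
  have hadd : ∀ u u', curvature g x (u + u') v w = curvature g x u v w + curvature g x u' v w := by
    intro u u'
    rw [key, key, key]
    simp only [extendVec_self, map_add, add_smul, smul_sub, smul_add, Finset.sum_add_distrib,
      Finset.sum_sub_distrib]
    abel
  have hsmul : ∀ (c : ℝ) u, curvature g x (c • u) v w = c • curvature g x u v w := by
    intro c u
    rw [key, key]
    simp only [extendVec_self, map_smul, smul_sub, Finset.smul_sum, smul_smul, smul_eq_mul,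
      mul_comm c]
  exact contraction_eq (fun u α => α (curvature g x u v w))
    (fun u u' α => by rw [hadd, map_add]) (fun c u α => by rw [hsmul, map_smul])
    (fun u α α' => rfl) (fun c u α => rfl) h

variable {φ : M ≃ₘ^(∞ : ℕ∞ω)⟮𝓘(ℝ, E), 𝓘(ℝ, E)⟯ M} {g' : BilinField E M}
  (hφ : ∀ x u v, g' (φ x) (dmap φ x u) (dmap φ x v) = g x u v)
include hφ

lemma dmap_leviCivita_leviCivita (hg : IsMetric g) (hg' : IsMetric g') {Y W : VecField E M} {x : M}
    (hY : SmoothVecAt Y (φ x)) (hW : SmoothVecAt W (φ x)) (u : TangentSpace 𝓘(ℝ, E) x) :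
    dmap φ x (leviCivita g (fun y => leviCivita g (pull φ W) y (pull φ Y y)) x u)
      = leviCivita g' (fun y => leviCivita g' W y (Y y)) (φ x) (dmap φ x u) := by
  have hD := isLeviCivita_leviCivita hg
  have h1 := (isLeviCivita_leviCivita hg').smooth hg' hY hW
  have h2 : ∀ᶠ y in nhds x, leviCivita g (pull φ W) y (pull φ Y y)
      = pull φ (fun z => leviCivita g' W z (Y z)) y := by
    filter_upwards [φ.continuous.continuousAt.eventually hW.eventually_diffVecAt] with y hy
    exact (pull_eq φ (by rw [dmap_leviCivita hφ hg hg' hy, dmap_pull])).symm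
  rw [hD.congr (hD.smooth hg (smoothVecAt_pull φ hY) (smoothVecAt_pull φ hW)).diffVecAt
    (diffVecAt_pull φ h1.diffVecAt) h2, dmap_leviCivita hφ hg hg' h1.diffVecAt]

/-- The curvature is natural under isometries. -/
theorem dmap_curvature (hg : IsMetric g) (hg' : IsMetric g') (x : M)
    (u v w : TangentSpace 𝓘(ℝ, E) x) :
    dmap φ x (curvature g x u v w) = curvature g' (φ x) (dmap φ x u) (dmap φ x v) (dmap φ x w) := by
  have hX := smoothVecAt_extendVec (dmap φ x u)
  have hY := smoothVecAt_extendVec (dmap φ x v)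
  have hW := smoothVecAt_extendVec (dmap φ x w)
  -- Pulling back the chosen extension at `φ x` gives some smooth extension at `x`, in general not
  -- the chosen one; tensoriality makes this harmless.
  have e : ∀ a : TangentSpace 𝓘(ℝ, E) x, pull φ (extendVec (dmap φ x a)) x = a := fun a =>
    pull_eq φ (extendVec_self _).symm
  have h1 := curvature_eq_curvField hg (smoothVecAt_pull φ hX) (smoothVecAt_pull φ hY)
    (smoothVecAt_pull φ hW)
  rw [e, e, e] at h1
  rw [h1, curvature_eq_curvField_extendVec, curvField, map_sub, map_sub,
    dmap_leviCivita_leviCivita hφ hg hg' hY hW, dmap_leviCivita_leviCivita hφ hg hg' hX hW,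
    dmap_leviCivita hφ hg hg' hW.diffVecAt, dmap_mlieBracket φ hX.diffVecAt hY.diffVecAt,
    dmap_pull, dmap_pull]
  rfl

lemma ricci_dmap (hg : IsMetric g) (hg' : IsMetric g') (x : M) (v w : TangentSpace 𝓘(ℝ, E) x) :
    ricci g' (φ x) (dmap φ x v) (dmap φ x w) = ricci g x v w := by
  obtain ⟨θ, h1, h2⟩ := exists_coframe_dmap φ x
  rw [ricci_eq_contraction hg' h2]
  refine Finset.sum_congr rfl fun i _ => ?_
  rw [← dmap_curvature hφ hg hg', h1]

end Curvature

end HitchinWitten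

namespace HitchinWitten

open VectorField

/-! ### Naturality of the differential of the Ricci potential. -/

section Potential

variable {E : Type*} [NormedAddCommGroup E] [NormedSpace ℝ E] [FiniteDimensional ℝ E]
  {M : Type*} [TopologicalSpace M] [ChartedSpace E M] [IsManifold 𝓘(ℝ, E) ∞ M]

omit [FiniteDimensional ℝ E] in
/-- A smooth vector field is related to a smooth vector field by a given diffeomorphism. -/
lemma exists_dmap_related (φ : M ≃ₘ^(∞ : ℕ∞ω)⟮𝓘(ℝ, E), 𝓘(ℝ, E)⟯ M) {X : VecField E M}
    (hX : SmoothVec X) :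
    ∃ X' : VecField E M, SmoothVec X' ∧ ∀ x, dmap φ x (X x) = X' (φ x) := by
  have : IsManifold 𝓘(ℝ, E) 1 M := IsManifold.of_le (n := (∞ : ℕ∞ω)) (by norm_cast)
  let a : M → E := fun x => (dmap φ x (X x) : E)
  let X' : VecField E M := fun y => (a (φ.symm y) : E)
  refine ⟨X', ?_, fun x => ?_⟩
  -- The push-forward is the tangent map of `φ` after `X` after the inverse. Its base point is `φ
  -- (φ.symm y)`, which equals `y` only propositionally.
  · have h1 : ContMDiff 𝓘(ℝ, E) (𝓘(ℝ, E).prod 𝓘(ℝ, E)) ∞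
        (fun y => tangentMap 𝓘(ℝ, E) 𝓘(ℝ, E) φ
          (TotalSpace.mk' E (E := fun x : M => TangentSpace 𝓘(ℝ, E) x) (φ.symm y) (X (φ.symm y)))) :=
      (φ.contMDiff.contMDiff_tangentMap (m := ∞) (by norm_cast)).comp (hX.comp φ.symm.contMDiff)
    refine h1.congr fun y => ?_
    exact congrArg (fun z : M => TotalSpace.mk' E (E := fun x : M => TangentSpace 𝓘(ℝ, E) x) z
      (a (φ.symm y) : E)) (φ.apply_symm_apply y).symm
  · exact congrArg a (φ.symm_apply_apply x).symm

lemma smoothOneForm_of_pairing {α : OneForm E M} (h : ∀ x, SmoothFormAt (E := E) α x) :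
    SmoothOneForm α := by
  intro x
  refine (contMDiffAt_hom_bundle (E₁ := fun x : M => TangentSpace 𝓘(ℝ, E) x)
    (E₂ := Bundle.Trivial M ℝ) _).2 ⟨contMDiffAt_id, ?_⟩
  refine contMDiffAt_clm_of_apply fun e => ?_
  refine (h x _ (smoothVecAt_constVec x e (mem_baseSet (E := E) x))).congr_of_eventuallyEq
    (Eventually.of_forall fun y => ?_)
  simp [ContinuousLinearMap.inCoordinates, constVec]

section Pullback

variable {φ : M ≃ₘ^(∞ : ℕ∞ω)⟮𝓘(ℝ, E), 𝓘(ℝ, E)⟯ M} {J J' : EndField E M}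
  (hφJ : ∀ x u, J' (φ x) (dmap φ x u) = dmap φ x (J x u))
include hφJ

/-- The operator `2i∂∂̄` is natural under holomorphic diffeomorphisms. -/
lemma ddbar_comp (hs : ∀ {Y : VecField E M} {x : M}, SmoothVecAt Y x →
      SmoothVecAt (fun y => J' y (Y y)) x)
    {f : M → ℝ} (hf : ContMDiff 𝓘(ℝ, E) 𝓘(ℝ, ℝ) ∞ f) {X Y X' Y' : VecField E M}
    (hX' : SmoothVec X') (hY' : SmoothVec Y') (eX : ∀ x, dmap φ x (X x) = X' (φ x))
    (eY : ∀ x, dmap φ x (Y x) = Y' (φ x)) (x : M) :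
    ddbar J (fun y => f (φ y)) X Y x = ddbar J' f X' Y' (φ x) := by
  have pX : pull φ X' = X := funext fun y => pull_eq φ (eX y)
  have pY : pull φ Y' = Y := funext fun y => pull_eq φ (eY y)
  have hd : ∀ y, MDifferentiableAt 𝓘(ℝ, E) 𝓘(ℝ, ℝ) f y := fun y => (hf y).mdifferentiableAt (by simp)
  have e1 : ∀ (y : M) (u : TangentSpace 𝓘(ℝ, E) y),
      diff (fun y => f (φ y)) y (J y u) = diff f (φ y) (J' (φ y) (dmap φ y u)) := fun y u => by
    rw [hφJ, diff_comp φ (hd _)]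
  have e2 : ∀ {Z Z' W W' : VecField E M}, SmoothVec W' → (∀ x, dmap φ x (Z x) = Z' (φ x)) →
      (∀ x, dmap φ x (W x) = W' (φ x)) →
      dirDeriv Z (fun y => diff (fun y => f (φ y)) y (J y (W y))) x
        = dirDeriv Z' (fun y => diff f y (J' y (W' y))) (φ x) := by
    intro Z Z' W W' hW' eZ eW
    have h1 : (fun y => diff (fun y => f (φ y)) y (J y (W y)))
        = fun y => (fun z => diff f z (J' z (W' z))) (φ y) :=
      funext fun y => by rw [e1, eW]
    have h2 : MDifferentiableAt 𝓘(ℝ, E) 𝓘(ℝ, ℝ) (fun z => diff f z (J' z (W' z))) (φ x) :=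
      (contMDiffAt_mvfderiv (hs (hW' (φ x))) (hf _)).mdifferentiableAt (by simp)
    have h3 := diff_comp φ h2 (Z x)
    rw [eZ] at h3
    rw [h1]
    exact h3.symm
  have e3 : dmap φ x (mlieBracket 𝓘(ℝ, E) X Y x) = mlieBracket 𝓘(ℝ, E) X' Y' (φ x) := by
    have := dmap_mlieBracket φ (x := x) (hX'.smoothVecAt _).diffVecAt (hY'.smoothVecAt _).diffVecAt
    rwa [pX, pY] at this
  simp only [ddbar, extDeriv₁, ContinuousLinearMap.comp_apply]
  rw [e2 hY' eX eY, e2 hX' eY eX, e1, e3]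

end Pullback

lemma ddbar_sub {J : EndField E M} (hs : ∀ {Y : VecField E M} {x : M}, SmoothVecAt Y x →
      SmoothVecAt (fun y => J y (Y y)) x)
    {f h : M → ℝ} (hf : ContMDiff 𝓘(ℝ, E) 𝓘(ℝ, ℝ) ∞ f) (hh : ContMDiff 𝓘(ℝ, E) 𝓘(ℝ, ℝ) ∞ h)
    {X Y : VecField E M} (hX : SmoothVec X) (hY : SmoothVec Y) (x : M) :
    ddbar J (fun y => f y - h y) X Y x = ddbar J f X Y x - ddbar J h X Y x := by
  have sub : ∀ {a b : M → ℝ} {y : M} (u : TangentSpace 𝓘(ℝ, E) y),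
      MDifferentiableAt 𝓘(ℝ, E) 𝓘(ℝ, ℝ) a y → MDifferentiableAt 𝓘(ℝ, E) 𝓘(ℝ, ℝ) b y →
      diff (fun z => a z - b z) y u = diff a y u - diff b y u := fun u ha hb =>
    DFunLike.congr_fun (mvfderiv_sub ha hb) u
  have e1 : ∀ (y : M) (u : TangentSpace 𝓘(ℝ, E) y),
      diff (fun y => f y - h y) y u = diff f y u - diff h y u := fun y u =>
    sub u ((hf y).mdifferentiableAt (by simp)) ((hh y).mdifferentiableAt (by simp))
  have m : ∀ {a : M → ℝ} {Y : VecField E M}, ContMDiff 𝓘(ℝ, E) 𝓘(ℝ, ℝ) ∞ a → SmoothVec Y →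
      MDifferentiableAt 𝓘(ℝ, E) 𝓘(ℝ, ℝ) (fun z => diff a z (J z (Y z))) x := fun ha hY =>
    (contMDiffAt_mvfderiv (hs (hY x)) (ha x)).mdifferentiableAt (by simp)
  simp only [ddbar, extDeriv₁, ContinuousLinearMap.comp_apply, dirDeriv, e1]
  rw [sub _ (m hf hY) (m hh hY), sub _ (m hf hX) (m hh hX)]
  ring

variable [T2Space M]

/-- If `H¹(M, ℝ) = 0` and there are no non-constant holomorphic functions, pluriharmonic functions
are constant. -/
theorem diff_eq_zero_of_ddbar {J : EndField E M} (hH1 : TrivialH1 E M) (hfun : OnlyConstHolFun J)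
    (hsq : ∀ x u, J x (J x u) = -u)
    (hs : ∀ {Y : VecField E M} {x : M}, SmoothVecAt Y x → SmoothVecAt (fun y => J y (Y y)) x)
    {h : M → ℝ} (hh : ContMDiff 𝓘(ℝ, E) 𝓘(ℝ, ℝ) ∞ h)
    (h0 : ∀ X Y, SmoothVec X → SmoothVec Y → ∀ x, ddbar J h X Y x = 0) (x : M)
    (u : TangentSpace 𝓘(ℝ, E) x) : diff h x u = 0 := by
  -- Up to sign, `2i∂∂̄h` is the exterior derivative of `dh ∘ J`. This form is therefore closed,
  -- hence `dv` for some `v`.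
  obtain ⟨v, hv, e⟩ := hH1 (fun y => (diff h y).comp (J y))
    (smoothOneForm_of_pairing fun y Z hZ => contMDiffAt_mvfderiv (hs hZ) (hh y))
    fun X Y hX hY y => neg_eq_zero.1 (h0 X Y hX hY y)
  have hd : ∀ y u, diff v y u = diff h y (J y u) := fun y u =>
    (congrArg (fun α : OneForm E M => α y u) e).symm
  have mh : ∀ y, MDifferentiableAt 𝓘(ℝ, E) 𝓘(ℝ, ℝ) h y := fun y => (hh y).mdifferentiableAt (by simp)
  have mv : ∀ y, MDifferentiableAt 𝓘(ℝ, E) 𝓘(ℝ, ℝ) v y := fun y => (hv y).mdifferentiableAt (by simp)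
  have key : ∀ y (u : TangentSpace 𝓘(ℝ, E) y),
      mvfderiv 𝓘(ℝ, E) (fun z => (h z : ℂ) + -Complex.I * (v z : ℂ)) y u
        = diff h y u + -Complex.I * diff v y u := fun y u => by
    have hI := mvfderiv_clm_comp (ContinuousLinearMap.mul ℝ ℂ (-Complex.I))
      (mdifferentiableAt_ofReal (mv y)) u
    refine (mvfderiv_add_apply (mdifferentiableAt_ofReal (mh y))
      (mdifferentiableAt_clm_comp (ContinuousLinearMap.mul ℝ ℂ (-Complex.I))
        (mdifferentiableAt_ofReal (mv y))) u).trans ?_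
    rw [mvfderiv_ofReal (mh y)]
    exact congrArg _ (hI.trans (congrArg _ (mvfderiv_ofReal (mv y) u)))
  -- With `dv = dh ∘ J` the function `h - iv` satisfies the Cauchy-Riemann equations.
  obtain ⟨c, hc⟩ := hfun (fun z => (h z : ℂ) + -Complex.I * (v z : ℂ))
    ((contMDiff_ofReal hh).add (contMDiff_mul_complex contMDiff_const (contMDiff_ofReal hv)))
    fun y u => by
      rw [key, key, hd, hd, hsq, map_neg]
      push_cast
      linear_combination (diff h y (J y u) : ℂ) * Complex.I_sq
  have h1 : h = fun _ => c.re := funext fun y => by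
    have := congrArg Complex.re (hc y)
    simpa using this
  rw [h1]
  exact DFunLike.congr_fun (mvfderiv_const c.re) u

variable {φ : M ≃ₘ^(∞ : ℕ∞ω)⟮𝓘(ℝ, E), 𝓘(ℝ, E)⟯ M} {J J' : EndField E M} {Ω : BilinField E M}
  (hφJ : ∀ x u, J' (φ x) (dmap φ x u) = dmap φ x (J x u))
  (hφΩ : ∀ x u v, Ω (φ x) (dmap φ x u) (dmap φ x v) = Ω x u v)
include hφJ hφΩ

omit [FiniteDimensional ℝ E] [T2Space M] in
lemma kahlerMetric_dmap (x : M) (u v : TangentSpace 𝓘(ℝ, E) x) :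
    kahlerMetric Ω J' (φ x) (dmap φ x u) (dmap φ x v) = kahlerMetric Ω J x u v :=
  (congrArg (Ω (φ x) (dmap φ x u)) (hφJ x v)).trans (hφΩ x u _)

/-- The differential of the Ricci potential is natural. -/
theorem diff_potential_dmap (hH1 : TrivialH1 E M) (hfun : OnlyConstHolFun J)
    (hJ : IsCompatible Ω J) (hJ' : IsCompatible Ω J') {F F' : M → ℝ} {lam : ℝ}
    (hF : ContMDiff 𝓘(ℝ, E) 𝓘(ℝ, ℝ) ∞ F) (hF' : ContMDiff 𝓘(ℝ, E) 𝓘(ℝ, ℝ) ∞ F')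
    (eF : ∀ X Y, SmoothVec X → SmoothVec Y → ∀ x, ddbar J F X Y x
      = ricci (kahlerMetric Ω J) x (J x (X x)) (Y x) - lam * Ω x (X x) (Y x))
    (eF' : ∀ X Y, SmoothVec X → SmoothVec Y → ∀ x, ddbar J' F' X Y x
      = ricci (kahlerMetric Ω J') x (J' x (X x)) (Y x) - lam * Ω x (X x) (Y x))
    (x : M) (u : TangentSpace 𝓘(ℝ, E) x) : diff F' (φ x) (dmap φ x u) = diff F x u := by
  have hc : ContMDiff 𝓘(ℝ, E) 𝓘(ℝ, ℝ) ∞ (fun y => F' (φ y)) := hF'.comp φ.contMDiff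
  -- Both potentials have the same right-hand side after transport, since `φ` preserves `Ω`, the
  -- complex structures and the Ricci tensors; so their difference is pluriharmonic.
  have h0 := diff_eq_zero_of_ddbar (h := fun y => F' (φ y) - F y) hH1 hfun hJ.sq hJ.smooth
    (hc.sub hF) (fun X Y hX hY y => by
      obtain ⟨X', hX', eX⟩ := exists_dmap_related φ hX
      obtain ⟨Y', hY', eY⟩ := exists_dmap_related φ hY
      rw [ddbar_sub hJ.smooth hc hF hX hY, ddbar_comp hφJ hJ'.smooth hF' hX' hY' eX eY,
        eF X Y hX hY, eF' X' Y' hX' hY', ← eX, ← eY, hφJ, hφΩ,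
        ricci_dmap (kahlerMetric_dmap hφJ hφΩ) hJ.isMetric hJ'.isMetric, sub_self]) x u
  have h1 : diff (fun y => F' (φ y) - F y) x u = diff (fun y => F' (φ y)) x u - diff F x u :=
    DFunLike.congr_fun (mvfderiv_sub ((hc x).mdifferentiableAt (by simp))
      ((hF x).mdifferentiableAt (by simp))) u
  rw [diff_comp φ ((hF' _).mdifferentiableAt (by simp))]
  exact sub_eq_zero.1 (h1.symm.trans h0)

end Potential

end HitchinWitten

namespace HitchinWitten

open VectorField

/-! ### Invariance under the symmetry group. -/

section Symmetries

variable {E : Type*} [NormedAddCommGroup E] [NormedSpace ℝ E] [FiniteDimensional ℝ E]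
  {M : Type*} [TopologicalSpace M] [ChartedSpace E M] [IsManifold 𝓘(ℝ, E) ∞ M] [T2Space M]
  {P : Type*} [NormedAddCommGroup P] [NormedSpace ℂ P]
  {S : Type*} [TopologicalSpace S] [ChartedSpace P S]
  {L : M → Type*} [∀ x, AddCommGroup (L x)] [∀ x, Module ℂ (L x)]
  [∀ x, TopologicalSpace (L x)] [∀ x, IsTopologicalAddGroup (L x)] [∀ x, ContinuousSMul ℝ (L x)]
  [TopologicalSpace (TotalSpace ℂ L)] [FiberBundle ℂ L] [VectorBundle ℝ ℂ L] [VectorBundle ℂ ℂ L]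
  [ContMDiffVectorBundle ∞ ℂ L 𝓘(ℝ, E)] {Ω : BilinField E M} {B : Prequantum L Ω} {k : ℕ}
  {J : S → EndField E M} {F : S → M → ℝ} {Γ : Type*} [Group Γ] [MulAction Γ M] [MulAction Γ S]
  (A : Symmetry (P := P) L Γ Ω B J)

namespace Symmetry

omit [T2Space M] [ContMDiffVectorBundle ∞ ℂ L 𝓘(ℝ, E)] in
/-- The action of `Γ` on sections preserves smoothness. -/
lemma exists_smoothSec_image (γ : Γ) {s : Π x, L x} (hs : SmoothSec (E := E) s) :
    ∃ s' : Π x, L x, SmoothSec (E := E) s' ∧ ∀ x, s' (γ • x) = A.act γ x (s x) := by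
  -- The image section at `y` lives in the fibre over `γ • γ⁻¹ • y`; in the total space the
  -- transport to the fibre over `y` disappears.
  have cast : ∀ {x y : M} (h : x = y) (a : L x),
      (⟨y, h ▸ a⟩ : TotalSpace ℂ L) = ⟨x, a⟩ := by
    intro x y h a
    subst h
    rfl
  let s' : Π x, L x := fun y => smul_inv_smul γ y ▸ A.act γ (γ⁻¹ • y) (s (γ⁻¹ • y))
  have e : ∀ y, (⟨y, s' y⟩ : TotalSpace ℂ L)
      = ⟨γ • γ⁻¹ • y, A.act γ (γ⁻¹ • y) (s (γ⁻¹ • y))⟩ := fun y => cast (smul_inv_smul γ y) _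
  refine ⟨s', ?_, fun x => ?_⟩
  · exact ((A.smooth_act γ).comp (hs.comp (A.smooth_base γ⁻¹))).congr e
  · have h1 := (e (γ • x)).trans
      (congrArg (fun z => (⟨γ • z, A.act γ z (s z)⟩ : TotalSpace ℂ L)) (inv_smul_smul γ x))
    exact (TotalSpace.mk_inj).1 h1

omit [T2Space M] [ContMDiffVectorBundle ∞ ℂ L 𝓘(ℝ, E)] in
lemma actPow_tpow (γ : Γ) (x : M) (a : L x) :
    A.actPow k γ x (tpow k a) = tpow k (A.act γ x a) :=
  PiTensorProduct.map_tprod _ _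

/-- The action of `Γ` preserves the connection on `L^k`. -/
theorem nabla_act (γ : Γ) {ψ ψ' : Sec L k} (hψ : SmoothPow (E := E) ψ)
    (h : ∀ x, ψ' (γ • x) = A.actPow k γ x (ψ x)) (x : M) (u : TangentSpace 𝓘(ℝ, E) x) :
    nabla B.conn ψ' (γ • x) (mfderiv 𝓘(ℝ, E) 𝓘(ℝ, E) (fun y : M => γ • y) x u)
      = A.actPow k γ x (nabla B.conn ψ x u) := by
  -- `conn_inv` speaks of global smooth sections, so the local frame is first extended. The action
  -- then carries `∇_u s = θ s` to the image section with the same `θ`, and `nabla_of_local` applies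
  -- to both.
  obtain ⟨s, hs, es⟩ := exists_smoothSec_eventuallyEq
    (eventually_smoothSecAt_frame (E := E) (L := L) x (mem_lbase x))
  obtain ⟨s', hs', es'⟩ := A.exists_smoothSec_image γ hs
  let c : M → ℂ := fun y => coord k x y (ψ y)
  let θ : ℂ := lcoord x x (B.conn s x u)
  have hθ : B.conn s x u = θ • s x := by
    rw [es.self_of_nhds]
    exact (lcoord_smul_frame (mem_lbase x) _).symm
  have hθ' : B.conn s' (γ • x) (mfderiv 𝓘(ℝ, E) 𝓘(ℝ, E) (fun y : M => γ • y) x u)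
      = θ • s' (γ • x) := by
    rw [A.conn_inv γ s s' hs hs' es', hθ, map_smul, es']
  have hc : MDifferentiableAt 𝓘(ℝ, E) 𝓘(ℝ, ℂ) c x := (hψ x).mdifferentiableAt (by simp)
  have hγ : MDifferentiableAt 𝓘(ℝ, E) 𝓘(ℝ, E) (fun y : M => γ • y) x :=
    (A.smooth_base γ x).mdifferentiableAt (by simp)
  have hγ' : MDifferentiableAt 𝓘(ℝ, E) 𝓘(ℝ, E) (fun y : M => γ⁻¹ • y) (γ • x) :=
    (A.smooth_base γ⁻¹ _).mdifferentiableAt (by simp)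
  have hc' : MDifferentiableAt 𝓘(ℝ, E) 𝓘(ℝ, ℂ) (fun y => c (γ⁻¹ • y)) (γ • x) := by
    refine MDifferentiableAt.comp (γ • x) (g := c) ?_ hγ'
    rwa [inv_smul_smul]
  have hψ1 : ∀ᶠ y in nhds x, ψ y = c y • tpow k (s y) := by
    filter_upwards [es, lbase_mem_nhds (mem_lbase (L := L) x)] with y h1 h2
    rw [h1]
    exact (coord_smul_tpow h2 (ψ y)).symm
  have hψ2 : ∀ᶠ z in nhds (γ • x), ψ' z = c (γ⁻¹ • z) • tpow k (s' z) := by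
    have h1 : Tendsto (fun z : M => γ⁻¹ • z) (nhds (γ • x)) (nhds x) := by
      have := hγ'.continuousAt.tendsto
      rwa [inv_smul_smul] at this
    filter_upwards [h1.eventually hψ1] with z hz
    obtain ⟨y, rfl⟩ : ∃ y, z = γ • y := ⟨γ⁻¹ • z, (smul_inv_smul γ z).symm⟩
    rw [inv_smul_smul] at hz ⊢
    rw [h, hz, map_smul, A.actPow_tpow, es']
  have hd : mvfderiv 𝓘(ℝ, E) (fun y => c (γ⁻¹ • y)) (γ • x)
      (mfderiv 𝓘(ℝ, E) 𝓘(ℝ, E) (fun y : M => γ • y) x u) = mvfderiv 𝓘(ℝ, E) c x u := by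
    have h1 := mfderiv_comp_apply x (g := fun y => c (γ⁻¹ • y)) hc' hγ u
    have h2 : (fun y => c (γ⁻¹ • y)) ∘ (fun y : M => γ • y) = c :=
      funext fun y => congrArg c (inv_smul_smul γ y)
    rw [h2] at h1
    exact h1.symm
  rw [nabla_of_local B (Eventually.of_forall fun y => hs y) hc hψ1 hθ,
    nabla_of_local B (Eventually.of_forall fun y => hs' y) hc' hψ2 hθ', map_smul, A.actPow_tpow,
    es', hd, inv_smul_smul]

/-- The diffeomorphism of `M` given by an element of `Γ`. -/
def diffeo (γ : Γ) : M ≃ₘ^(∞ : ℕ∞ω)⟮𝓘(ℝ, E), 𝓘(ℝ, E)⟯ M where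
  toEquiv := MulAction.toPerm γ
  contMDiff_toFun := A.smooth_base γ
  contMDiff_invFun := A.smooth_base γ⁻¹

variable [IsManifold 𝓘(ℝ, P) ∞ S] (hJ : IsKahlerFamily (P := P) Ω J) (hΩ : IsSymplectic Ω) (hH1 : TrivialH1 E M)
  (hfun : ∀ σ, OnlyConstHolFun (J σ)) {lam : ℝ} (hF : IsRicciPotential (P := P) Ω J lam F)
include hJ hΩ hH1 hfun hF

/-- The operators `firstSolution` attached to real functions are `Γ`-invariant. -/
lemma realSolution_act (γ : Γ) {f : M → ℝ} (hf : ContMDiff 𝓘(ℝ, E) 𝓘(ℝ, ℝ) ∞ f) (σ : S)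
    {ψ ψ' : Sec L k} (hψ : SmoothPow (E := E) ψ)
    (h : ∀ x, ψ' (γ • x) = A.actPow k γ x (ψ x)) (x : M) :
    realSolution B.conn Ω J F (fun y => f (γ⁻¹ • y)) (γ • σ) ψ' (γ • x)
      = A.actPow k γ x (realSolution B.conn Ω J F f σ ψ x) := by
  let φ : M ≃ₘ^(∞ : ℕ∞ω)⟮𝓘(ℝ, E), 𝓘(ℝ, E)⟯ M := A.diffeo γ
  have hφJ : ∀ x u, J (γ • σ) (φ x) (dmap φ x u) = dmap φ x (J σ x u) := A.equivariant γ σ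
  have hφΩ : ∀ x u v, Ω (φ x) (dmap φ x u) (dmap φ x v) = Ω x u v := A.symplectic γ
  have hc := hJ.isCompatible hΩ σ
  have hc' := hJ.isCompatible hΩ (γ • σ)
  have hf' : ContMDiff 𝓘(ℝ, E) 𝓘(ℝ, ℝ) ∞ (fun y => f (γ⁻¹ • y)) := hf.comp (A.smooth_base γ⁻¹)
  have ef : (fun y => f (γ⁻¹ • φ y)) = f := funext fun y => congrArg f (inv_smul_smul γ y)
  have hg := kahlerMetric_dmap hφJ hφΩ
  have h1 := grad_pull hg hc.isMetric hc'.isMetric (x := x)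
    ((hf' (φ x)).mdifferentiableAt (by simp))
  have h2 := laplacian_pull hg hc.isMetric hc'.isMetric hf' x
  rw [ef] at h1 h2
  -- `F` itself is only determined up to a constant for each `σ`, but `solutionPotential` involves
  -- it through `dF` alone.
  have h3 := diff_potential_dmap hφJ hφΩ hH1 (hfun σ) hc hc' (contMDiff_slice hF.smooth σ)
    (contMDiff_slice hF.smooth (γ • σ)) (hF.eq σ) (hF.eq (γ • σ)) x
    (grad (kahlerMetric Ω (J σ)) f x)
  rw [h1] at h3
  have h4 : solutionPotential Ω J F (fun y => f (γ⁻¹ • y)) (γ • σ) (γ • x)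
      = solutionPotential Ω J F f σ x :=
    congrArg₂ (fun a b : ℝ => 2 * a + b) h3 h2.symm
  have h5 := A.nabla_act γ hψ h x (grad (kahlerMetric Ω (J σ)) f x)
  have h6 : nabla B.conn ψ' (γ • x) (grad (kahlerMetric Ω (J (γ • σ))) (fun y => f (γ⁻¹ • y)) (γ • x))
      = A.actPow k γ x (nabla B.conn ψ x (grad (kahlerMetric Ω (J σ)) f x)) :=
    (congrArg (nabla B.conn ψ' (γ • x)) h1.symm).trans h5
  rw [realSolution_apply, realSolution_apply, h6, h4, h, map_smul, map_add, map_smul, map_smul]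

theorem invariant_firstSolution : A.Invariant (firstSolution (k := k) B.conn Ω J F) := by
  intro γ f hf σ ψ ψ' hψ h x
  rw [firstSolution_eq, firstSolution_eq]
  change realSolution B.conn Ω J F (fun y => (f (γ⁻¹ • y)).re) (γ • σ) ψ' (γ • x)
      + Complex.I • realSolution B.conn Ω J F (fun y => (f (γ⁻¹ • y)).im) (γ • σ) ψ' (γ • x)
    = A.actPow k γ x (realSolution B.conn Ω J F (fun y => (f y).re) σ ψ x
      + Complex.I • realSolution B.conn Ω J F (fun y => (f y).im) σ ψ x)
  rw [map_add, map_smul, ← A.realSolution_act hJ hΩ hH1 hfun hF γ (contMDiff_re hf) σ hψ h x,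
    ← A.realSolution_act hJ hΩ hH1 hfun hF γ (contMDiff_im hf) σ hψ h x]

end Symmetry

end Symmetries

end HitchinWitten

end

open HitchinWitten in
theorem theorem3
    {E : Type*} [NormedAddCommGroup E] [NormedSpace ℝ E] [FiniteDimensional ℝ E]
    {M : Type*} [TopologicalSpace M] [ChartedSpace E M] [IsManifold 𝓘(ℝ, E) ∞ M]
    [T2Space M] [SigmaCompactSpace M]
    {P : Type*} [NormedAddCommGroup P] [NormedSpace ℂ P] [FiniteDimensional ℂ P]
    {S : Type*} [TopologicalSpace S] [ChartedSpace P S] [IsManifold 𝓘(ℂ, P) ∞ S]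
    (Ω : BilinField E M) (hΩ : IsSymplectic Ω) (hH1 : TrivialH1 E M)
    (L : M → Type*) [∀ x, AddCommGroup (L x)] [∀ x, Module ℂ (L x)]
    [∀ x, TopologicalSpace (L x)] [∀ x, IsTopologicalAddGroup (L x)]
    [∀ x, ContinuousSMul ℝ (L x)]
    [TopologicalSpace (TotalSpace ℂ L)] [FiberBundle ℂ L] [VectorBundle ℝ ℂ L]
    [VectorBundle ℂ ℂ L] [ContMDiffVectorBundle ∞ ℂ L 𝓘(ℝ, E)]
    (B : Prequantum L Ω)
    (J : S → EndField E M) (hJ : IsKahlerFamily (P := P) Ω J)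
    (hfun : ∀ σ, OnlyConstHolFun (J σ)) (hvec : ∀ σ, OnlyZeroHolVec (J σ))
    (hhol : IsHolomorphicFamily (P := P) Ω J) (hrig : IsRigidFamily (P := P) Ω J)
    (lam : ℝ) (F : S → M → ℝ) (hF : IsRicciPotential (P := P) Ω J lam F)
    (Γ : Type*) [Group Γ] [MulAction Γ M] [MulAction Γ S]
    (A : Symmetry (P := P) L Γ Ω B J)
    (k : ℕ) (hk : 0 < k) :
    A.Invariant (firstSolution (k := k) B.conn Ω J F) ∧
    ∀ f : M → ℂ, ContMDiff 𝓘(ℝ, E) 𝓘(ℝ, ℂ) ∞ f →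
      SmoothFamily E P (firstSolution (k := k) B.conn Ω J F f) ∧
      (∀ σ, IsDiffOp E 1 (firstSolution (k := k) B.conn Ω J F f σ)) ∧
      ∀ (σ : S) (V : TangentSpace 𝓘(ℝ, P) σ),
        (∀ ψ : Sec L k, SmoothPow (E := E) ψ →
          twistedDeriv F (firstSolution B.conn Ω J F f) σ V ψ
            = (Complex.I / 2) •
                comm (bOp B.conn Ω J lam F σ V + bBarOp B.conn Ω J lam F σ V) (mulOp f) ψ) ∧
        IsLittleOInvLevel E (fun s : ℝ =>
          hwDeriv (k := k) B.conn Ω J lam F s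
            (fun τ => mulOp f + (1 / (s : ℂ)) • firstSolution B.conn Ω J F f τ) σ V) := by
  -- The results on families use the real manifold underlying the complex parameter space.
  have : IsManifold 𝓘(ℝ, P) ∞ S := isManifold_real
  exact ⟨A.invariant_firstSolution hJ hΩ hH1 hfun hF, fun f hf =>
    ⟨smoothFamily_firstSolution B hJ hΩ hF.smooth hf,
      isDiffOp_firstSolution B hJ hΩ hF.smooth hf, fun σ V =>
      ⟨fun ψ hψ => twistedDeriv_firstSolution B hJ hΩ hhol lam hF.smooth hf σ V hψ,
        isLittleOInvLevel_firstSolution B hJ hΩ hhol lam hF.smooth hf hk σ V⟩⟩⟩
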